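/- Let $n,l,m,d_\varphi,d_\eta\in\mathbb N$ and $T>0$, let $U\subset\mathbb R^l$ and $V\subset\mathbb R^m$ be open, and let $f_i:\mathbb R^{n+l}\to\mathbb R^n$ ($0\le i\le m$), $\varphi_i:\mathbb R^{2n}\to\mathbb R$ ($0\le i\le d_\varphi$) and $\eta_j:\mathbb R^{2n}\to\mathbb R$ ($1\le j\le d_\eta$) be functions with Lipschitz-continuous second order derivatives. Put $F(x,u,v):=f_0(x,u)+\sum_{i=1}^m v_if_i(x,u)$. Consider the problem (P) of minimizing $\varphi_0(x(0),x(T))$ over the feasible trajectories, i.e. over all $w=(x,u,v)\in\mathcal W:=W^{1,\infty}(0,T;\mathbb R^n)\times L^\infty(0,T;\mathbb R^l)\times L^\infty(0,T;\mathbb R^m)$ such that $$\dot x=F(x,u,v)\ \text{ a.e. on }[0,T],\qquad \eta_j(x(0),x(T))=0\ (1\le j\le d_\eta),\qquad \varphi_i(x(0),x(T))\le 0\ (1\le i\le d_\varphi),$$ and $u(t)\in U$, $v(t)\in V$ for a.e. $t\in[0,T]$. A feasible trajectory $\hat w=(\hat x,\hat u,\hat v)$ is a weak minimum if there is $\varepsilon>0$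 such that $\varphi_0(\hat x(0),\hat x(T))\le\varphi_0(x(0),x(T))$ for every feasible trajectory $(x,u,v)$ with $\|x-\hat x\|_\infty<\varepsilon$, $\|u-\hat u\|_\infty<\varepsilon$ and $\|v-\hat v\|_\infty<\varepsilon$. Fix a feasible trajectory $\hat w=(\hat x,\hat u,\hat v)$ with $\varphi_i(\hat x(0),\hat x(T))=0$ for $1\le i\le d_\varphi$, and suppose that for some $\delta>0$ the closed ball of radius $\delta$ around $(\hat u(t),\hat v(t))$ in $\mathbb R^{l+m}$ is contained in $U\times V$ for a.e. $t\in[0,T]$. For $\lambda=(\alpha,\beta,p)\in\mathbb R^{d_\varphi+1}\times\mathbb R^{d_\eta}\times W^{1,\infty}(0,T;\mathbb R^{n,*})$, where $\mathbb R^{n,*}$ is the space of row vectors, put $H[\lambda](x,u,v,t):=p(t)F(x,u,v)$ and $\ell[\lambda](x_0,x_T):=\sum_{i=0}^{d_\varphi}\alpha_i\varphi_i(x_0,x_T)+\sum_{j=1}^{d_\eta}\beta_j\eta_j(x_0,x_T)$. Below, derivatives of $F$ and $H[\lambda]$ are evaluated along $\hat w$ and those of $\ell[\lambda],\varphi_i,\eta_j$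 at $(\hat x(0),\hat x(T))$. Let $\Lambda$ be the set of Lagrange multipliers associated with $\hat w$, i.e. of those $\lambda$ for which $$\sum_{i=0}^{d_\varphi}|\alpha_i|+\sum_{j=1}^{d_\eta}|\beta_j|=1,\qquad \alpha_i\ge 0\ (0\le i\le d_\varphi),\qquad -\dot p=H_x[\lambda]\ \text{ a.e. on }[0,T],$$ $$p(0)=-D_{x_0}\ell[\lambda],\qquad p(T)=D_{x_T}\ell[\lambda],\qquad H_u[\lambda]=0\ \text{ and }\ H_v[\lambda]=0\ \text{ a.e. on }[0,T].$$ Let $\mathcal C_2$ be the set of all $\bar w=(\bar x,\bar u,\bar v)\in\mathcal W_2:=W^{1,2}(0,T;\mathbb R^n)\times L^2(0,T;\mathbb R^l)\times L^2(0,T;\mathbb R^m)$ such that $\dot{\bar x}=F_x\bar x+F_u\bar u+F_v\bar v$ a.e. on $[0,T]$, $D\eta_j(\bar x(0),\bar x(T))=0$ for $1\le j\le d_\eta$ and $D\varphi_i(\bar x(0),\bar x(T))\le 0$ for $0\le i\le d_\varphi$, and let $\mathcal C:=\mathcal C_2\cap\mathcal W$. For $\bar w\in\mathcal W_2$ put $$\Omega[\lambda](\bar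 x,\bar u,\bar v):=\tfrac12 D^2\ell[\lambda]\,(\bar x(0),\bar x(T))^2+\int_0^T\Big(\tfrac12\bar x^\top H_{xx}[\lambda]\bar x+\bar u^\top H_{ux}[\lambda]\bar x+\bar v^\top H_{vx}[\lambda]\bar x+\tfrac12\bar u^\top H_{uu}[\lambda]\bar u+\bar v^\top H_{vu}[\lambda]\bar u\Big)\,dt .$$ Theorem. If $\hat w$ is a weak minimum of (P), then $$\max_{\lambda\in\Lambda}\Omega[\lambda](\bar x,\bar u,\bar v)\ge 0\qquad\text{for all }(\bar x,\bar u,\bar v)\in\mathcal C,$$ and the same holds for all $(\bar x,\bar u,\bar v)\in\mathcal C_2$; in both cases the maximum is attained. -/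

import Mathlib

open MeasureTheory

noncomputable section

/-- The Euclidean space of column vectors of dimension `k`. -/
abbrev Vec (k : ℕ) : Type := EuclideanSpace ℝ (Fin k)

/-- Lebesgue measure on the interval `[0, T]`. -/
def timeMeasure (T : ℝ) : Measure ℝ := volume.restrict (Set.Icc 0 T)

/-- `MemW1 p T x`: the function `x`, restricted to `[0, T]`, is (the continuous representative of)
an element of the Sobolev space `W^{1,p}(0,T;E)`, that is, `x` and its derivative `g` are in `L^p`
and `x` is the indefinite integral of `g`. Being in `L^p` is automatic for `x` itself, as `x` is
continuous on the compact interval `[0, T]`. Values outside `[0, T]` play no role. -/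
def MemW1 {E : Type*} [NormedAddCommGroup E] [NormedSpace ℝ E] (p : ENNReal) (T : ℝ)
    (x : ℝ → E) : Prop :=
  ∃ g : ℝ → E, MemLp g p (timeMeasure T) ∧
    ∀ t ∈ Set.Icc 0 T, x t = x 0 + ∫ s in (0 : ℝ)..t, g s

/-- A triple `w = (x, u, v)` of functions of time: state, nonlinear control, affine control. -/
structure Triple (n l m : ℕ) where
  x : ℝ → Vec n
  u : ℝ → Vec l
  v : ℝ → Vec m

/-- Membership in `W^{1,p} × L^p × L^p`; the space `𝒲` is the case `p = ∞` and the space `𝒲₂` is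
the case `p = 2`. -/
def Triple.MemW {n l m : ℕ} (p : ENNReal) (T : ℝ) (w : Triple n l m) : Prop :=
  MemW1 p T w.x ∧ MemLp w.u p (timeMeasure T) ∧ MemLp w.v p (timeMeasure T)

/-- A function of class `C²` whose second order derivative is Lipschitz continuous. -/
def HasLipschitzSecondDeriv {E F : Type*} [NormedAddCommGroup E] [NormedSpace ℝ E]
    [NormedAddCommGroup F] [NormedSpace ℝ F] (g : E → F) : Prop :=
  ContDiff ℝ 2 g ∧ ∃ K : NNReal, LipschitzWith K (iteratedFDeriv ℝ 2 g)

/-- An element `λ = (α, β, p)`, where `p` takes values in the space of row vectors. -/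
structure Multiplier (n dφ dη : ℕ) where
  α : Fin (dφ + 1) → ℝ
  β : Fin dη → ℝ
  p : ℝ → (Vec n →L[ℝ] ℝ)

/-- The data of the optimal control problem: minimize `φ₀(x(0),x(T))` subject to
`ẋ = f₀(x,u) + ∑ i, vᵢ fᵢ(x,u)`, `η_j(x(0),x(T)) = 0` for all `j`, `φᵢ(x(0),x(T)) ≤ 0` for `i ≥ 1`,
`u(t) ∈ U`, `v(t) ∈ V`. The index `0` of `f` and `φ` is the one of `f₀` and `φ₀`. -/
structure ControlProblem (n l m dφ dη : ℕ) where
  T : ℝ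
  f : Fin (m + 1) → Vec n × Vec l → Vec n
  φ : Fin (dφ + 1) → Vec n × Vec n → ℝ
  η : Fin dη → Vec n × Vec n → ℝ
  U : Set (Vec l)
  V : Set (Vec m)

namespace ControlProblem

variable {n l m dφ dη : ℕ} (P : ControlProblem n l m dφ dη)

/-- All data functions have Lipschitz continuous second order derivatives. -/
def IsRegular : Prop :=
  (∀ i, HasLipschitzSecondDeriv (P.f i)) ∧ (∀ i, HasLipschitzSecondDeriv (P.φ i)) ∧
    ∀ j, HasLipschitzSecondDeriv (P.η j)

/-- The dynamics `F(x,u,v) = f₀(x,u) + ∑ i, vᵢ fᵢ(x,u)`. -/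
def F (x : Vec n) (u : Vec l) (v : Vec m) : Vec n :=
  P.f 0 (x, u) + ∑ i : Fin m, v i • P.f i.succ (x, u)

/-- The pair `(x(0), x(T))` of endpoints. -/
def endpoints (w : Triple n l m) : Vec n × Vec n := (w.x 0, w.x P.T)

/-- A trajectory: an element of `𝒲` that satisfies the state equation. -/
def IsTrajectory (w : Triple n l m) : Prop :=
  w.MemW ⊤ P.T ∧
    ∀ᵐ t ∂(timeMeasure P.T), HasDerivAt w.x (P.F (w.x t) (w.u t) (w.v t)) t

/-- A feasible trajectory. -/
def IsFeasible (w : Triple n l m) : Prop :=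
  P.IsTrajectory w ∧
    (∀ j, P.η j (P.endpoints w) = 0) ∧
    (∀ i : Fin dφ, P.φ i.succ (P.endpoints w) ≤ 0) ∧
    ∀ᵐ t ∂(timeMeasure P.T), w.u t ∈ P.U ∧ w.v t ∈ P.V

/-- A weak minimum: a feasible trajectory that is optimal among the feasible trajectories whose
three components are uniformly close to its own. -/
def IsWeakMin (wh : Triple n l m) : Prop :=
  P.IsFeasible wh ∧ ∃ ε : ℝ, 0 < ε ∧ ∀ w : Triple n l m, P.IsFeasible w →
    eLpNorm (fun t => w.x t - wh.x t) ⊤ (timeMeasure P.T) < ENNReal.ofReal ε →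
    eLpNorm (fun t => w.u t - wh.u t) ⊤ (timeMeasure P.T) < ENNReal.ofReal ε →
    eLpNorm (fun t => w.v t - wh.v t) ⊤ (timeMeasure P.T) < ENNReal.ofReal ε →
    P.φ 0 (P.endpoints wh) ≤ P.φ 0 (P.endpoints w)

/-- The controls do not accumulate at the boundary: for some `δ > 0`, the closed Euclidean ball of
radius `δ` around `(u(t), v(t))` is contained in `U × V` for almost all `t`. -/
def ControlsAwayFromBoundary (wh : Triple n l m) : Prop :=
  ∃ δ : ℝ, 0 < δ ∧ ∀ᵐ t ∂(timeMeasure P.T), ∀ (a : Vec l) (b : Vec m),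
    ‖a‖ ^ 2 + ‖b‖ ^ 2 ≤ δ ^ 2 → wh.u t + a ∈ P.U ∧ wh.v t + b ∈ P.V

/-- The unmaximized Hamiltonian `H[λ](x,u,v,t) = p(t) F(x,u,v)`. -/
def H (μ : Multiplier n dφ dη) (x : Vec n) (u : Vec l) (v : Vec m) (t : ℝ) : ℝ :=
  μ.p t (P.F x u v)

/-- The endpoint Lagrangian `ℓ[λ]`. -/
def endpointLagrangian (μ : Multiplier n dφ dη) (z : Vec n × Vec n) : ℝ :=
  ∑ i, μ.α i * P.φ i z + ∑ j, μ.β j * P.η j z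

/-- The derivative `H_x[λ]`. -/
def Hx (μ : Multiplier n dφ dη) (x : Vec n) (u : Vec l) (v : Vec m) (t : ℝ) : Vec n →L[ℝ] ℝ :=
  fderiv ℝ (fun y => P.H μ y u v t) x

/-- The derivative `H_u[λ]`. -/
def Hu (μ : Multiplier n dφ dη) (x : Vec n) (u : Vec l) (v : Vec m) (t : ℝ) : Vec l →L[ℝ] ℝ :=
  fderiv ℝ (fun y => P.H μ x y v t) u

/-- The derivative `H_v[λ]`. -/
def Hv (μ : Multiplier n dφ dη) (x : Vec n) (u : Vec l) (v : Vec m) (t : ℝ) : Vec m →L[ℝ] ℝ :=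
  fderiv ℝ (fun y => P.H μ x u y t) v

/-- The set `Λ` of Lagrange multipliers associated with the trajectory `wh`. -/
def multipliers (wh : Triple n l m) : Set (Multiplier n dφ dη) :=
  {μ | MemW1 ⊤ P.T μ.p ∧
    -- nontriviality and sign
    ∑ i, |μ.α i| + ∑ j, |μ.β j| = 1 ∧ (∀ i, 0 ≤ μ.α i) ∧
    -- costate equation
    (∀ᵐ t ∂(timeMeasure P.T), HasDerivAt μ.p (-(P.Hx μ (wh.x t) (wh.u t) (wh.v t) t)) t) ∧
    -- transversality conditions
    μ.p 0 = -(fderiv ℝ (fun y => P.endpointLagrangian μ (y, wh.x P.T)) (wh.x 0)) ∧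
    μ.p P.T = fderiv ℝ (fun y => P.endpointLagrangian μ (wh.x 0, y)) (wh.x P.T) ∧
    -- stationarity conditions
    ∀ᵐ t ∂(timeMeasure P.T), P.Hu μ (wh.x t) (wh.u t) (wh.v t) t = 0 ∧
      P.Hv μ (wh.x t) (wh.u t) (wh.v t) t = 0}

/-- The right-hand side `F_x x̄ + F_u ū + F_v v̄` of the linearized state equation at time `t`, the
derivatives being evaluated along `wh`. -/
def linearizedRHS (wh w : Triple n l m) (t : ℝ) : Vec n :=
  fderiv ℝ (fun y => P.F y (wh.u t) (wh.v t)) (wh.x t) (w.x t) +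
    fderiv ℝ (fun y => P.F (wh.x t) y (wh.v t)) (wh.u t) (w.u t) +
    fderiv ℝ (fun y => P.F (wh.x t) (wh.u t) y) (wh.v t) (w.v t)

/-- The critical cone `𝒞₂` in `𝒲₂`. The initial value of the state component is free. -/
def criticalConeL2 (wh : Triple n l m) : Set (Triple n l m) :=
  {w | w.MemW 2 P.T ∧
    (∀ᵐ t ∂(timeMeasure P.T), HasDerivAt w.x (P.linearizedRHS wh w t) t) ∧
    (∀ j, fderiv ℝ (P.η j) (P.endpoints wh) (P.endpoints w) = 0) ∧
    ∀ i, fderiv ℝ (P.φ i) (P.endpoints wh) (P.endpoints w) ≤ 0}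

/-- The critical cone `𝒞 = 𝒞₂ ∩ 𝒲`. -/
def criticalCone (wh : Triple n l m) : Set (Triple n l m) :=
  P.criticalConeL2 wh ∩ {w | w.MemW ⊤ P.T}

/-- The integrand of the second variation at time `t`. Second order derivatives of the Hamiltonian
are bilinear forms obtained by differentiating `H_x`, `H_u` and `H_v`: for instance `ūᵀ H_ux x̄` is
the derivative of `x ↦ H_u` in the direction `x̄`, applied to `ū`. -/
def secondVariationIntegrand (wh : Triple n l m) (μ : Multiplier n dφ dη) (w : Triple n l m)
    (t : ℝ) : ℝ :=
  (1 / 2 : ℝ) * fderiv ℝ (fun y => P.Hx μ y (wh.u t) (wh.v t) t) (wh.x t) (w.x t) (w.x t) +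
    fderiv ℝ (fun y => P.Hu μ y (wh.u t) (wh.v t) t) (wh.x t) (w.x t) (w.u t) +
    fderiv ℝ (fun y => P.Hv μ y (wh.u t) (wh.v t) t) (wh.x t) (w.x t) (w.v t) +
    (1 / 2 : ℝ) * fderiv ℝ (fun y => P.Hu μ (wh.x t) y (wh.v t) t) (wh.u t) (w.u t) (w.u t) +
    fderiv ℝ (fun y => P.Hv μ (wh.x t) y (wh.v t) t) (wh.u t) (w.u t) (w.v t)

/-- The second variation `Ω[λ](x̄,ū,v̄)` of the Lagrangian at `wh`. -/
def secondVariation (wh : Triple n l m) (μ : Multiplier n dφ dη) (w : Triple n l m) : ℝ :=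
  (1 / 2 : ℝ) * iteratedFDeriv ℝ 2 (P.endpointLagrangian μ) (P.endpoints wh)
      (fun _ => P.endpoints w) +
    ∫ t in (0 : ℝ)..P.T, P.secondVariationIntegrand wh μ w t

end ControlProblem

end

set_option linter.unusedSectionVars false

noncomputable section

open Set Filter Topology

/-! The two controls are merged into one control `c = (u, v)` of a system `ẋ = F(x, c)`. A direction
`q = (ξ, c)` in `E × L²`, an initial value and a control, determines the solution `state q` of the
linearized equation and a quadratic correction `second q`, which solves the linearized equation with
forcing `½ D²F (state q, c)²`. Along the curve `x̂ + s · state q₀ + s² (state q₁ + second q₀)` the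
state equation holds up to `o(s²)`, and a function `H` of the endpoints has first coefficient `lin H
q₀` and second coefficient `lin H q₁ + curv H q₀`.

Let `q₀` be critical with bounded control, and let `Φ` collect the cost and the inequality
constraints, all of which are active. Suppose that the linearized equality constraints are onto on
bounded directions, and that some bounded `q₁` makes the second coefficient vanish for the
equalities and be negative for every component of `Φ`. A Lyusternik correction of size `o(s²)`
(`exists_zero_near_of_approximatesLinearOn`, `exists_nearby_curve`) then produces genuine
trajectories, uniformly close to the reference, that satisfy the equalities and lower all of `Φ`
(`exists_nearby_decrease`). These are feasible with smaller cost, which contradicts weak minimality.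
So this affine system for `q₁` is unsolvable or the equalities are not onto, and finite dimensional
separation (`exists_multiplier_of_not_solvable`) gives a normalized `(α, β)` with `α ≥ 0` that
annihilates the linearized constraints and pairs nonnegatively with the curvature terms at `q₀`.

The passage to square integrable controls (`ReferenceTrajectory.exists_multiplier`) involves no
trajectories. The curvature terms are continuous in the `L²` topology, bounded directions are dense
in each fiber of the finite rank map `(lin Φ, lin H)` and hence respect criticality exactly, and the
normalized multipliers form a compact set.

Finally, `(α, β)` annihilates the linearized constraints exactly when it can be completed by a
costate to an element of `Λ` (`mem_normalizedMultipliers`, `exists_mem_multipliers`). Integrating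
the costate against `second q` turns the pairing with the curvature terms into `Ω`
(`secondVariation_eq_pairing`). The values of `Ω` on `Λ` are thus the values of a continuous
function on a compact set, so the maximum is attained. -/

instance isFiniteMeasure_timeMeasure (T : ℝ) : IsFiniteMeasure (timeMeasure T) := by
  unfold timeMeasure; infer_instance

/-! ### Integration on `[0, T]` as an operator into continuous functions -/

section Primitive

variable {E : Type*} [NormedAddCommGroup E] [NormedSpace ℝ E] {T : ℝ}

theorem ae_timeMeasure_mem (T : ℝ) : ∀ᵐ t ∂timeMeasure T, t ∈ Icc 0 T :=
  ae_restrict_mem measurableSet_Icc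

theorem timeMeasure_eq_Ioc (T : ℝ) : timeMeasure T = volume.restrict (Ioc 0 T) :=
  Measure.restrict_congr_set Ioc_ae_eq_Icc.symm

theorem intervalIntegrable_of_timeMeasure {b : ℝ → E} (hb : Integrable b (timeMeasure T)) {s t : ℝ}
    (hs : s ∈ Icc 0 T) (ht : t ∈ Icc 0 T) : IntervalIntegrable b volume s t := by
  rw [intervalIntegrable_iff]
  refine IntegrableOn.mono_set (t := Icc 0 T) hb (fun x hx => ?_)
  rw [mem_uIoc] at hx
  rcases hx with h | h
  · exact ⟨hs.1.trans h.1.le, h.2.trans ht.2⟩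
  · exact ⟨ht.1.trans h.1.le, h.2.trans hs.2⟩

theorem intervalIntegrable_iff_timeMeasure (hT : 0 ≤ T) {b : ℝ → E} :
    IntervalIntegrable b volume 0 T ↔ Integrable b (timeMeasure T) := by
  rw [intervalIntegrable_iff_integrableOn_Ioc_of_le hT, timeMeasure_eq_Ioc, IntegrableOn]

theorem intervalIntegral_eq_timeMeasure (hT : 0 ≤ T) (b : ℝ → E) :
    ∫ s in (0 : ℝ)..T, b s = ∫ s, b s ∂timeMeasure T := by
  rw [intervalIntegral.integral_of_le hT, timeMeasure_eq_Ioc]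

theorem intervalIntegral_congr_timeMeasure {b c : ℝ → E} (h : b =ᵐ[timeMeasure T] c) {t : ℝ}
    (ht : t ∈ Icc 0 T) : ∫ s in (0 : ℝ)..t, b s = ∫ s in (0 : ℝ)..t, c s := by
  refine intervalIntegral.integral_congr_ae ?_
  have := (ae_restrict_iff' measurableSet_Icc).1 h
  filter_upwards [this] with s hs hst
  rw [uIoc_of_le ht.1] at hst
  exact hs ⟨hst.1.le, hst.2.trans ht.2⟩

theorem norm_intervalIntegral_le_timeMeasure {b : ℝ → E} (hb : Integrable b (timeMeasure T)) {t : ℝ}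
    (ht : t ∈ Icc 0 T) : ‖∫ s in (0 : ℝ)..t, b s‖ ≤ ∫ s, ‖b s‖ ∂timeMeasure T := by
  rw [intervalIntegral.integral_of_le ht.1]
  refine (norm_integral_le_integral_norm _).trans ?_
  refine setIntegral_mono_set (s := Ioc 0 t) (t := Icc 0 T) hb.norm ?_ ?_
  · exact Eventually.of_forall fun _ => norm_nonneg _
  · exact LE.le.eventuallyLE fun x hx => ⟨hx.1.le, hx.2.trans ht.2⟩

theorem continuousOn_primitive_timeMeasure {b : ℝ → E} (hb : Integrable b (timeMeasure T)) :
    ContinuousOn (fun t => ∫ s in (0 : ℝ)..t, b s) (Icc 0 T) := by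
  rcases le_or_gt 0 T with hT | hT
  · have := intervalIntegral.continuousOn_primitive_interval (a := 0) (b := T) (μ := volume)
      (f := b) (by rw [uIcc_of_le hT]; exact hb)
    rwa [uIcc_of_le hT] at this
  · rw [Icc_eq_empty (not_le.2 hT)]
    exact continuousOn_empty _

open Classical in
/-- The primitive on `[0, T]` vanishing at `0`; it is zero if the function is not integrable. -/
def primitive (T : ℝ) (b : ℝ → E) : C(Icc 0 T, E) :=
  if hb : Integrable b (timeMeasure T) then
    ⟨fun t => ∫ s in (0 : ℝ)..t, b s, continuousOn_iff_continuous_domRestrict.1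
      (continuousOn_primitive_timeMeasure hb)⟩
  else 0

theorem primitive_apply {b : ℝ → E} (hb : Integrable b (timeMeasure T)) (t : Icc 0 T) :
    primitive T b t = ∫ s in (0 : ℝ)..t, b s := by
  rw [primitive, dif_pos hb]; rfl

theorem norm_primitive_le (b : ℝ → E) :
    ‖primitive T b‖ ≤ ∫ s, ‖b s‖ ∂timeMeasure T := by
  rw [ContinuousMap.norm_le _ (integral_nonneg fun _ => norm_nonneg _)]
  intro t
  by_cases hb : Integrable b (timeMeasure T)
  · rw [primitive_apply hb]
    exact norm_intervalIntegral_le_timeMeasure hb t.2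
  · rw [primitive, dif_neg hb]
    simpa using integral_nonneg fun _ => norm_nonneg _

theorem primitive_congr {b c : ℝ → E} (h : b =ᵐ[timeMeasure T] c) :
    primitive T b = primitive T c := by
  by_cases hb : Integrable b (timeMeasure T)
  · ext t
    rw [primitive_apply hb, primitive_apply (hb.congr h), intervalIntegral_congr_timeMeasure h t.2]
  · rw [primitive, primitive, dif_neg hb, dif_neg (fun h' => hb (h'.congr h.symm))]

theorem primitive_add {b c : ℝ → E} (hb : Integrable b (timeMeasure T))
    (hc : Integrable c (timeMeasure T)) :
    primitive T (fun t => b t + c t) = primitive T b + primitive T c := by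
  ext t
  have hbc : Integrable (fun t => b t + c t) (timeMeasure T) := hb.add hc
  rw [ContinuousMap.add_apply, primitive_apply hb, primitive_apply hc, primitive_apply hbc]
  have h0 : (0 : ℝ) ∈ Icc 0 T := ⟨le_rfl, t.2.1.trans t.2.2⟩
  exact intervalIntegral.integral_add (intervalIntegrable_of_timeMeasure hb h0 t.2)
    (intervalIntegrable_of_timeMeasure hc h0 t.2)

theorem primitive_smul {b : ℝ → E} (r : ℝ) (hb : Integrable b (timeMeasure T)) :
    primitive T (fun t => r • b t) = r • primitive T b := by
  ext t
  have hrb : Integrable (fun t => r • b t) (timeMeasure T) := hb.smul r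
  rw [ContinuousMap.smul_apply, primitive_apply hb, primitive_apply hrb]
  exact intervalIntegral.integral_smul _ _

/-- The primitive as a continuous linear map from `L¹`. -/
def primitiveL (T : ℝ) (E : Type*) [NormedAddCommGroup E] [NormedSpace ℝ E] :
    Lp E 1 (timeMeasure T) →L[ℝ] C(Icc 0 T, E) :=
  LinearMap.mkContinuous
    { toFun := fun b => primitive T b
      map_add' := fun b c => by
        rw [primitive_congr (Lp.coeFn_add b c)]
        exact primitive_add (L1.integrable_coeFn b) (L1.integrable_coeFn c)
      map_smul' := fun r b => by
        rw [primitive_congr (Lp.coeFn_smul r b)]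
        exact primitive_smul r (L1.integrable_coeFn b) } 1
    fun b => by
      rw [one_mul, L1.norm_eq_integral_norm]
      exact norm_primitive_le b

theorem primitiveL_apply (b : Lp E 1 (timeMeasure T)) : primitiveL T E b = primitive T b := rfl

/-- The extension of a function on `[0, T]` to the real line by constants. -/
def extendIcc (hT : 0 ≤ T) (x : C(Icc 0 T, E)) (t : ℝ) : E := x (projIcc 0 T hT t)

theorem extendIcc_of_mem (hT : 0 ≤ T) (x : C(Icc 0 T, E)) {t : ℝ} (ht : t ∈ Icc 0 T) :
    extendIcc hT x t = x ⟨t, ht⟩ := by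
  rw [extendIcc, projIcc_of_mem hT ht]

theorem continuous_extendIcc (hT : 0 ≤ T) (x : C(Icc 0 T, E)) : Continuous (extendIcc hT x) :=
  x.continuous.comp continuous_projIcc

theorem norm_extendIcc_le (hT : 0 ≤ T) (x : C(Icc 0 T, E)) (t : ℝ) : ‖extendIcc hT x t‖ ≤ ‖x‖ :=
  x.norm_coe_le_norm _

theorem aestronglyMeasurable_extendIcc (hT : 0 ≤ T) (x : C(Icc 0 T, E)) :
    AEStronglyMeasurable (extendIcc hT x) (timeMeasure T) :=
  (continuous_extendIcc hT x).aestronglyMeasurable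

theorem memLp_extendIcc (hT : 0 ≤ T) (x : C(Icc 0 T, E)) (p : ENNReal) :
    MemLp (extendIcc hT x) p (timeMeasure T) :=
  MemLp.of_bound (aestronglyMeasurable_extendIcc hT x) ‖x‖
    (Eventually.of_forall (norm_extendIcc_le hT x))

/-- The embedding of the continuous functions into `L^p`. -/
def extendIccL (hT : 0 ≤ T) (E : Type*) [NormedAddCommGroup E] [NormedSpace ℝ E] (p : ENNReal)
    [Fact (1 ≤ p)] : C(Icc 0 T, E) →L[ℝ] Lp E p (timeMeasure T) :=
  LinearMap.mkContinuous
    { toFun := fun x => (memLp_extendIcc hT x p).toLp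
      map_add' := fun x y => by
        rw [← MemLp.toLp_add]; rfl
      map_smul' := fun r x => by
        rw [RingHom.id_apply, ← MemLp.toLp_const_smul]; rfl }
    ((measureUnivNNReal (timeMeasure T) : ℝ) ^ p.toReal⁻¹)
    fun x => by
      refine Lp.norm_le_of_ae_bound (norm_nonneg x) ?_
      filter_upwards [(memLp_extendIcc hT x p).coeFn_toLp] with t ht
      simp only [LinearMap.coe_mk, AddHom.coe_mk, ht]
      exact norm_extendIcc_le hT x t

theorem coeFn_extendIccL (hT : 0 ≤ T) (p : ENNReal) [Fact (1 ≤ p)] (x : C(Icc 0 T, E)) :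
    extendIccL hT E p x =ᵐ[timeMeasure T] extendIcc hT x :=
  (memLp_extendIcc hT x p).coeFn_toLp

end Primitive

/-! ### Linear Volterra equations with bounded measurable coefficients -/

section Volterra

variable {E : Type*} [NormedAddCommGroup E] [NormedSpace ℝ E] {T : ℝ}

/-- The Volterra operator `x ↦ ∫₀ᵗ A x` with bounded measurable coefficient `A`. -/
def volterra (hT : 0 ≤ T) (A : Lp (E →L[ℝ] E) ⊤ (timeMeasure T)) :
    C(Icc 0 T, E) →L[ℝ] C(Icc 0 T, E) :=
  primitiveL T E ∘L ((ContinuousLinearMap.id ℝ (E →L[ℝ] E)).holderL (timeMeasure T) ⊤ 1 1 A) ∘L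
    extendIccL hT E 1

theorem coeFn_holder_extendIccL (hT : 0 ≤ T) (A : Lp (E →L[ℝ] E) ⊤ (timeMeasure T))
    (x : C(Icc 0 T, E)) :
    (ContinuousLinearMap.id ℝ (E →L[ℝ] E)).holder 1 A (extendIccL hT E 1 x) =ᵐ[timeMeasure T]
      fun t => A t (extendIcc hT x t) := by
  filter_upwards [ContinuousLinearMap.coeFn_holder (r := 1) (ContinuousLinearMap.id ℝ (E →L[ℝ] E)) A
    (extendIccL hT E 1 x), coeFn_extendIccL hT 1 x] with t h1 h2
  rw [h1, h2]; rfl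

theorem integrable_volterra (hT : 0 ≤ T) (A : Lp (E →L[ℝ] E) ⊤ (timeMeasure T))
    (x : C(Icc 0 T, E)) : Integrable (fun t => A t (extendIcc hT x t)) (timeMeasure T) :=
  (L1.integrable_coeFn _).congr (coeFn_holder_extendIccL hT A x)

theorem volterra_eq_primitive (hT : 0 ≤ T) (A : Lp (E →L[ℝ] E) ⊤ (timeMeasure T))
    (x : C(Icc 0 T, E)) : volterra hT A x = primitive T (fun t => A t (extendIcc hT x t)) :=
  primitive_congr (coeFn_holder_extendIccL hT A x)

theorem ae_norm_le_norm_Lp_top {F : Type*} [NormedAddCommGroup F]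
    (A : Lp F ⊤ (timeMeasure T)) :
    ∀ᵐ t ∂timeMeasure T, ‖A t‖ ≤ ‖A‖ := by
  filter_upwards [ae_le_eLpNormEssSup (f := A) (μ := timeMeasure T)] with t ht
  rw [Lp.norm_def, eLpNorm_exponent_top, ← toReal_enorm]
  refine ENNReal.toReal_mono ?_ ht
  rw [← eLpNorm_exponent_top]
  exact (Lp.memLp A).2.ne

/-- Each iteration integrates the previous bound once more, which creates the factorial. Some power
of the operator is then a contraction, without any smallness of `T` or `‖A‖`. -/
theorem norm_volterra_pow_apply_le (hT : 0 ≤ T) (A : Lp (E →L[ℝ] E) ⊤ (timeMeasure T)) (k : ℕ)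
    (x : C(Icc 0 T, E)) (t : Icc 0 T) :
    ‖(volterra hT A ^ k) x t‖ ≤ (‖A‖ * t) ^ k / k.factorial * ‖x‖ := by
  induction k generalizing t with
  | zero => simpa using x.norm_coe_le_norm t
  | succ k ih =>
    rw [pow_succ', mul_apply_eq_comp, volterra_eq_primitive,
      primitive_apply (integrable_volterra hT A _)]
    have hM := (ae_restrict_iff' measurableSet_Icc).1 (ae_norm_le_norm_Lp_top A)
    have h1 : ‖∫ s in (0 : ℝ)..t, A s (extendIcc hT ((volterra hT A ^ k) x) s)‖ ≤
        ∫ s in (0 : ℝ)..t, ‖A‖ * ((‖A‖ * s) ^ k / k.factorial * ‖x‖) := by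
      refine intervalIntegral.norm_integral_le_of_norm_le t.2.1 ?_ ?_
      · filter_upwards [hM] with s hs hst
        have hs' : s ∈ Icc 0 T := ⟨hst.1.le, hst.2.trans t.2.2⟩
        refine (ContinuousLinearMap.le_opNorm _ _).trans ?_
        rw [extendIcc_of_mem hT _ hs']
        exact mul_le_mul (hs hs') (ih ⟨s, hs'⟩) (norm_nonneg _) (norm_nonneg _)
      · exact Continuous.intervalIntegrable (by fun_prop) _ _
    refine h1.trans (le_of_eq ?_)
    have : (fun s : ℝ => ‖A‖ * ((‖A‖ * s) ^ k / k.factorial * ‖x‖)) =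
        fun s => (‖A‖ ^ (k + 1) / k.factorial * ‖x‖) * s ^ k := by
      funext s; ring
    rw [this, intervalIntegral.integral_const_mul, integral_pow, Nat.factorial_succ]
    push_cast
    rw [mul_pow]
    field_simp
    simp

/-- For large `k` the element `1 - V ^ k` is invertible by the Neumann series. It is the product of
`1 - V` with the commuting factor `∑ V ^ i`, and commuting factors of a unit are units. -/
theorem isUnit_one_sub_volterra (hT : 0 ≤ T) [CompleteSpace E]
    (A : Lp (E →L[ℝ] E) ⊤ (timeMeasure T)) :
    IsUnit (1 - volterra hT A) := by
  have hlim := FloorSemiring.tendsto_pow_div_factorial_atTop (‖A‖ * T)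
  obtain ⟨k, hk⟩ := (hlim.eventually (gt_mem_nhds (zero_lt_one))).exists
  have hnorm : ‖volterra hT A ^ k‖ < 1 := by
    refine lt_of_le_of_lt ?_ hk
    have h0 : 0 ≤ (‖A‖ * T) ^ k / (k.factorial : ℝ) := by positivity
    refine ContinuousLinearMap.opNorm_le_bound _ h0 fun x => ?_
    rw [ContinuousMap.norm_le _ (by positivity)]
    intro t
    refine (norm_volterra_pow_apply_le hT A k x t).trans ?_
    have := t.2.1
    have := t.2.2
    gcongr
  have hu : IsUnit (1 - volterra hT A ^ k) := by
    exact isUnit_one_sub_of_norm_lt_one (R := C(Icc 0 T, E) →L[ℝ] C(Icc 0 T, E)) hnorm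
  rw [← mul_neg_geom_sum] at hu
  have hc : Commute (1 - volterra hT A) (∑ i ∈ Finset.range k, volterra hT A ^ i) := by
    refine Commute.sum_right _ _ _ fun i _ => ?_
    exact ((Commute.one_left _).sub_left (Commute.refl _)).pow_right i
  exact (hc.isUnit_mul_iff.1 hu).1

/-- The solution operator `y ↦ x` of the linear Volterra equation `x(t) = y(t) + ∫₀ᵗ A x`. -/
def volterraResolvent (hT : 0 ≤ T) (A : Lp (E →L[ℝ] E) ⊤ (timeMeasure T)) :
    C(Icc 0 T, E) →L[ℝ] C(Icc 0 T, E) :=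
  Ring.inverse (1 - volterra hT A)

variable [CompleteSpace E]

theorem volterraResolvent_eq (hT : 0 ≤ T) (A : Lp (E →L[ℝ] E) ⊤ (timeMeasure T))
    (y : C(Icc 0 T, E)) :
    volterraResolvent hT A y = y + volterra hT A (volterraResolvent hT A y) := by
  have h := Ring.mul_inverse_cancel _ (isUnit_one_sub_volterra hT A)
  have h2 := congrArg (fun L => L y) h
  simp only [mul_apply_eq_comp, sub_apply,
    one_apply_eq_self] at h2
  rw [volterraResolvent, ← sub_eq_iff_eq_add]
  exact h2

/-- Uniqueness for the Volterra equation; it identifies a given solution of the linearized equation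
with `state`. -/
theorem eq_volterraResolvent (hT : 0 ≤ T) (A : Lp (E →L[ℝ] E) ⊤ (timeMeasure T))
    {x y : C(Icc 0 T, E)}
    (h : x = y + volterra hT A x) : x = volterraResolvent hT A y := by
  have h1 := Ring.inverse_mul_cancel _ (isUnit_one_sub_volterra hT A)
  have h2 := congrArg (fun L => L x) h1
  simp only [mul_apply_eq_comp, sub_apply,
    one_apply_eq_self] at h2
  rw [volterraResolvent, ← h2]
  congr 1
  exact sub_eq_iff_eq_add.2 h

end Volterra

/-! ### The linearized state equation and the quadratic correction of the state -/

/-- A bounded trajectory `(x, c)` of a control system `ẋ = F (x, c)`, around which the system is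
expanded. -/
structure ReferenceTrajectory (E C : Type*) [NormedAddCommGroup E] [NormedSpace ℝ E]
    [NormedAddCommGroup C] [NormedSpace ℝ C] (T : ℝ) where
  hT : 0 ≤ T
  F : E × C → E
  contDiff : ContDiff ℝ 2 F
  x : C(Icc 0 T, E)
  c : ℝ → C
  measurable_c : AEStronglyMeasurable c (timeMeasure T)
  bounded_c : ∃ M : ℝ, ∀ᵐ t ∂timeMeasure T, ‖c t‖ ≤ M
  x_eq : x = ContinuousMap.const _ (x ⟨0, le_rfl, hT⟩) +
    primitive T (fun t => F (extendIcc hT x t, c t))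

namespace ReferenceTrajectory

variable {E C : Type*} [NormedAddCommGroup E] [NormedSpace ℝ E] [NormedAddCommGroup C]
  [NormedSpace ℝ C] {T : ℝ} (R : ReferenceTrajectory E C T)

/-- The value `(x t, c t)` of the reference trajectory. -/
def pt (t : ℝ) : E × C := (extendIcc R.hT R.x t, R.c t)

theorem aestronglyMeasurable_pt : AEStronglyMeasurable R.pt (timeMeasure T) :=
  (aestronglyMeasurable_extendIcc R.hT R.x).prodMk R.measurable_c

theorem exists_bound_pt : ∃ M : ℝ, 0 ≤ M ∧ ∀ᵐ t ∂timeMeasure T, ‖R.pt t‖ ≤ M := by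
  obtain ⟨M, hM⟩ := R.bounded_c
  refine ⟨max ‖R.x‖ M, le_max_of_le_left (norm_nonneg _), ?_⟩
  filter_upwards [hM] with t ht
  exact max_le_max (norm_extendIcc_le _ _ _) ht

/-- A function with values in a product that is bounded and measurable stays so under composition
with a continuous map. -/
theorem memLp_comp_of_bounded {W Y : Type*} [NormedAddCommGroup W] [ProperSpace W]
    [NormedAddCommGroup Y] {G : W → Y} (hG : Continuous G) {f : ℝ → W}
    (hf : AEStronglyMeasurable f (timeMeasure T)) {M : ℝ}
    (hM : ∀ᵐ t ∂timeMeasure T, ‖f t‖ ≤ M) (p : ENNReal) :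
    MemLp (fun t => G (f t)) p (timeMeasure T) := by
  obtain ⟨K, hK⟩ := (isCompact_closedBall (0 : W) M).exists_bound_of_continuousOn hG.continuousOn
  refine MemLp.of_bound (hG.comp_aestronglyMeasurable hf) K ?_
  filter_upwards [hM] with t ht
  exact hK _ (mem_closedBall_zero_iff.2 ht)

variable [FiniteDimensional ℝ E] [FiniteDimensional ℝ C]

theorem memLp_comp_pt {Y : Type*} [NormedAddCommGroup Y] {G : E × C → Y} (hG : Continuous G)
    (p : ENNReal) : MemLp (fun t => G (R.pt t)) p (timeMeasure T) := by
  obtain ⟨M, -, hM⟩ := R.exists_bound_pt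
  have := FiniteDimensional.proper ℝ (E × C)
  exact memLp_comp_of_bounded hG R.aestronglyMeasurable_pt hM p

theorem continuous_fderiv : Continuous (fderiv ℝ R.F) :=
  R.contDiff.continuous_fderiv (by norm_num)

theorem contDiff_fderiv : ContDiff ℝ 1 (fderiv ℝ R.F) :=
  R.contDiff.fderiv_right (by norm_num)

theorem continuous_fderiv_fderiv : Continuous (fderiv ℝ (fderiv ℝ R.F)) :=
  R.contDiff_fderiv.continuous_fderiv (by norm_num)

/-- The coefficient `F_x` of the linearized equation. -/
def A : Lp (E →L[ℝ] E) ⊤ (timeMeasure T) :=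
  (R.memLp_comp_pt (G := fun w => (fderiv ℝ R.F w).comp (ContinuousLinearMap.inl ℝ E C))
    (R.continuous_fderiv.clm_comp continuous_const) ⊤).toLp

/-- The coefficient `F_c` of the linearized equation. -/
def B : Lp (C →L[ℝ] E) 2 (timeMeasure T) :=
  (R.memLp_comp_pt (G := fun w => (fderiv ℝ R.F w).comp (ContinuousLinearMap.inr ℝ E C))
    (R.continuous_fderiv.clm_comp continuous_const) 2).toLp

/-- The second derivative of `F` along the reference trajectory. -/
def D₂ : Lp (E × C →L[ℝ] E × C →L[ℝ] E) ⊤ (timeMeasure T) :=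
  (R.memLp_comp_pt R.continuous_fderiv_fderiv ⊤).toLp

theorem coeFn_A : R.A =ᵐ[timeMeasure T]
    fun t => (fderiv ℝ R.F (R.pt t)).comp (ContinuousLinearMap.inl ℝ E C) :=
  MemLp.coeFn_toLp _

theorem coeFn_B : R.B =ᵐ[timeMeasure T]
    fun t => (fderiv ℝ R.F (R.pt t)).comp (ContinuousLinearMap.inr ℝ E C) :=
  MemLp.coeFn_toLp _

theorem coeFn_D₂ : R.D₂ =ᵐ[timeMeasure T] fun t => fderiv ℝ (fderiv ℝ R.F) (R.pt t) :=
  MemLp.coeFn_toLp _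

/-- The forcing term `F_c c` of the linearized equation. -/
def forcing : Lp C 2 (timeMeasure T) →L[ℝ] Lp E 1 (timeMeasure T) :=
  (ContinuousLinearMap.id ℝ (C →L[ℝ] E)).holderL (timeMeasure T) 2 2 1 R.B

theorem coeFn_forcing (c : Lp C 2 (timeMeasure T)) : R.forcing c =ᵐ[timeMeasure T]
    fun t => fderiv ℝ R.F (R.pt t) (0, c t) := by
  have h := ContinuousLinearMap.coeFn_holder (r := 1) (ContinuousLinearMap.id ℝ (C →L[ℝ] E)) R.B c
  filter_upwards [h, R.coeFn_B] with t h1 h2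
  rw [forcing, ContinuousLinearMap.holderL_apply_apply, h1, h2]; rfl

/-- The state of the linearized system with given initial value and control. -/
def state : E × Lp C 2 (timeMeasure T) →L[ℝ] C(Icc 0 T, E) :=
  volterraResolvent R.hT R.A ∘L
    (ContinuousLinearMap.const ℝ (Icc 0 T) ∘L ContinuousLinearMap.fst ℝ _ _ +
      primitiveL T E ∘L R.forcing ∘L ContinuousLinearMap.snd ℝ _ _)

theorem coeFn_A_apply (x : C(Icc 0 T, E)) : (fun t => R.A t (extendIcc R.hT x t)) =ᵐ[timeMeasure T]
    fun t => fderiv ℝ R.F (R.pt t) (extendIcc R.hT x t, 0) := by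
  filter_upwards [R.coeFn_A] with t ht
  rw [ht]; rfl

theorem volterra_A_eq (x : C(Icc 0 T, E)) : volterra R.hT R.A x =
    primitive T (fun t => fderiv ℝ R.F (R.pt t) (extendIcc R.hT x t, 0)) := by
  rw [volterra_eq_primitive, primitive_congr (R.coeFn_A_apply x)]

theorem integrable_A_apply (x : C(Icc 0 T, E)) :
    Integrable (fun t => fderiv ℝ R.F (R.pt t) (extendIcc R.hT x t, 0)) (timeMeasure T) :=
  (integrable_volterra R.hT R.A x).congr (R.coeFn_A_apply x)

theorem integrable_forcing (c : Lp C 2 (timeMeasure T)) :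
    Integrable (fun t => fderiv ℝ R.F (R.pt t) (0, c t)) (timeMeasure T) :=
  (L1.integrable_coeFn _).congr (R.coeFn_forcing c)

theorem integrable_linearized (x : C(Icc 0 T, E)) (c : Lp C 2 (timeMeasure T)) :
    Integrable (fun t => fderiv ℝ R.F (R.pt t) (extendIcc R.hT x t, c t)) (timeMeasure T) := by
  refine ((R.integrable_A_apply x).add (R.integrable_forcing c)).congr
    (Eventually.of_forall fun t => ?_)
  simp only [Pi.add_apply]
  rw [← map_add]; simp

theorem primitive_linearized (x : C(Icc 0 T, E)) (c : Lp C 2 (timeMeasure T)) :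
    primitive T (fun t => fderiv ℝ R.F (R.pt t) (extendIcc R.hT x t, c t)) =
      primitiveL T E (R.forcing c) + volterra R.hT R.A x := by
  rw [volterra_A_eq, primitiveL_apply, primitive_congr (R.coeFn_forcing c),
    ← primitive_add (R.integrable_forcing c) (R.integrable_A_apply x)]
  congr 1
  funext t
  rw [← map_add]; simp

theorem state_eq (q : E × Lp C 2 (timeMeasure T)) :
    R.state q = ContinuousMap.const _ q.1 + primitive T
      (fun t => fderiv ℝ R.F (R.pt t) (extendIcc R.hT (R.state q) t, q.2 t)) := by
  have := FiniteDimensional.complete ℝ E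
  rw [primitive_linearized, ← add_assoc]
  exact volterraResolvent_eq R.hT R.A _

theorem eq_state {x : C(Icc 0 T, E)} {ξ : E} {c : Lp C 2 (timeMeasure T)}
    (h : x = ContinuousMap.const _ ξ + primitive T
      (fun t => fderiv ℝ R.F (R.pt t) (extendIcc R.hT x t, c t))) : x = R.state (ξ, c) := by
  have := FiniteDimensional.complete ℝ E
  rw [primitive_linearized, ← add_assoc] at h
  exact eq_volterraResolvent R.hT R.A h

/-- The pair of the linearized state and the control, as a square integrable function. -/
def pair : E × Lp C 2 (timeMeasure T) →L[ℝ] Lp (E × C) 2 (timeMeasure T) :=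
  (ContinuousLinearMap.inl ℝ E C).compLpL 2 (timeMeasure T) ∘L extendIccL R.hT E 2 ∘L R.state +
    (ContinuousLinearMap.inr ℝ E C).compLpL 2 (timeMeasure T) ∘L ContinuousLinearMap.snd ℝ _ _

theorem coeFn_pair (q : E × Lp C 2 (timeMeasure T)) :
    R.pair q =ᵐ[timeMeasure T] fun t => (extendIcc R.hT (R.state q) t, q.2 t) := by
  have h1 := Lp.coeFn_add ((ContinuousLinearMap.inl ℝ E C).compLpL 2 (timeMeasure T)
    (extendIccL R.hT E 2 (R.state q))) ((ContinuousLinearMap.inr ℝ E C).compLpL 2 (timeMeasure T)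
    q.2)
  filter_upwards [h1, (ContinuousLinearMap.inl ℝ E C).coeFn_compLpL
    (extendIccL R.hT E 2 (R.state q)), (ContinuousLinearMap.inr ℝ E C).coeFn_compLpL q.2,
    coeFn_extendIccL R.hT 2 (R.state q)] with t h1 h2 h3 h4
  simp only [pair, add_apply, ContinuousLinearMap.comp_apply,
    ContinuousLinearMap.coe_snd']
  rw [h1, Pi.add_apply, h2, h3, h4]
  simp

/-- The pointwise application of a function with values in the continuous linear maps, as a
bilinear map on `L^p` spaces. -/
def applyLp {X Y : Type*} [NormedAddCommGroup X] [NormedSpace ℝ X] [NormedAddCommGroup Y]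
    [NormedSpace ℝ Y] (p q r : ENNReal) [Fact (1 ≤ p)] [Fact (1 ≤ q)] [Fact (1 ≤ r)]
    [ENNReal.HolderTriple p q r] : Lp (X →L[ℝ] Y) p (timeMeasure T) →L[ℝ]
      Lp X q (timeMeasure T) →L[ℝ] Lp Y r (timeMeasure T) :=
  (ContinuousLinearMap.id ℝ (X →L[ℝ] Y)).holderL (timeMeasure T) p q r

theorem coeFn_applyLp {X Y : Type*} [NormedAddCommGroup X] [NormedSpace ℝ X]
    [NormedAddCommGroup Y] [NormedSpace ℝ Y] (p q r : ENNReal) [Fact (1 ≤ p)] [Fact (1 ≤ q)]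
    [Fact (1 ≤ r)] [ENNReal.HolderTriple p q r] (L : Lp (X →L[ℝ] Y) p (timeMeasure T))
    (f : Lp X q (timeMeasure T)) :
    applyLp p q r L f =ᵐ[timeMeasure T] fun t => L t (f t) :=
  ContinuousLinearMap.coeFn_holder (r := r) (ContinuousLinearMap.id ℝ (X →L[ℝ] Y)) L f

/-- The quadratic term `D²F (x, c)²` of the expansion of the dynamics. -/
def quad (q : E × Lp C 2 (timeMeasure T)) : Lp E 1 (timeMeasure T) :=
  applyLp 2 2 1 (applyLp ⊤ 2 2 R.D₂ (R.pair q)) (R.pair q)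

/-- `D²F` is bounded along the reference, so the quadratic term is a bounded bilinear map `L² × L² →
L¹` on the diagonal. This `L²` continuity is what later extends the second order condition to
unbounded controls. -/
theorem continuous_quad : Continuous R.quad := by
  unfold quad
  fun_prop

theorem coeFn_quad (q : E × Lp C 2 (timeMeasure T)) : R.quad q =ᵐ[timeMeasure T]
    fun t => fderiv ℝ (fderiv ℝ R.F) (R.pt t) (extendIcc R.hT (R.state q) t, q.2 t)
      (extendIcc R.hT (R.state q) t, q.2 t) := by
  filter_upwards [coeFn_applyLp ⊤ 2 2 R.D₂ (R.pair q),
    coeFn_applyLp 2 2 1 (applyLp ⊤ 2 2 R.D₂ (R.pair q)) (R.pair q), R.coeFn_pair q, R.coeFn_D₂]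
    with t h1 h2 h3 h4
  rw [quad, h2, h1, h3, h4]

/-- The second order correction of the state: the solution with initial value zero of the
linearized equation with forcing term `1/2 D²F (x, c)²`. -/
def second (q : E × Lp C 2 (timeMeasure T)) : C(Icc 0 T, E) :=
  volterraResolvent R.hT R.A (primitiveL T E ((1 / 2 : ℝ) • R.quad q))

theorem continuous_second : Continuous R.second :=
  (volterraResolvent R.hT R.A).continuous.comp
    ((primitiveL T E).continuous.comp
      ((continuous_const_smul (1 / 2 : ℝ)).comp R.continuous_quad))

theorem integrable_quad (q : E × Lp C 2 (timeMeasure T)) : Integrable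
    (fun t => (1 / 2 : ℝ) • fderiv ℝ (fderiv ℝ R.F) (R.pt t)
      (extendIcc R.hT (R.state q) t, q.2 t) (extendIcc R.hT (R.state q) t, q.2 t))
    (timeMeasure T) :=
  ((L1.integrable_coeFn _).congr (R.coeFn_quad q)).smul _

theorem second_eq (q : E × Lp C 2 (timeMeasure T)) : R.second q = primitive T
    (fun t => fderiv ℝ R.F (R.pt t) (extendIcc R.hT (R.second q) t, 0) +
      (1 / 2 : ℝ) • fderiv ℝ (fderiv ℝ R.F) (R.pt t)
        (extendIcc R.hT (R.state q) t, q.2 t) (extendIcc R.hT (R.state q) t, q.2 t)) := by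
  have := FiniteDimensional.complete ℝ E
  rw [primitive_add (R.integrable_A_apply _) (R.integrable_quad q), ← volterra_A_eq, add_comm]
  refine (volterraResolvent_eq R.hT R.A _).trans ?_
  congr 1
  rw [primitiveL_apply]
  refine primitive_congr ?_
  filter_upwards [Lp.coeFn_smul (1 / 2 : ℝ) (R.quad q), R.coeFn_quad q] with t h1 h2
  rw [h1, Pi.smul_apply, h2]

/-- The pair of the endpoints of a continuous function. -/
def ends (hT : 0 ≤ T) (E : Type*) [NormedAddCommGroup E] [NormedSpace ℝ E] :
    C(Icc 0 T, E) →L[ℝ] E × E :=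
  (ContinuousMap.evalCLM ℝ (⟨0, le_rfl, hT⟩ : Icc 0 T)).prod
    (ContinuousMap.evalCLM ℝ (⟨T, hT, le_rfl⟩ : Icc 0 T))

theorem ends_apply (hT : 0 ≤ T) (x : C(Icc 0 T, E)) :
    ends hT E x = (x ⟨0, le_rfl, hT⟩, x ⟨T, hT, le_rfl⟩) := rfl

theorem primitive_zero (hT : 0 ≤ T) (b : ℝ → E) : primitive T b ⟨0, le_rfl, hT⟩ = 0 := by
  by_cases hb : Integrable b (timeMeasure T)
  · rw [primitive_apply hb]; simp
  · rw [primitive, dif_neg hb]; rfl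

theorem state_zero (q : E × Lp C 2 (timeMeasure T)) : R.state q ⟨0, le_rfl, R.hT⟩ = q.1 := by
  rw [state_eq, ContinuousMap.add_apply, primitive_zero R.hT]; simp

theorem second_zero (q : E × Lp C 2 (timeMeasure T)) : R.second q ⟨0, le_rfl, R.hT⟩ = 0 := by
  rw [second_eq, primitive_zero R.hT]

end ReferenceTrajectory

/-! ### Taylor expansions uniform on bounded sets -/

section Taylor

variable {X Y : Type*} [NormedAddCommGroup X] [NormedSpace ℝ X] [FiniteDimensional ℝ X]
  [NormedAddCommGroup Y] [NormedSpace ℝ Y]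

/-- Strict differentiability of a `C¹` map, uniformly on bounded sets. -/
theorem exists_strict_approx {f : X → Y} (hf : ContDiff ℝ 1 f) (M : ℝ) {ε : ℝ} (hε : 0 < ε) :
    ∃ δ > 0, ∀ w, ‖w‖ ≤ M → ∀ a ∈ Metric.closedBall w δ, ∀ b ∈ Metric.closedBall w δ,
      ‖f a - f b - fderiv ℝ f w (a - b)‖ ≤ ε * ‖a - b‖ := by
  have := FiniteDimensional.proper ℝ X
  have hc : Continuous (fderiv ℝ f) := hf.continuous_fderiv (by norm_num)
  have hu := (isCompact_closedBall (0 : X) (M + 1)).uniformContinuousOn_of_continuous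
    hc.continuousOn
  obtain ⟨δ, hδ, h⟩ := Metric.uniformContinuousOn_iff.1 hu ε hε
  -- The bound `1` keeps the ball inside the compact set of radius `M + 1`, where the derivative is
  -- uniformly continuous; `δ / 2` makes the distance strictly less than `δ`.
  refine ⟨min (δ / 2) 1, by positivity, fun w hw a ha b hb => ?_⟩
  refine Convex.norm_image_sub_le_of_norm_fderiv_le' (𝕜 := ℝ)
    (s := Metric.closedBall w (min (δ / 2) 1))
    (fun z _ => hf.differentiable (by norm_num) z) (fun z hz => ?_) (convex_closedBall _ _) hb ha
  have hz' : dist z w ≤ min (δ / 2) 1 := hz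
  have h1 : ‖z‖ ≤ M + 1 := by
    have := norm_le_norm_add_norm_sub' z w
    rw [dist_eq_norm] at hz'
    linarith [min_le_right (δ / 2) 1]
  rw [← dist_eq_norm]
  refine (h z (mem_closedBall_zero_iff.2 h1) w (mem_closedBall_zero_iff.2 (by linarith)) ?_).le
  linarith [min_le_left (δ / 2) 1]

/-- The second order Taylor expansion of a `C²` map, uniformly on bounded sets. -/
theorem exists_taylor_two {f : X → Y} (hf : ContDiff ℝ 2 f) (M : ℝ) {ε : ℝ} (hε : 0 < ε) :
    ∃ δ > 0, ∀ w, ‖w‖ ≤ M → ∀ h, ‖h‖ ≤ δ →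
      ‖f (w + h) - f w - fderiv ℝ f w h - (1 / 2 : ℝ) • fderiv ℝ (fderiv ℝ f) w h h‖ ≤
        ε * ‖h‖ ^ 2 := by
  have hf' : ContDiff ℝ 1 (fderiv ℝ f) := hf.fderiv_right (by norm_num)
  obtain ⟨δ, hδ, H⟩ := exists_strict_approx hf' M hε
  refine ⟨δ, hδ, fun w hw h hh => ?_⟩
  set D := fderiv ℝ (fderiv ℝ f) w with hD
  -- Symmetry makes `D k` the derivative of `½ D k k`. The remainder `r` then has derivative `Df(w +
  -- k) - Df(w) - D k`, to which strict differentiability of `Df` applies, and the mean value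
  -- inequality gives the quadratic bound.
  have hsymm : ∀ a b, D a b = D b a := fun a b =>
    (hf.contDiffAt.isSymmSndFDerivAt (by simp)) a b
  let r : X → Y := fun k => f (w + k) - fderiv ℝ f w k - (1 / 2 : ℝ) • D k k
  have hder : ∀ k, HasFDerivAt r (fderiv ℝ f (w + k) - fderiv ℝ f w - D k) k := by
    intro k
    have h1 : HasFDerivAt (fun k => f (w + k)) (fderiv ℝ f (w + k)) k := by
      have := (hf.differentiable (by norm_num) (w + k)).hasFDerivAt
      have h0 := this.comp k ((hasFDerivAt_id (𝕜 := ℝ) k).const_add w)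
      simpa using! h0
    have h2 : HasFDerivAt (fun k => (1 / 2 : ℝ) • D k k) (D k) k := by
      have h3 : HasFDerivAt (fun k => D k k) _ k :=
        D.hasFDerivAt.clm_apply (hasFDerivAt_id k)
      convert! h3.const_smul (1 / 2 : ℝ) using 1
      ext v
      simp only [smul_apply, add_apply, ContinuousLinearMap.comp_apply,
        ContinuousLinearMap.flip_apply]
      rw [hsymm v k]
      change D k v = (1 / 2 : ℝ) • (D k v + D k v)
      rw [← two_smul ℝ, smul_smul]; norm_num
    exact (h1.sub (fderiv ℝ f w).hasFDerivAt).sub h2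
  have hmv := Convex.norm_image_sub_le_of_norm_hasFDerivWithin_le (𝕜 := ℝ) (f := r)
    (s := Metric.closedBall 0 ‖h‖) (C := ε * ‖h‖) (x := 0) (y := h)
    (fun k _ => (hder k).hasFDerivWithinAt)
    (fun k hk => by
      have hk' : ‖k‖ ≤ ‖h‖ := mem_closedBall_zero_iff.1 hk
      have := H w hw (w + k) (by simpa using hk'.trans hh) w (by simpa using hδ.le)
      rw [add_sub_cancel_left] at this
      exact this.trans (by gcongr))
    (convex_closedBall _ _) (by simp) (by simp)
  have : r h - r 0 = f (w + h) - f w - fderiv ℝ f w h - (1 / 2 : ℝ) • D h h := by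
    simp only [r, add_zero, map_zero, smul_zero, sub_zero]
    abel
  rw [this, sub_zero] at hmv
  refine hmv.trans (le_of_eq (by ring))

/-- The second order expansion of a `C²` map along parabolas, uniformly on bounded sets. -/
theorem exists_taylor_curve {f : X → Y} (hf : ContDiff ℝ 2 f) (M K : ℝ) {ε : ℝ} (hε : 0 < ε) :
    ∃ δ > 0, ∀ w, ‖w‖ ≤ M → ∀ a, ‖a‖ ≤ K → ∀ b, ‖b‖ ≤ K → ∀ s, 0 ≤ s → s ≤ δ →
      ‖f (w + (s • a + s ^ 2 • b)) - f w - s • fderiv ℝ f w a -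
        s ^ 2 • (fderiv ℝ f w b + (1 / 2 : ℝ) • fderiv ℝ (fderiv ℝ f) w a a)‖ ≤ ε * s ^ 2 := by
  have := FiniteDimensional.proper ℝ X
  wlog hK : 1 ≤ K generalizing K
  · obtain ⟨δ, hδ, h⟩ := this 1 le_rfl
    exact ⟨δ, hδ, fun w hw a ha b hb => h w hw a (ha.trans (not_le.1 hK).le) b
      (hb.trans (not_le.1 hK).le)⟩
  have hc : Continuous (fderiv ℝ (fderiv ℝ f)) :=
    (hf.fderiv_right (m := 1) (by norm_num)).continuous_fderiv (by norm_num)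
  obtain ⟨N, hN⟩ := (isCompact_closedBall (0 : X) M).exists_bound_of_continuousOn
    (E := X →L[ℝ] X →L[ℝ] Y) hc.continuousOn
  have hK0 : 0 < K := by linarith
  -- Since `‖h‖ ≤ 2 K s`, this constant makes the Taylor remainder at most `ε / 2 * s ^ 2`. The last
  -- bound on `s` below absorbs the terms of order `s ^ 3` and `s ^ 4` of `D h h` into the other
  -- half.
  obtain ⟨δ, hδ, H⟩ := exists_taylor_two hf M (ε := ε / (8 * K ^ 2)) (by positivity)
  refine ⟨min 1 (min (δ / (2 * K)) (ε / (3 * (|N| + 1) * K ^ 2))), by positivity,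
    fun w hw a ha b hb s hs hsδ => ?_⟩
  have hs1 : s ≤ 1 := hsδ.trans (min_le_left _ _)
  have hs2 : s ≤ δ / (2 * K) := hsδ.trans ((min_le_right _ _).trans (min_le_left _ _))
  have hs3 : s ≤ ε / (3 * (|N| + 1) * K ^ 2) :=
    hsδ.trans ((min_le_right _ _).trans (min_le_right _ _))
  set D := fderiv ℝ (fderiv ℝ f) w with hD
  have hDn : ‖D‖ ≤ |N| + 1 := by
    have := hN w (mem_closedBall_zero_iff.2 hw)
    linarith [le_abs_self N]
  set h := s • a + s ^ 2 • b with hh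
  have hh1 : ‖h‖ ≤ 2 * K * s := by
    refine (norm_add_le _ _).trans ?_
    rw [norm_smul, norm_smul, Real.norm_of_nonneg hs, Real.norm_of_nonneg (by positivity)]
    have : s ^ 2 ≤ s := by nlinarith
    nlinarith [mul_le_mul_of_nonneg_left ha hs, mul_le_mul this hb (norm_nonneg b) hs]
  have hhδ : ‖h‖ ≤ δ := by
    refine hh1.trans ?_
    rw [le_div_iff₀ (by positivity)] at hs2
    linarith
  have h1 := H w hw h hhδ
  have h2 : ‖(1 / 2 : ℝ) • (D h h - s ^ 2 • D a a)‖ ≤ ε / 2 * s ^ 2 := by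
    have e : D h h - s ^ 2 • D a a = s ^ 3 • (D a b + D b a) + s ^ 4 • D b b := by
      simp only [hh, map_add, map_smul, add_apply, smul_apply, smul_add, smul_smul]
      have e1 : s * s = s ^ 2 := by ring
      have e2 : s * s ^ 2 = s ^ 3 := by ring
      have e3 : s ^ 2 * s = s ^ 3 := by ring
      have e4 : s ^ 2 * s ^ 2 = s ^ 4 := by ring
      rw [e1, e2, e3, e4]
      abel
    have hbd : ∀ x y, ‖x‖ ≤ K → ‖y‖ ≤ K → ‖D x y‖ ≤ (|N| + 1) * K ^ 2 := by
      intro x y hx hy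
      refine (D.le_opNorm₂ x y).trans ?_
      rw [sq, ← mul_assoc]
      gcongr
    rw [e, norm_smul]
    have h3 : ‖s ^ 3 • (D a b + D b a) + s ^ 4 • D b b‖ ≤ 3 * ((|N| + 1) * K ^ 2) * s ^ 3 := by
      refine (norm_add_le _ _).trans ?_
      rw [norm_smul, norm_smul, Real.norm_of_nonneg (by positivity),
        Real.norm_of_nonneg (by positivity)]
      have h4 : ‖D a b + D b a‖ ≤ 2 * ((|N| + 1) * K ^ 2) := by
        refine (norm_add_le _ _).trans ?_
        linarith [hbd a b ha hb, hbd b a hb ha]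
      have h5 : s ^ 4 ≤ s ^ 3 := pow_le_pow_of_le_one hs hs1 (by norm_num)
      have h6 : 0 ≤ s ^ 3 := by positivity
      nlinarith [mul_le_mul_of_nonneg_left h4 h6, mul_le_mul h5 (hbd b b hb hb) (norm_nonneg _) h6]
    rw [Real.norm_of_nonneg (by norm_num : (0 : ℝ) ≤ 1 / 2)]
    rw [le_div_iff₀ (by positivity)] at hs3
    have h7 : 3 * ((|N| + 1) * K ^ 2) * s ^ 3 ≤ ε * s ^ 2 := by
      have : 3 * ((|N| + 1) * K ^ 2) * s ^ 3 = (s * (3 * (|N| + 1) * K ^ 2)) * s ^ 2 := by ring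
      rw [this]
      gcongr
    linarith
  have h8 : ε / (8 * K ^ 2) * ‖h‖ ^ 2 ≤ ε / 2 * s ^ 2 := by
    have : ‖h‖ ^ 2 ≤ (2 * K * s) ^ 2 := by gcongr
    calc ε / (8 * K ^ 2) * ‖h‖ ^ 2 ≤ ε / (8 * K ^ 2) * (2 * K * s) ^ 2 := by gcongr
      _ = ε / 2 * s ^ 2 := by field_simp; ring
  have e : f (w + h) - f w - s • fderiv ℝ f w a - s ^ 2 • (fderiv ℝ f w b + (1 / 2 : ℝ) • D a a) =
      (f (w + h) - f w - fderiv ℝ f w h - (1 / 2 : ℝ) • D h h) +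
        (1 / 2 : ℝ) • (D h h - s ^ 2 • D a a) := by
    rw [smul_sub, smul_add, smul_comm (s ^ 2) (1 / 2 : ℝ)]
    simp only [hh, map_add, map_smul]
    abel
  rw [e]
  refine (norm_add_le _ _).trans ?_
  linarith

end Taylor

/-! ### Solving nonlinear equations near an approximate solution -/

section Lyusternik

variable {X Y : Type*} [NormedAddCommGroup X] [NormedSpace ℝ X] [CompleteSpace X]
  [NormedAddCommGroup Y] [NormedSpace ℝ Y] [CompleteSpace Y]

/-- Solvability of `G = 0` near an approximate solution, with a linear estimate of the distance,
for maps `G` that are well approximated by a fixed surjective linear map. -/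
theorem exists_zero_near_of_approximatesLinearOn (L : X →L[ℝ] Y) (hL : Function.Surjective L) :
    ∃ c : ℝ, 0 < c ∧ ∃ K : ℝ, 0 < K ∧ ∀ (G : X → Y) (b : X) (ρ : ℝ),
      (∀ z ∈ Metric.closedBall b ρ, ∀ z' ∈ Metric.closedBall b ρ,
        ‖G z - G z' - L (z - z')‖ ≤ c * ‖z - z'‖) →
      K * ‖G b‖ ≤ ρ → ∃ z, G z = 0 ∧ ‖z - b‖ ≤ K * ‖G b‖ := by
  obtain ⟨S, hS⟩ := L.exists_nonlinearRightInverse_of_surjective (LinearMap.range_eq_top.2 hL)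
  have hS' : (0 : ℝ) < S.nnnorm := hS
  -- With approximation constant `‖S‖⁻¹ / 2`, the ball of radius `2 ‖S‖ ‖G b‖` about `b` covers the
  -- ball about `G b` of radius `(‖S‖⁻¹ - ‖S‖⁻¹ / 2) * 2 ‖S‖ ‖G b‖ = ‖G b‖`, which just reaches `0`.
  -- The right inverse `S` need not be linear, so the kernel of `L` need not be complemented.
  refine ⟨(S.nnnorm : ℝ)⁻¹ / 2, by positivity, 2 * S.nnnorm, by positivity,
    fun G b ρ hG hρ => ?_⟩
  have happ : ApproximatesLinearOn G L (Metric.closedBall b ρ) (S.nnnorm⁻¹ / 2) :=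
    fun z hz z' hz' => by
      simpa using hG z hz z' hz'
  have hsurj := happ.surjOn_closedBall_of_nonlinearRightInverse S
    (ε := 2 * S.nnnorm * ‖G b‖) (b := b) (by positivity) (Metric.closedBall_subset_closedBall hρ)
  have h0 : (0 : Y) ∈ Metric.closedBall (G b)
      (((S.nnnorm : ℝ)⁻¹ - ((S.nnnorm⁻¹ / 2 : NNReal) : ℝ)) * (2 * S.nnnorm * ‖G b‖)) := by
    rw [Metric.mem_closedBall, dist_zero_left]
    refine le_of_eq ?_
    push_cast
    field_simp
    ring
  obtain ⟨z, hz, hz0⟩ := hsurj h0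
  exact ⟨z, hz0, by simpa [dist_eq_norm] using hz⟩

end Lyusternik

/-! ### State equation and endpoint equations as one nonlinear operator -/

theorem norm_primitive_le_of_ae_bound {E : Type*} [NormedAddCommGroup E] [NormedSpace ℝ E] {T : ℝ}
    (hT : 0 ≤ T) {b : ℝ → E} {K : ℝ} (hb : ∀ᵐ t ∂timeMeasure T, ‖b t‖ ≤ K) :
    ‖primitive T b‖ ≤ T * K := by
  refine (norm_primitive_le b).trans ?_
  have h : ∫ s, ‖b s‖ ∂timeMeasure T ≤ ∫ _, K ∂timeMeasure T :=
    integral_mono_of_nonneg (Eventually.of_forall fun _ => norm_nonneg _) (integrable_const K) hb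
  refine h.trans (le_of_eq ?_)
  rw [integral_const, smul_eq_mul]
  congr 1
  simp [timeMeasure, Measure.real, hT]

theorem primitive_sub {E : Type*} [NormedAddCommGroup E] [NormedSpace ℝ E] {T : ℝ} {b c : ℝ → E}
    (hb : Integrable b (timeMeasure T)) (hc : Integrable c (timeMeasure T)) :
    primitive T (fun t => b t - c t) = primitive T b - primitive T c := by
  have hc' : Integrable (fun t => (-1 : ℝ) • c t) (timeMeasure T) := hc.smul (-1 : ℝ)
  have := primitive_add hb hc'
  rw [primitive_smul _ hc, neg_one_smul, ← sub_eq_add_neg] at this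
  rw [← this]
  congr 1
  funext t
  rw [neg_one_smul, sub_eq_add_neg]

namespace ReferenceTrajectory

variable {E C : Type*} [NormedAddCommGroup E] [NormedSpace ℝ E] [NormedAddCommGroup C]
  [NormedSpace ℝ C] {T : ℝ} (R : ReferenceTrajectory E C T)
  [FiniteDimensional ℝ E] [FiniteDimensional ℝ C]
  {Y : Type*} [NormedAddCommGroup Y] [NormedSpace ℝ Y]

/-- The linearization at the reference trajectory of a function of the endpoints. -/
def lin (H : E × E → Y) : E × Lp C 2 (timeMeasure T) →L[ℝ] Y :=
  fderiv ℝ H (ends R.hT E R.x) ∘L ends R.hT E ∘L R.state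

/-- The second order term of the expansion of a function of the endpoints in the direction `q`. -/
def curv (H : E × E → Y) (q : E × Lp C 2 (timeMeasure T)) : Y :=
  fderiv ℝ H (ends R.hT E R.x) (ends R.hT E (R.second q)) +
    (1 / 2 : ℝ) • fderiv ℝ (fderiv ℝ H) (ends R.hT E R.x) (ends R.hT E (R.state q))
      (ends R.hT E (R.state q))

theorem lin_apply (H : E × E → Y) (q : E × Lp C 2 (timeMeasure T)) :
    R.lin H q = fderiv ℝ H (ends R.hT E R.x) (ends R.hT E (R.state q)) := rfl

theorem continuous_curv (H : E × E → Y) : Continuous (R.curv H) := by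
  unfold curv
  have := R.continuous_second
  fun_prop

theorem norm_ends_le (hT : 0 ≤ T) (x : C(Icc 0 T, E)) : ‖ends hT E x‖ ≤ ‖x‖ :=
  max_le (x.norm_coe_le_norm _) (x.norm_coe_le_norm _)

/-- The constraints (state equation and endpoint equations `H = const`) for the unknown state
and the parameter `y` of the correction `S y` of initial value and control. -/
def residual (H : E × E → Y) (S : Y →L[ℝ] E × Lp C 2 (timeMeasure T)) (ξ : E) (c : ℝ → C)
    (z : C(Icc 0 T, E) × Y) : C(Icc 0 T, E) × Y :=
  (z.1 - ContinuousMap.const _ (ξ + (S z.2).1) -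
    primitive T (fun t => R.F (extendIcc R.hT z.1 t, c t + (S z.2).2 t)),
    H (ends R.hT E z.1) - H (ends R.hT E R.x))

/-- The linearization of the constraints. -/
def linResidual (H : E × E → Y) (S : Y →L[ℝ] E × Lp C 2 (timeMeasure T)) :
    C(Icc 0 T, E) × Y →L[ℝ] C(Icc 0 T, E) × Y :=
  ContinuousLinearMap.prod
    (ContinuousLinearMap.fst ℝ C(Icc 0 T, E) Y -
      volterra R.hT R.A ∘L ContinuousLinearMap.fst ℝ C(Icc 0 T, E) Y -
      (ContinuousLinearMap.const ℝ (Icc 0 T) ∘L ContinuousLinearMap.fst ℝ _ _ +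
        primitiveL T E ∘L R.forcing ∘L ContinuousLinearMap.snd ℝ _ _) ∘L S ∘L
          ContinuousLinearMap.snd ℝ C(Icc 0 T, E) Y)
    (fderiv ℝ H (ends R.hT E R.x) ∘L ends R.hT E ∘L ContinuousLinearMap.fst ℝ C(Icc 0 T, E) Y)

theorem linResidual_apply (H : E × E → Y) (S : Y →L[ℝ] E × Lp C 2 (timeMeasure T))
    (z : C(Icc 0 T, E) × Y) : R.linResidual H S z =
      (z.1 - ContinuousMap.const _ (S z.2).1 - primitive T
        (fun t => fderiv ℝ R.F (R.pt t) (extendIcc R.hT z.1 t, (S z.2).2 t)),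
        fderiv ℝ H (ends R.hT E R.x) (ends R.hT E z.1)) := by
  rw [primitive_linearized]
  refine Prod.ext ?_ rfl
  change z.1 - volterra R.hT R.A z.1 - (ContinuousMap.const _ (S z.2).1 +
    primitiveL T E (R.forcing (S z.2).2)) = _
  abel_nf

/-- The Volterra resolvent solves the state component. Adding `state (S θ)` together with the
parameter `θ` leaves that component unchanged and shifts the endpoint component by `θ`, so the
remaining endpoint error can be prescribed. -/
theorem surjective_linResidual {H : E × E → Y} {S : Y →L[ℝ] E × Lp C 2 (timeMeasure T)}
    (hS : ∀ y, R.lin H (S y) = y) : Function.Surjective (R.linResidual H S) := by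
  have := FiniteDimensional.complete ℝ E
  rintro ⟨g, η⟩
  set r := volterraResolvent R.hT R.A g with hr
  set θ := η - fderiv ℝ H (ends R.hT E R.x) (ends R.hT E r) with hθ
  refine ⟨(r + R.state (S θ), θ), Prod.ext ?_ ?_⟩
  · change r + R.state (S θ) - volterra R.hT R.A (r + R.state (S θ)) -
      (ContinuousMap.const _ (S θ).1 + primitiveL T E (R.forcing (S θ).2)) = g
    have h1 := volterraResolvent_eq R.hT R.A g
    have h2 : R.state (S θ) = (ContinuousMap.const _ (S θ).1 +
      primitiveL T E (R.forcing (S θ).2)) + volterra R.hT R.A (R.state (S θ)) :=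
      volterraResolvent_eq R.hT R.A _
    rw [← hr] at h1
    rw [map_add]
    nth_rw 1 [h1, h2]
    abel
  · change fderiv ℝ H (ends R.hT E R.x) (ends R.hT E (r + R.state (S θ))) = η
    rw [map_add, map_add, ← lin_apply, hS, hθ]
    abel

theorem integrable_dynamics (x : C(Icc 0 T, E)) {c : ℝ → C}
    (hc : AEStronglyMeasurable c (timeMeasure T)) {M : ℝ} (hM : ∀ᵐ t ∂timeMeasure T, ‖c t‖ ≤ M) :
    Integrable (fun t => R.F (extendIcc R.hT x t, c t)) (timeMeasure T) := by
  have := FiniteDimensional.proper ℝ (E × C)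
  rw [← memLp_one_iff_integrable]
  refine memLp_comp_of_bounded (M := max ‖x‖ M) (f := fun t => (extendIcc R.hT x t, c t))
    R.contDiff.continuous ((aestronglyMeasurable_extendIcc R.hT x).prodMk hc) ?_ 1
  filter_upwards [hM] with t ht
  exact max_le_max (norm_extendIcc_le _ _ _) ht

theorem extendIcc_sub (hT : 0 ≤ T) (x y : C(Icc 0 T, E)) (t : ℝ) :
    extendIcc hT (x - y) t = extendIcc hT x t - extendIcc hT y t := rfl

/-- Superposition by `F` behaves well only for uniformly small perturbations, not for small ones in
`L²`. The controls of `S y` are therefore required to be bounded by `M * ‖y‖`, so that strict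
differentiability of `F` can be applied pointwise in time. The estimate is uniform in `ξ` because
the initial value cancels in the difference. -/
theorem residual_approx {H : E × E → Y} (hH : ContDiff ℝ 1 H)
    (S : Y →L[ℝ] E × Lp C 2 (timeMeasure T)) {M : ℝ} (hM0 : 0 ≤ M)
    (hM : ∀ y, ∀ᵐ t ∂timeMeasure T, ‖(S y).2 t‖ ≤ M * ‖y‖) {κ : ℝ} (hκ : 0 < κ) :
    ∃ δ > 0, ∀ (ξ : E) (c : ℝ → C), AEStronglyMeasurable c (timeMeasure T) →
      (∀ᵐ t ∂timeMeasure T, ‖c t - R.c t‖ ≤ δ) → ∀ z z' : C(Icc 0 T, E) × Y,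
      ‖z.1 - R.x‖ ≤ δ → ‖z.2‖ ≤ δ → ‖z'.1 - R.x‖ ≤ δ → ‖z'.2‖ ≤ δ →
      ‖R.residual H S ξ c z - R.residual H S ξ c z' - R.linResidual H S (z - z')‖ ≤
        κ * ‖z - z'‖ := by
  obtain ⟨B, hB0, hB⟩ := R.exists_bound_pt
  have hT := R.hT
  -- The factor `1 + M` bounds the state and control increments by `‖z - z'‖`. Integration over `[0,
  -- T]` costs a factor `T`, and `T + 1` keeps the denominator positive for `T = 0`.
  obtain ⟨δ₁, hδ₁, h₁⟩ := exists_strict_approx (R.contDiff.of_le (by norm_num)) B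
    (ε := κ / ((T + 1) * (1 + M))) (by positivity)
  obtain ⟨δ₂, hδ₂, h₂⟩ := exists_strict_approx hH ‖ends R.hT E R.x‖ hκ
  refine ⟨min (δ₁ / (1 + M)) δ₂, by positivity, fun ξ c hc hcδ z z' hz1 hz2 hz1' hz2' => ?_⟩
  have hδM : min (δ₁ / (1 + M)) δ₂ * (1 + M) ≤ δ₁ := by
    rw [← le_div_iff₀ (by positivity)]; exact min_le_left _ _
  have hδ0 : 0 ≤ min (δ₁ / (1 + M)) δ₂ := by positivity
  have hδδ : min (δ₁ / (1 + M)) δ₂ ≤ δ₂ := min_le_right _ _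
  generalize min (δ₁ / (1 + M)) δ₂ = δ at *
  have hint : ∀ w : C(Icc 0 T, E) × Y,
      Integrable (fun t => R.F (extendIcc R.hT w.1 t, c t + (S w.2).2 t)) (timeMeasure T) := by
    intro w
    refine R.integrable_dynamics w.1 (M := B + δ + M * ‖w.2‖)
      (hc.add (Lp.aestronglyMeasurable _)) ?_
    filter_upwards [hcδ, hB, hM w.2] with t h1 h2 h3
    have h4 : ‖R.c t‖ ≤ B := (le_max_right _ _).trans h2
    have h5 : ‖c t‖ ≤ ‖R.c t‖ + ‖c t - R.c t‖ := norm_le_norm_add_norm_sub' _ _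
    have := norm_add_le (c t) ((S w.2).2 t)
    linarith
  rw [linResidual_apply]
  refine max_le ?_ ?_
  · have e : (R.residual H S ξ c z - R.residual H S ξ c z' -
        (((z - z').1 - ContinuousMap.const _ (S (z - z').2).1 - primitive T
        (fun t => fderiv ℝ R.F (R.pt t) (extendIcc R.hT (z - z').1 t, (S (z - z').2).2 t)),
        fderiv ℝ H (ends R.hT E R.x) (ends R.hT E (z - z').1)) : C(Icc 0 T, E) × Y)).1 =
        -primitive T (fun t => (R.F (extendIcc R.hT z.1 t, c t + (S z.2).2 t) -
          R.F (extendIcc R.hT z'.1 t, c t + (S z'.2).2 t)) -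
          fderiv ℝ R.F (R.pt t) (extendIcc R.hT (z - z').1 t, (S (z - z').2).2 t)) := by
      have hint₂ : Integrable (fun t => R.F (extendIcc R.hT z.1 t, c t + (S z.2).2 t) -
          R.F (extendIcc R.hT z'.1 t, c t + (S z'.2).2 t)) (timeMeasure T) :=
        (hint z).sub (hint z')
      rw [primitive_sub hint₂ (R.integrable_linearized _ _),
        primitive_sub (hint z) (hint z')]
      simp only [residual, Prod.fst_sub, Prod.snd_sub, map_sub]
      have : ∀ a b : E, ContinuousMap.const (Icc 0 T) (ξ + a) -
          ContinuousMap.const (Icc 0 T) (ξ + b) = ContinuousMap.const (Icc 0 T) (a - b) := by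
        intro a b; ext; simp
      rw [← this]
      abel
    rw [e, norm_neg]
    have hbd : ∀ᵐ t ∂timeMeasure T, ‖(R.F (extendIcc R.hT z.1 t, c t + (S z.2).2 t) -
          R.F (extendIcc R.hT z'.1 t, c t + (S z'.2).2 t)) -
          fderiv ℝ R.F (R.pt t) (extendIcc R.hT (z - z').1 t, (S (z - z').2).2 t)‖ ≤
          κ / ((T + 1) * (1 + M)) * ((1 + M) * ‖z - z'‖) := by
      have hsub := Lp.coeFn_sub (S z.2).2 (S z'.2).2
      filter_upwards [hB, hcδ, hM z.2, hM z'.2, hM (z - z').2, hsub] with t hB hc h3 h3' h4 h5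
      have hmem : ∀ w : C(Icc 0 T, E) × Y, ‖w.1 - R.x‖ ≤ δ → ‖w.2‖ ≤ δ →
          ‖(S w.2).2 t‖ ≤ M * ‖w.2‖ →
          (extendIcc R.hT w.1 t, c t + (S w.2).2 t) ∈ Metric.closedBall (R.pt t) δ₁ := by
        intro w hw1 hw2 hw3
        rw [mem_closedBall_iff_norm]
        refine max_le ?_ ?_
        · change ‖extendIcc R.hT (w.1 - R.x) t‖ ≤ δ₁
          refine (norm_extendIcc_le _ _ _).trans (hw1.trans ?_)
          nlinarith
        · change ‖c t + (S w.2).2 t - R.c t‖ ≤ δ₁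
          have : c t + (S w.2).2 t - R.c t = (c t - R.c t) + (S w.2).2 t := by abel
          rw [this]
          refine (norm_add_le _ _).trans ?_
          nlinarith
      have key := h₁ _ hB _ (hmem z hz1 hz2 h3) _ (hmem z' hz1' hz2' h3')
      have e2 : (extendIcc R.hT z.1 t, c t + (S z.2).2 t) -
          (extendIcc R.hT z'.1 t, c t + (S z'.2).2 t) =
          (extendIcc R.hT (z - z').1 t, (S (z - z').2).2 t) := by
        have e3 : (S (z - z').2).2 t = (S z.2).2 t - (S z'.2).2 t := by
          rw [Prod.snd_sub, map_sub, Prod.snd_sub]; exact h5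
        refine Prod.ext rfl ?_
        change c t + (S z.2).2 t - (c t + (S z'.2).2 t) = _
        rw [e3]; abel_nf
      rw [e2] at key
      refine key.trans ?_
      gcongr
      refine max_le ((norm_extendIcc_le _ _ _).trans ?_) (h4.trans ?_)
      · have := norm_fst_le (z - z')
        nlinarith [norm_nonneg (z - z')]
      · have := norm_snd_le (z - z')
        nlinarith [norm_nonneg (z - z')]
    refine (norm_primitive_le_of_ae_bound R.hT hbd).trans ?_
    have : T * (κ / ((T + 1) * (1 + M)) * ((1 + M) * ‖z - z'‖)) =
        (T / (T + 1)) * (κ * ‖z - z'‖) := by field_simp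
    rw [this]
    refine mul_le_of_le_one_left (by positivity) ?_
    rw [div_le_one (by positivity)]
    linarith
  · have hmem : ∀ w : C(Icc 0 T, E), ‖w - R.x‖ ≤ δ →
        ends R.hT E w ∈ Metric.closedBall (ends R.hT E R.x) δ₂ := by
      intro w hw
      rw [mem_closedBall_iff_norm, ← map_sub]
      exact (norm_ends_le _ _).trans (hw.trans hδδ)
    have key := h₂ _ le_rfl _ (hmem _ hz1) _ (hmem _ hz1')
    have e : (R.residual H S ξ c z - R.residual H S ξ c z' -
        (((z - z').1 - ContinuousMap.const _ (S (z - z').2).1 - primitive T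
        (fun t => fderiv ℝ R.F (R.pt t) (extendIcc R.hT (z - z').1 t, (S (z - z').2).2 t)),
        fderiv ℝ H (ends R.hT E R.x) (ends R.hT E (z - z').1)) : C(Icc 0 T, E) × Y)).2 =
        H (ends R.hT E z.1) - H (ends R.hT E z'.1) - fderiv ℝ H (ends R.hT E R.x)
          (ends R.hT E z.1 - ends R.hT E z'.1) := by
      simp only [residual, Prod.snd_sub, Prod.fst_sub, map_sub]
      abel
    rw [e]
    refine key.trans ?_
    gcongr
    rw [← map_sub]
    exact (norm_ends_le _ _).trans (norm_fst_le (z - z'))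

/-- The directions with essentially bounded control. -/
def boundedDirections (E C : Type*) [NormedAddCommGroup E] [NormedSpace ℝ E]
    [NormedAddCommGroup C] [NormedSpace ℝ C] (T : ℝ) :
    Submodule ℝ (E × Lp C 2 (timeMeasure T)) where
  carrier := {q | ∃ M : ℝ, ∀ᵐ t ∂timeMeasure T, ‖q.2 t‖ ≤ M}
  add_mem' := by
    rintro q r ⟨M, hM⟩ ⟨N, hN⟩
    refine ⟨M + N, ?_⟩
    filter_upwards [hM, hN, Lp.coeFn_add q.2 r.2] with t h1 h2 h3
    rw [Prod.snd_add, h3]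
    exact (norm_add_le _ _).trans (add_le_add h1 h2)
  zero_mem' := by
    refine ⟨0, ?_⟩
    filter_upwards [Lp.coeFn_zero C 2 (timeMeasure T)] with t h
    rw [Prod.snd_zero, h]; simp
  smul_mem' := by
    rintro a q ⟨M, hM⟩
    refine ⟨‖a‖ * M, ?_⟩
    filter_upwards [hM, Lp.coeFn_smul a q.2] with t h1 h3
    rw [Prod.smul_snd, h3, Pi.smul_apply, norm_smul]
    gcongr

/-- The base curve of states to which second order corrections are applied. -/
def curveState (q₀ q₁ : E × Lp C 2 (timeMeasure T)) (s : ℝ) : C(Icc 0 T, E) :=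
  R.x + (s • R.state q₀ + s ^ 2 • (R.state q₁ + R.second q₀))

/-- The base curve of controls. -/
def curveControl (q₀ q₁ : E × Lp C 2 (timeMeasure T)) (s : ℝ) (t : ℝ) : C :=
  R.c t + (s • q₀.2 t + s ^ 2 • q₁.2 t)

theorem aestronglyMeasurable_curveControl (q₀ q₁ : E × Lp C 2 (timeMeasure T)) (s : ℝ) :
    AEStronglyMeasurable (R.curveControl q₀ q₁ s) (timeMeasure T) :=
  R.measurable_c.add (((Lp.aestronglyMeasurable q₀.2).const_smul s).add
    ((Lp.aestronglyMeasurable q₁.2).const_smul (s ^ 2)))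

theorem exists_endpoint_expansion {H : E × E → Y} (hH : ContDiff ℝ 2 H)
    (q₀ q₁ : E × Lp C 2 (timeMeasure T)) {ε : ℝ} (hε : 0 < ε) :
    ∃ δ > 0, ∀ s, 0 ≤ s → s ≤ δ → ‖H (ends R.hT E (R.curveState q₀ q₁ s)) - H (ends R.hT E R.x) -
      s • R.lin H q₀ - s ^ 2 • (R.lin H q₁ + R.curv H q₀)‖ ≤ ε * s ^ 2 := by
  obtain ⟨δ, hδ, h⟩ := exists_taylor_curve hH ‖ends R.hT E R.x‖
    (max ‖ends R.hT E (R.state q₀)‖ ‖ends R.hT E (R.state q₁ + R.second q₀)‖) hε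
  refine ⟨δ, hδ, fun s hs hsδ => ?_⟩
  have := h _ le_rfl _ (le_max_left _ _) _ (le_max_right _ _) s hs hsδ
  convert this using 3
  · simp only [curveState, map_add, map_smul, lin_apply]
  · congr 1
    simp only [lin_apply, curv, map_add]
    abel

/-- The coefficients of `s` and `s ^ 2` in the integrated expansion of `F` are exactly the integral
equations of `state q₀` and of `state q₁ + second q₀`, so only the Taylor remainder survives.
Bounded controls make that remainder uniform in time. -/
theorem exists_dynamics_expansion {q₀ q₁ : E × Lp C 2 (timeMeasure T)}
    (h₀ : q₀ ∈ boundedDirections E C T) (h₁ : q₁ ∈ boundedDirections E C T) {ε : ℝ} (hε : 0 < ε) :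
    ∃ δ > 0, ∀ s, 0 ≤ s → s ≤ δ →
      ‖R.curveState q₀ q₁ s - ContinuousMap.const _
        (R.x ⟨0, le_rfl, R.hT⟩ + (s • q₀.1 + s ^ 2 • q₁.1)) -
        primitive T (fun t => R.F (extendIcc R.hT (R.curveState q₀ q₁ s) t,
          R.curveControl q₀ q₁ s t))‖ ≤ ε * s ^ 2 := by
  obtain ⟨B, hB0, hB⟩ := R.exists_bound_pt
  obtain ⟨M₀, hM₀⟩ := h₀
  obtain ⟨M₁, hM₁⟩ := h₁
  have hT := R.hT
  set x₂ := R.state q₁ + R.second q₀ with hx₂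
  set K := max (max ‖R.state q₀‖ M₀) (max ‖x₂‖ M₁) with hK
  obtain ⟨δ, hδ, h⟩ := exists_taylor_curve R.contDiff B K (ε := ε / (T + 1)) (by positivity)
  refine ⟨δ, hδ, fun s hs hsδ => ?_⟩
  let a : ℝ → E × C := fun t => (extendIcc R.hT (R.state q₀) t, q₀.2 t)
  let b : ℝ → E × C := fun t => (extendIcc R.hT x₂ t, q₁.2 t)
  have hcurve : ∀ t, (extendIcc R.hT (R.curveState q₀ q₁ s) t, R.curveControl q₀ q₁ s t) =
      R.pt t + (s • a t + s ^ 2 • b t) := fun t => rfl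
  have hi0 : Integrable (fun t => R.F (R.pt t)) (timeMeasure T) :=
    memLp_one_iff_integrable.1 (R.memLp_comp_pt R.contDiff.continuous 1)
  have hi1 : Integrable (fun t => fderiv ℝ R.F (R.pt t) (a t)) (timeMeasure T) :=
    R.integrable_linearized _ _
  have hi2 : Integrable (fun t => fderiv ℝ R.F (R.pt t) (b t) +
      (1 / 2 : ℝ) • fderiv ℝ (fderiv ℝ R.F) (R.pt t) (a t) (a t)) (timeMeasure T) :=
    (R.integrable_linearized _ _).add (R.integrable_quad q₀)
  have hi3 : Integrable (fun t => R.F (R.pt t + (s • a t + s ^ 2 • b t))) (timeMeasure T) := by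
    refine R.integrable_dynamics (R.curveState q₀ q₁ s)
      (R.aestronglyMeasurable_curveControl q₀ q₁ s) (M := B + (s * M₀ + s ^ 2 * M₁)) ?_
    filter_upwards [hB, hM₀, hM₁] with t h1 h2 h3
    refine (norm_add_le _ _).trans (add_le_add ((le_max_right _ _).trans h1)
      ((norm_add_le _ _).trans (add_le_add ?_ ?_)))
    · change ‖s • q₀.2 t‖ ≤ _
      rw [norm_smul, Real.norm_of_nonneg hs]; gcongr
    · change ‖s ^ 2 • q₁.2 t‖ ≤ _
      rw [norm_smul, Real.norm_of_nonneg (by positivity)]; gcongr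
  have hi30 : Integrable (fun t => R.F (R.pt t + (s • a t + s ^ 2 • b t)) - R.F (R.pt t))
      (timeMeasure T) := hi3.sub hi0
  have hi1' : Integrable (fun t => s • fderiv ℝ R.F (R.pt t) (a t)) (timeMeasure T) := hi1.smul s
  have hi301 : Integrable (fun t => R.F (R.pt t + (s • a t + s ^ 2 • b t)) - R.F (R.pt t) -
      s • fderiv ℝ R.F (R.pt t) (a t)) (timeMeasure T) := hi30.sub hi1'
  have hi2' : Integrable (fun t => s ^ 2 • (fderiv ℝ R.F (R.pt t) (b t) +
      (1 / 2 : ℝ) • fderiv ℝ (fderiv ℝ R.F) (R.pt t) (a t) (a t))) (timeMeasure T) :=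
    hi2.smul (s ^ 2)
  have e : R.curveState q₀ q₁ s - ContinuousMap.const _
        (R.x ⟨0, le_rfl, R.hT⟩ + (s • q₀.1 + s ^ 2 • q₁.1)) -
        primitive T (fun t => R.F (extendIcc R.hT (R.curveState q₀ q₁ s) t,
          R.curveControl q₀ q₁ s t)) =
      -primitive T (fun t => R.F (R.pt t + (s • a t + s ^ 2 • b t)) - R.F (R.pt t) -
        s • fderiv ℝ R.F (R.pt t) (a t) - s ^ 2 • (fderiv ℝ R.F (R.pt t) (b t) +
          (1 / 2 : ℝ) • fderiv ℝ (fderiv ℝ R.F) (R.pt t) (a t) (a t))) := by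
    rw [primitive_sub hi301 hi2', primitive_sub hi30 hi1', primitive_sub hi3 hi0,
      primitive_smul _ hi1, primitive_smul _ hi2]
    simp only [hcurve]
    have e0 : primitive T (fun t => R.F (R.pt t)) =
        R.x - ContinuousMap.const _ (R.x ⟨0, le_rfl, R.hT⟩) :=
      eq_sub_of_add_eq' R.x_eq.symm
    have e1 : primitive T (fun t => fderiv ℝ R.F (R.pt t) (a t)) =
        R.state q₀ - ContinuousMap.const _ q₀.1 :=
      eq_sub_of_add_eq' (R.state_eq q₀).symm
    have e2 : primitive T (fun t => fderiv ℝ R.F (R.pt t) (b t) +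
      (1 / 2 : ℝ) • fderiv ℝ (fderiv ℝ R.F) (R.pt t) (a t) (a t)) =
        x₂ - ContinuousMap.const _ q₁.1 := by
      have e3 := eq_sub_of_add_eq' (R.state_eq q₁).symm
      have e4 := R.second_eq q₀
      have hi4 : Integrable (fun t => fderiv ℝ R.F (R.pt t) (extendIcc R.hT (R.second q₀) t, 0) +
          (1 / 2 : ℝ) • fderiv ℝ (fderiv ℝ R.F) (R.pt t) (a t) (a t)) (timeMeasure T) :=
        (R.integrable_A_apply _).add (R.integrable_quad q₀)
      rw [hx₂, add_sub_right_comm, ← e3, e4]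
      refine Eq.trans ?_ (primitive_add (R.integrable_linearized _ _) hi4)
      congr 1
      funext t
      rw [← add_assoc, ← map_add]
      congr 2
      refine Prod.ext rfl ?_
      simp [b]
    rw [e0, e1, e2, curveState, ← hx₂]
    ext t
    simp only [ContinuousMap.sub_apply, ContinuousMap.add_apply, ContinuousMap.smul_apply,
      ContinuousMap.neg_apply, ContinuousMap.const_apply, smul_sub]
    abel
  rw [e, norm_neg]
  have hbd : ∀ᵐ t ∂timeMeasure T, ‖R.F (R.pt t + (s • a t + s ^ 2 • b t)) - R.F (R.pt t) -
        s • fderiv ℝ R.F (R.pt t) (a t) - s ^ 2 • (fderiv ℝ R.F (R.pt t) (b t) +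
          (1 / 2 : ℝ) • fderiv ℝ (fderiv ℝ R.F) (R.pt t) (a t) (a t))‖ ≤
        ε / (T + 1) * s ^ 2 := by
    filter_upwards [hB, hM₀, hM₁] with t h1 h2 h3
    refine h _ h1 _ ?_ _ ?_ s hs hsδ
    · exact (max_le_max (norm_extendIcc_le _ _ _) h2).trans (le_max_left _ _)
    · exact (max_le_max (norm_extendIcc_le _ _ _) h3).trans (le_max_right _ _)
  refine (norm_primitive_le_of_ae_bound R.hT hbd).trans ?_
  have : T * (ε / (T + 1) * s ^ 2) = (T / (T + 1)) * (ε * s ^ 2) := by field_simp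
  rw [this]
  refine mul_le_of_le_one_left (by positivity) ?_
  rw [div_le_one (by positivity)]
  linarith

end ReferenceTrajectory

/-! ### Genuine trajectories tangent to second order curves -/

namespace ReferenceTrajectory

variable {E C : Type*} [NormedAddCommGroup E] [NormedSpace ℝ E] [NormedAddCommGroup C]
  [NormedSpace ℝ C] {T : ℝ} (R : ReferenceTrajectory E C T)
  [FiniteDimensional ℝ E] [FiniteDimensional ℝ C]
  {Y : Type*} [NormedAddCommGroup Y] [NormedSpace ℝ Y] [CompleteSpace Y]

/-- A nearby trajectory `(x, c)` of the control system. -/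
def IsNearbyTrajectory (ε : ℝ) (x : C(Icc 0 T, E)) (c : ℝ → C) : Prop :=
  AEStronglyMeasurable c (timeMeasure T) ∧
    x = ContinuousMap.const _ (x ⟨0, le_rfl, R.hT⟩) +
      primitive T (fun t => R.F (extendIcc R.hT x t, c t)) ∧
    ‖x - R.x‖ ≤ ε ∧ ∀ᵐ t ∂timeMeasure T, ‖c t - R.c t‖ ≤ ε

/-- By `hlin` and `hcurv` the residual of the curve is `o(s²)` in the endpoint equations too. The
Lyusternik estimate bounds the correction linearly by the residual, so it does not disturb the
second order expansion of other endpoint functions. -/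
theorem exists_nearby_curve {H : E × E → Y} (hH : ContDiff ℝ 2 H)
    (S : Y →L[ℝ] E × Lp C 2 (timeMeasure T)) (hS : ∀ y, R.lin H (S y) = y) {M : ℝ} (hM0 : 0 ≤ M)
    (hM : ∀ y, ∀ᵐ t ∂timeMeasure T, ‖(S y).2 t‖ ≤ M * ‖y‖) {q₀ q₁ : E × Lp C 2 (timeMeasure T)}
    (h₀ : q₀ ∈ boundedDirections E C T) (h₁ : q₁ ∈ boundedDirections E C T)
    (hlin : R.lin H q₀ = 0) (hcurv : R.lin H q₁ + R.curv H q₀ = 0) {ε κ : ℝ} (hε : 0 < ε)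
    (hκ : 0 < κ) :
    ∃ δ > 0, ∀ s, 0 ≤ s → s ≤ δ → ∃ x c, R.IsNearbyTrajectory ε x c ∧
      H (ends R.hT E x) = H (ends R.hT E R.x) ∧ ‖x - R.curveState q₀ q₁ s‖ ≤ κ * s ^ 2 := by
  have := FiniteDimensional.complete ℝ E
  obtain ⟨k, hk, K, hK, hLy⟩ := exists_zero_near_of_approximatesLinearOn (R.linResidual H S)
    (R.surjective_linResidual hS)
  obtain ⟨δ₀, hδ₀, happ⟩ := R.residual_approx (hH.of_le (by norm_num)) S hM0 hM hk
  obtain ⟨M₀, hM₀⟩ := h₀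
  obtain ⟨M₁, hM₁⟩ := h₁
  obtain ⟨δ₁, hδ₁, hexp₁⟩ := R.exists_dynamics_expansion ⟨M₀, hM₀⟩ ⟨M₁, hM₁⟩
    (ε := κ / K) (by positivity)
  obtain ⟨δ₂, hδ₂, hexp₂⟩ := R.exists_endpoint_expansion hH q₀ q₁ (ε := κ / K) (by positivity)
  -- Both the curve's distance from the reference and the correction are kept below `ρ`. Their sum
  -- is at most `δ₀`, where the linear approximation is valid, and the control moves by at most `ρ *
  -- (1 + M) ≤ ε`.
  set ρ := min (δ₀ / 2) (ε / (2 * (1 + M))) with hρ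
  have hρ0 : 0 < ρ := by positivity
  have hρε : ρ * (1 + M) ≤ ε / 2 := by
    have : ρ ≤ ε / (2 * (1 + M)) := min_le_right _ _
    rw [le_div_iff₀ (by positivity)] at this
    linarith
  have hρδ : ρ ≤ δ₀ / 2 := min_le_left _ _
  have ev1 : ∀ᶠ s : ℝ in 𝓝 0, ‖s • R.state q₀ + s ^ 2 • (R.state q₁ + R.second q₀)‖ < ρ := by
    have hc : Continuous fun s : ℝ => ‖s • R.state q₀ + s ^ 2 • (R.state q₁ + R.second q₀)‖ := by
      fun_prop
    exact hc.continuousAt.eventually_lt continuousAt_const (by simpa using hρ0)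
  have ev2 : ∀ᶠ s : ℝ in 𝓝 0, |s| * M₀ + s ^ 2 * M₁ < ρ := by
    have hc : Continuous fun s : ℝ => |s| * M₀ + s ^ 2 * M₁ := by fun_prop
    exact hc.continuousAt.eventually_lt continuousAt_const (by simpa using hρ0)
  have ev3 : ∀ᶠ s : ℝ in 𝓝 0, κ * s ^ 2 < ρ := by
    have hc : Continuous fun s : ℝ => κ * s ^ 2 := by fun_prop
    exact hc.continuousAt.eventually_lt continuousAt_const (by simpa using hρ0)
  obtain ⟨δ₃, hδ₃, hev⟩ := Metric.eventually_nhds_iff.1 (ev1.and (ev2.and ev3))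
  refine ⟨min (min δ₁ δ₂) (δ₃ / 2), by positivity, fun s hs hsδ => ?_⟩
  have hs1 : s ≤ δ₁ := hsδ.trans ((min_le_left _ _).trans (min_le_left _ _))
  have hs2 : s ≤ δ₂ := hsδ.trans ((min_le_left _ _).trans (min_le_right _ _))
  have hs3 : s ≤ δ₃ / 2 := hsδ.trans (min_le_right _ _)
  obtain ⟨hx, hc, hr⟩ := hev (y := s) (by
    rw [Real.dist_eq, sub_zero, abs_of_nonneg hs]; linarith)
  set ξ := R.x ⟨0, le_rfl, R.hT⟩ + (s • q₀.1 + s ^ 2 • q₁.1) with hξ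
  set c := R.curveControl q₀ q₁ s with hcdef
  set xs := R.curveState q₀ q₁ s with hxs
  have hxs' : ‖xs - R.x‖ ≤ ρ := by
    rw [hxs, curveState, add_sub_cancel_left]; exact hx.le
  have hcm : AEStronglyMeasurable c (timeMeasure T) := R.aestronglyMeasurable_curveControl q₀ q₁ s
  have hcb : ∀ᵐ t ∂timeMeasure T, ‖c t - R.c t‖ ≤ ρ := by
    filter_upwards [hM₀, hM₁] with t ht0 ht1
    rw [hcdef, curveControl, add_sub_cancel_left]
    refine ((norm_add_le _ _).trans (add_le_add ?_ ?_)).trans hc.le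
    · rw [norm_smul, Real.norm_eq_abs]; gcongr
    · rw [norm_smul, Real.norm_of_nonneg (by positivity)]; gcongr
  have hres : ‖R.residual H S ξ c (xs, 0)‖ ≤ κ / K * s ^ 2 := by
    refine max_le ?_ ?_
    · have e : (R.residual H S ξ c (xs, 0)).1 = xs - ContinuousMap.const _ ξ -
          primitive T (fun t => R.F (extendIcc R.hT xs t, c t)) := by
        simp only [residual, map_zero, Prod.fst_zero, add_zero, Prod.snd_zero]
        congr 1
        refine primitive_congr ?_
        filter_upwards [Lp.coeFn_zero C 2 (timeMeasure T)] with t ht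
        rw [ht]; simp
      change ‖(R.residual H S ξ c (xs, 0)).1‖ ≤ _
      rw [e]
      exact hexp₁ s hs hs1
    · have := hexp₂ s hs hs2
      rwa [hlin, hcurv, smul_zero, smul_zero, sub_zero, sub_zero] at this
  have hKres : K * ‖R.residual H S ξ c (xs, 0)‖ ≤ κ * s ^ 2 := by
    calc K * ‖R.residual H S ξ c (xs, 0)‖ ≤ K * (κ / K * s ^ 2) := by gcongr
      _ = κ * s ^ 2 := by field_simp
  have hball : ∀ z ∈ Metric.closedBall ((xs, 0) : C(Icc 0 T, E) × Y) ρ,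
      ‖z.1 - R.x‖ ≤ δ₀ ∧ ‖z.2‖ ≤ δ₀ := by
    intro z hz
    rw [mem_closedBall_iff_norm] at hz
    have h1 : ‖z.1 - xs‖ ≤ ρ := (norm_fst_le (z - (xs, 0))).trans hz
    have h2 : ‖z.2 - 0‖ ≤ ρ := (norm_snd_le (z - (xs, 0))).trans hz
    rw [sub_zero] at h2
    refine ⟨?_, by linarith⟩
    have := norm_sub_le_norm_sub_add_norm_sub z.1 xs R.x
    linarith
  obtain ⟨z, hz0, hz⟩ := hLy (R.residual H S ξ c) (xs, 0) ρ (fun z hz z' hz' =>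
    happ ξ c hcm (by filter_upwards [hcb] with t ht; linarith) z z' (hball z hz).1 (hball z hz).2
      (hball z' hz').1 (hball z' hz').2) (hKres.trans hr.le)
  have hz' := hz.trans hKres
  have h1 : ‖z.1 - xs‖ ≤ κ * s ^ 2 := (norm_fst_le (z - (xs, 0))).trans hz'
  have h2 : ‖z.2‖ ≤ ρ := by
    have : ‖z.2 - 0‖ ≤ κ * s ^ 2 := (norm_snd_le (z - (xs, 0))).trans hz'
    rw [sub_zero] at this
    linarith
  have hρε' : 2 * ρ ≤ ε := by nlinarith
  have heq : z.1 = ContinuousMap.const _ (ξ + (S z.2).1) +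
      primitive T (fun t => R.F (extendIcc R.hT z.1 t, c t + (S z.2).2 t)) := by
    have := congrArg Prod.fst hz0
    simp only [residual, Prod.fst_zero] at this
    rw [sub_sub] at this
    exact sub_eq_zero.1 this
  refine ⟨z.1, fun t => c t + (S z.2).2 t, ⟨hcm.add (Lp.aestronglyMeasurable _), ?_, ?_, ?_⟩, ?_,
    h1⟩
  · have h3 : z.1 ⟨0, le_rfl, R.hT⟩ = ξ + (S z.2).1 := by
      rw [heq, ContinuousMap.add_apply, primitive_zero R.hT]; simp
    rw [h3]
    exact heq
  · have := norm_sub_le_norm_sub_add_norm_sub z.1 xs R.x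
    linarith
  · filter_upwards [hcb, hM z.2] with t ht1 ht2
    have e : c t + (S z.2).2 t - R.c t = (c t - R.c t) + (S z.2).2 t := by abel
    rw [e]
    refine (norm_add_le _ _).trans ?_
    have : M * ‖z.2‖ ≤ M * ρ := by gcongr
    nlinarith
  · have := congrArg Prod.snd hz0
    exact sub_eq_zero.1 this

/-- If the linearized equations `H = const` are solvable with bounded controls and the second order
expansion in some direction makes all components of `Φ` decrease, then there are nearby
trajectories with the same value of `H` and smaller values of `Φ`. -/
theorem exists_nearby_decrease {ι : Type*} [Fintype ι] {Φ : E × E → ι → ℝ} (hΦ : ContDiff ℝ 2 Φ)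
    {H : E × E → Y} (hH : ContDiff ℝ 2 H)
    (S : Y →L[ℝ] E × Lp C 2 (timeMeasure T)) (hS : ∀ y, R.lin H (S y) = y) {M : ℝ} (hM0 : 0 ≤ M)
    (hM : ∀ y, ∀ᵐ t ∂timeMeasure T, ‖(S y).2 t‖ ≤ M * ‖y‖) {q₀ q₁ : E × Lp C 2 (timeMeasure T)}
    (h₀ : q₀ ∈ boundedDirections E C T) (h₁ : q₁ ∈ boundedDirections E C T)
    (hlin : R.lin H q₀ = 0) (hcurv : R.lin H q₁ + R.curv H q₀ = 0)
    (hlinΦ : ∀ i, R.lin Φ q₀ i ≤ 0) (hcurvΦ : ∀ i, R.lin Φ q₁ i + R.curv Φ q₀ i < 0)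
    {ε : ℝ} (hε : 0 < ε) :
    ∃ x c, R.IsNearbyTrajectory ε x c ∧ H (ends R.hT E x) = H (ends R.hT E R.x) ∧
      ∀ i, Φ (ends R.hT E x) i < Φ (ends R.hT E R.x) i := by
  obtain ⟨γ, hγ, hγ'⟩ : ∃ γ > 0, ∀ i, R.lin Φ q₁ i + R.curv Φ q₀ i ≤ -γ := by
    rcases isEmpty_or_nonempty ι with h | h
    · exact ⟨1, one_pos, fun i => h.elim i⟩
    · obtain ⟨j, hj⟩ := Finite.exists_max fun i => R.lin Φ q₁ i + R.curv Φ q₀ i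
      refine ⟨-(R.lin Φ q₁ j + R.curv Φ q₀ j), by linarith [hcurvΦ j], fun i => ?_⟩
      rw [neg_neg]; exact hj i
  obtain ⟨δ₀, hδ₀, hstrict⟩ := exists_strict_approx (hΦ.of_le (by norm_num) : ContDiff ℝ 1 Φ)
    ‖ends R.hT E R.x‖ one_pos
  set L := ‖fderiv ℝ Φ (ends R.hT E R.x)‖ + 1 with hL
  have hL0 : 0 < L := by positivity
  -- `L` is a Lipschitz constant of `Φ` near the endpoints, so the correction changes `Φ` by at most
  -- `γ / 4 * s ^ 2`. The expansion error below costs another `γ / 4 * s ^ 2`, against a gain of at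
  -- least `γ * s ^ 2`; the first order term is nonpositive since `s ≥ 0`.
  obtain ⟨δ₁, hδ₁, hcurve⟩ := R.exists_nearby_curve hH S hS hM0 hM h₀ h₁ hlin hcurv
    (ε := min ε δ₀) (κ := γ / (4 * L)) (by positivity) (by positivity)
  obtain ⟨δ₂, hδ₂, hexp⟩ := R.exists_endpoint_expansion hΦ q₀ q₁ (ε := γ / 4) (by positivity)
  have ev : ∀ᶠ s : ℝ in 𝓝 0, ‖s • R.state q₀ + s ^ 2 • (R.state q₁ + R.second q₀)‖ < δ₀ := by
    have hc : Continuous fun s : ℝ => ‖s • R.state q₀ + s ^ 2 • (R.state q₁ + R.second q₀)‖ := by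
      fun_prop
    exact hc.continuousAt.eventually_lt continuousAt_const (by simpa using hδ₀)
  obtain ⟨δ₃, hδ₃, hev⟩ := Metric.eventually_nhds_iff.1 ev
  set s := min (min δ₁ δ₂) (δ₃ / 2) with hs
  have hs0 : 0 < s := by positivity
  have hs1 : s ≤ δ₁ := (min_le_left _ _).trans (min_le_left _ _)
  have hs2 : s ≤ δ₂ := (min_le_left _ _).trans (min_le_right _ _)
  have hs3 : s ≤ δ₃ / 2 := min_le_right _ _
  have hxs := hev (y := s) (by rw [Real.dist_eq, sub_zero, abs_of_nonneg hs0.le]; linarith)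
  obtain ⟨x, c, ⟨hc, hx, hxε, hcε⟩, hHx, hxd⟩ := hcurve s hs0.le hs1
  refine ⟨x, c, ⟨hc, hx, hxε.trans (min_le_left _ _), ?_⟩, hHx, fun i => ?_⟩
  · filter_upwards [hcε] with t ht
    exact ht.trans (min_le_left _ _)
  have h1 := hexp s hs0.le hs2
  have hmem1 : ends R.hT E x ∈ Metric.closedBall (ends R.hT E R.x) δ₀ := by
    rw [mem_closedBall_iff_norm, ← map_sub]
    exact (norm_ends_le _ _).trans (hxε.trans (min_le_right _ _))
  have hmem2 : ends R.hT E (R.curveState q₀ q₁ s) ∈ Metric.closedBall (ends R.hT E R.x) δ₀ := by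
    rw [mem_closedBall_iff_norm, ← map_sub]
    refine (norm_ends_le _ _).trans ?_
    rw [curveState, add_sub_cancel_left]; exact hxs.le
  have h2 := hstrict _ le_rfl _ hmem1 _ hmem2
  rw [one_mul] at h2
  have h3 : ‖ends R.hT E x - ends R.hT E (R.curveState q₀ q₁ s)‖ ≤ γ / (4 * L) * s ^ 2 := by
    rw [← map_sub]; exact (norm_ends_le _ _).trans hxd
  have h4 : ‖Φ (ends R.hT E x) - Φ (ends R.hT E (R.curveState q₀ q₁ s))‖ ≤ γ / 4 * s ^ 2 := by
    set d := ends R.hT E x - ends R.hT E (R.curveState q₀ q₁ s) with hd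
    calc ‖Φ (ends R.hT E x) - Φ (ends R.hT E (R.curveState q₀ q₁ s))‖
        ≤ ‖Φ (ends R.hT E x) - Φ (ends R.hT E (R.curveState q₀ q₁ s)) -
            fderiv ℝ Φ (ends R.hT E R.x) d‖ + ‖fderiv ℝ Φ (ends R.hT E R.x) d‖ := by
          simpa using norm_add_le (Φ (ends R.hT E x) - Φ (ends R.hT E (R.curveState q₀ q₁ s)) -
            fderiv ℝ Φ (ends R.hT E R.x) d) (fderiv ℝ Φ (ends R.hT E R.x) d)
      _ ≤ ‖d‖ + ‖fderiv ℝ Φ (ends R.hT E R.x)‖ * ‖d‖ :=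
          add_le_add h2 (ContinuousLinearMap.le_opNorm _ _)
      _ = L * ‖d‖ := by rw [hL]; ring
      _ ≤ L * (γ / (4 * L) * s ^ 2) := by gcongr
      _ = γ / 4 * s ^ 2 := by field_simp
  have h5 := (abs_le.1 ((norm_le_pi_norm _ i).trans h4)).2
  have h6 := (abs_le.1 ((norm_le_pi_norm _ i).trans h1)).2
  simp only [Pi.sub_apply, Pi.smul_apply, Pi.add_apply, smul_eq_mul] at h5 h6
  have h7 : s * R.lin Φ q₀ i ≤ 0 := mul_nonpos_of_nonneg_of_nonpos hs0.le (hlinΦ i)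
  have h8 : 0 < s ^ 2 := by positivity
  have h9 := mul_le_mul_of_nonneg_left (hγ' i) h8.le
  nlinarith

end ReferenceTrajectory

/-! ### Finite dimensional separation, multipliers, and density in fibers -/

section Duality

variable {V : Type*} [NormedAddCommGroup V] [NormedSpace ℝ V] {ι κ : Type*} [Fintype ι] [Fintype κ]

/-- The pairing of `(α, β)` with a vector. -/
def pairing (ab k : (ι → ℝ) × (κ → ℝ)) : ℝ := ∑ i, ab.1 i * k.1 i + ∑ j, ab.2 j * k.2 j

theorem pairing_add (ab k k' : (ι → ℝ) × (κ → ℝ)) :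
    pairing ab (k + k') = pairing ab k + pairing ab k' := by
  simp only [pairing, Prod.fst_add, Prod.snd_add, Pi.add_apply, mul_add, Finset.sum_add_distrib]
  ring

theorem pairing_smul (ab k : (ι → ℝ) × (κ → ℝ)) (r : ℝ) :
    pairing ab (r • k) = r * pairing ab k := by
  simp only [pairing, Prod.smul_fst, Prod.smul_snd, Pi.smul_apply, smul_eq_mul, mul_add,
    Finset.mul_sum]
  congr 1 <;> exact Finset.sum_congr rfl fun i _ => by ring

theorem smul_pairing (ab k : (ι → ℝ) × (κ → ℝ)) (r : ℝ) :
    pairing (r • ab) k = r * pairing ab k := by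
  simp only [pairing, Prod.smul_fst, Prod.smul_snd, Pi.smul_apply, smul_eq_mul, mul_add,
    Finset.mul_sum, mul_assoc]

theorem continuous_pairing :
    Continuous fun p : ((ι → ℝ) × (κ → ℝ)) × ((ι → ℝ) × (κ → ℝ)) => pairing p.1 p.2 := by
  unfold pairing
  fun_prop

/-- The normalized Lagrange multipliers of the constraints `L.1 ≤ 0`, `L.2 = 0`. -/
def normalizedMultipliers (L : V → (ι → ℝ) × (κ → ℝ)) : Set ((ι → ℝ) × (κ → ℝ)) :=
  {ab | ∑ i, |ab.1 i| + ∑ j, |ab.2 j| = 1 ∧ (∀ i, 0 ≤ ab.1 i) ∧ ∀ q, pairing ab (L q) = 0}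

theorem isCompact_normalizedMultipliers (L : V → (ι → ℝ) × (κ → ℝ)) :
    IsCompact (normalizedMultipliers L) := by
  refine Metric.isCompact_of_isClosed_isBounded ?_ ?_
  · have h1 : IsClosed {ab : (ι → ℝ) × (κ → ℝ) | ∑ i, |ab.1 i| + ∑ j, |ab.2 j| = 1} :=
      isClosed_eq (by fun_prop) continuous_const
    have h2 : IsClosed {ab : (ι → ℝ) × (κ → ℝ) | ∀ i, 0 ≤ ab.1 i} := by
      simp only [ofPred_forall]
      exact isClosed_iInter fun i => isClosed_le continuous_const (by fun_prop)
    have h3 : IsClosed {ab : (ι → ℝ) × (κ → ℝ) | ∀ q, pairing ab (L q) = 0} := by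
      simp only [ofPred_forall]
      refine isClosed_iInter fun q => isClosed_eq ?_ continuous_const
      exact continuous_pairing.comp (continuous_id.prodMk continuous_const)
    exact h1.inter (h2.inter h3)
  · refine (Metric.isBounded_closedBall (x := 0) (r := 1)).subset fun ab hab => ?_
    have h := hab.1
    have h1 : 0 ≤ ∑ i, |ab.1 i| := Finset.sum_nonneg fun _ _ => abs_nonneg _
    have h2 : 0 ≤ ∑ j, |ab.2 j| := Finset.sum_nonneg fun _ _ => abs_nonneg _
    rw [mem_closedBall_zero_iff]
    refine max_le ((pi_norm_le_iff_of_nonneg zero_le_one).2 fun i => ?_)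
      ((pi_norm_le_iff_of_nonneg zero_le_one).2 fun j => ?_)
    · have := Finset.single_le_sum (f := fun i => |ab.1 i|) (fun _ _ => abs_nonneg _)
        (Finset.mem_univ i)
      rw [Real.norm_eq_abs]; linarith
    · have := Finset.single_le_sum (f := fun j => |ab.2 j|) (fun _ _ => abs_nonneg _)
        (Finset.mem_univ j)
      rw [Real.norm_eq_abs]; linarith

theorem exists_normalized {L : V → (ι → ℝ) × (κ → ℝ)} {k ab : (ι → ℝ) × (κ → ℝ)} (hne : ab ≠ 0)
    (hpos : ∀ i, 0 ≤ ab.1 i) (hL : ∀ q, pairing ab (L q) = 0) (hk : 0 ≤ pairing ab k) :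
    ∃ ab ∈ normalizedMultipliers L, 0 ≤ pairing ab k := by
  set N := ∑ i, |ab.1 i| + ∑ j, |ab.2 j| with hN
  have h1 : 0 ≤ ∑ i, |ab.1 i| := Finset.sum_nonneg fun _ _ => abs_nonneg _
  have h2 : 0 ≤ ∑ j, |ab.2 j| := Finset.sum_nonneg fun _ _ => abs_nonneg _
  have hN0 : 0 < N := by
    refine lt_of_le_of_ne (by positivity) fun h0 => hne ?_
    have e1 : ∑ i, |ab.1 i| = 0 := by linarith
    have e2 : ∑ j, |ab.2 j| = 0 := by linarith
    rw [Finset.sum_eq_zero_iff_of_nonneg fun _ _ => abs_nonneg _] at e1 e2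
    refine Prod.ext (funext fun i => ?_) (funext fun j => ?_)
    · exact abs_eq_zero.1 (e1 i (Finset.mem_univ i))
    · exact abs_eq_zero.1 (e2 j (Finset.mem_univ j))
  refine ⟨N⁻¹ • ab, ⟨?_, fun i => ?_, fun q => ?_⟩, ?_⟩
  · simp only [Prod.smul_fst, Prod.smul_snd, Pi.smul_apply, smul_eq_mul, abs_mul,
      abs_of_pos (inv_pos.2 hN0), ← Finset.mul_sum]
    rw [← mul_add, ← hN, inv_mul_cancel₀ hN0.ne']
  · exact mul_nonneg (inv_nonneg.2 hN0.le) (hpos i)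
  · rw [smul_pairing, hL, mul_zero]
  · rw [smul_pairing]; exact mul_nonneg (inv_nonneg.2 hN0.le) hk

open Classical in
/-- The coefficients of a linear functional on `ℝ^ι × ℝ^κ`. -/
theorem exists_pairing_eq (f : (ι → ℝ) × (κ → ℝ) →ₗ[ℝ] ℝ) :
    ∃ ab : (ι → ℝ) × (κ → ℝ), ∀ k, f k = pairing ab k := by
  refine ⟨(fun i => f (Pi.single i 1, 0), fun j => f (0, Pi.single j 1)), fun k => ?_⟩
  have e1 : k.1 = ∑ i, k.1 i • Pi.single i (1 : ℝ) := by
    simpa using! pi_eq_sum_univ' k.1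
  have e2 : k.2 = ∑ i, k.2 i • Pi.single i (1 : ℝ) := by
    simpa using! pi_eq_sum_univ' k.2
  have e : f k = f.comp (LinearMap.inl ℝ _ _) k.1 + f.comp (LinearMap.inr ℝ _ _) k.2 := by
    simp only [LinearMap.comp_apply, LinearMap.inl_apply, LinearMap.inr_apply, ← map_add]
    simp
  rw [e]
  nth_rw 1 [e1]
  nth_rw 1 [e2]
  rw [map_sum, map_sum]
  simp only [map_smul, smul_eq_mul, pairing, LinearMap.comp_apply, LinearMap.inl_apply,
    LinearMap.inr_apply]
  congr 1 <;> exact Finset.sum_congr rfl fun i _ => mul_comm _ _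

theorem nonneg_of_forall_add_mul_pos {c a : ℝ} (h : ∀ t > 0, 0 < c + t * a) : 0 ≤ a := by
  by_contra! ha
  have := h ((|c| + 1) / (-a)) (by have := neg_pos.2 ha; positivity)
  have e : (|c| + 1) / (-a) * a = -(|c| + 1) := by
    rw [div_neg, neg_mul, div_mul_cancel₀ _ ha.ne]
  rw [e] at this
  linarith [le_abs_self c]

theorem nonneg_of_forall_small {c a : ℝ} (h : ∀ t > 0, 0 < c + t * a) : 0 ≤ c := by
  by_contra! hc
  have := h (-c / (|a| + 1)) (by have := neg_pos.2 hc; positivity)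
  have e : -c / (|a| + 1) * a ≤ -c := by
    rw [div_mul_eq_mul_div, div_le_iff₀ (by positivity)]
    nlinarith [le_abs_self a]
  linarith

open Classical in
/-- An alternative: either an affine system of strict inequalities and equations with linearly
independent equations is solvable, or there is a multiplier certifying the contrary. -/
theorem exists_multiplier_of_not_solvable (L : V →ₗ[ℝ] (ι → ℝ) × (κ → ℝ))
    (k : (ι → ℝ) × (κ → ℝ))
    (h : Function.Surjective (fun q => (L q).2) →
      ¬∃ q, (∀ i, (L q).1 i + k.1 i < 0) ∧ (L q).2 + k.2 = 0) :
    ∃ ab ∈ normalizedMultipliers L, 0 ≤ pairing ab k := by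
  by_cases hs : Function.Surjective (fun q => (L q).2)
  -- Slack variables `y > 0` turn the strict inequalities into equations. The image of the open
  -- convex set of admissible `(q, y)` under the surjection `Q`, translated by `k`, is open and
  -- convex and misses `0`, so it can be separated from `0`.
  · let Q : V × (ι → ℝ) →ₗ[ℝ] (ι → ℝ) × (κ → ℝ) :=
      L ∘ₗ LinearMap.fst ℝ _ _ + LinearMap.inl ℝ _ _ ∘ₗ LinearMap.snd ℝ _ _
    have hQ : ∀ q y, Q (q, y) = L q + (y, 0) := fun q y => rfl
    have hQs : Function.Surjective Q := by
      rintro ⟨a, b⟩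
      obtain ⟨q, hq⟩ := hs b
      refine ⟨(q, a - (L q).1), ?_⟩
      rw [hQ]
      refine Prod.ext ?_ ?_
      · simp
      · simpa using! hq
    let P : Set (V × (ι → ℝ)) := {p | ∀ i, 0 < p.2 i}
    have hPo : IsOpen P := by
      simp only [P, ofPred_forall]
      exact isOpen_iInter_of_finite fun i => isOpen_lt continuous_const (by fun_prop)
    have hPc : Convex ℝ P := by
      intro x hx y hy a b ha hb hab i
      have h1 := hx i
      have h2 := hy i
      simp only [Prod.snd_add, Prod.smul_snd, Pi.add_apply, Pi.smul_apply, smul_eq_mul]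
      rcases ha.eq_or_lt with h | h
      · have : b = 1 := by linarith
        rw [← h, this]; simpa using h2
      · have := mul_pos h h1
        have := mul_nonneg hb h2.le
        linarith
    have hDo : IsOpen ((fun z => k + z) '' (Q '' P)) :=
      (Homeomorph.addLeft k).isOpenMap _ (Q.isOpenMap_of_finiteDimensional hQs _ hPo)
    have hDc : Convex ℝ ((fun z => k + z) '' (Q '' P)) := (hPc.linear_image Q).translate k
    have h0 : (0 : (ι → ℝ) × (κ → ℝ)) ∉ (fun z => k + z) '' (Q '' P) := by
      rintro ⟨-, ⟨⟨q, y⟩, hy, rfl⟩, hz⟩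
      refine h hs ⟨q, fun i => ?_, ?_⟩
      · have := congrFun (congrArg Prod.fst hz) i
        simp only [hQ, Prod.fst_add, Pi.add_apply, Prod.fst_zero, Pi.zero_apply] at this
        have := hy i
        simp only at this
        linarith
      · have := congrArg Prod.snd hz
        simp only [hQ, Prod.snd_add, Prod.snd_zero, add_zero] at this
        rw [add_comm]; exact this
    obtain ⟨f, hf⟩ := geometric_hahn_banach_open_point hDc hDo h0
    obtain ⟨ab, hab⟩ := exists_pairing_eq (-f : StrongDual ℝ ((ι → ℝ) × (κ → ℝ))).toLinearMap
    -- All properties of the multiplier follow from this strict inequality: large multiples of `±q`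
    -- force `pairing ab (L q) = 0`, large slacks in one coordinate force `α i ≥ 0`, slacks tending
    -- to zero give `pairing ab k ≥ 0`, and strictness excludes `ab = 0`.
    have key : ∀ q (y : ι → ℝ), (∀ i, 0 < y i) →
        0 < pairing ab k + (pairing ab (L q) + pairing ab (y, 0)) := by
      intro q y hy
      have h1 := hf _ ⟨_, ⟨(q, y), hy, rfl⟩, rfl⟩
      rw [map_zero, hQ] at h1
      rw [← pairing_add, ← pairing_add, ← hab]
      have h2 : f k + (f (L q) + f (y, 0)) < 0 := by simpa using h1
      have h3 : (-f : StrongDual ℝ ((ι → ℝ) × (κ → ℝ))).toLinearMap (k + (L q + (y, 0))) =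
          -(f k + (f (L q) + f (y, 0))) := by
        rw [← map_add, ← map_add]; rfl
      rw [h3]
      linarith
    have hp0 : pairing ab 0 = 0 := by simp [pairing]
    have hone : ∀ i : ι, (0 : ℝ) < (fun _ : ι => (1 : ℝ)) i := fun _ => one_pos
    have hLq : ∀ q, 0 ≤ pairing ab (L q) := by
      intro q
      refine nonneg_of_forall_add_mul_pos (c := pairing ab k + pairing ab (fun _ => 1, 0))
        fun t _ => ?_
      have := key (t • q) (fun _ => 1) hone
      rw [map_smul, pairing_smul] at this
      linarith
    refine exists_normalized (ab := ab) ?_ (fun i => ?_) (fun q => ?_) ?_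
    · rintro rfl
      have := key 0 (fun _ => 1) hone
      simp [pairing] at this
    · refine nonneg_of_forall_add_mul_pos (c := pairing ab k + pairing ab (fun _ => 1, 0))
        fun t ht => ?_
      have := key 0 ((fun _ => 1) + t • Pi.single i 1) (fun j => by
        have : (0 : ℝ) ≤ (Pi.single i (1 : ℝ) : ι → ℝ) j := by
          by_cases hj : j = i
          · subst hj; simp
          · simp [hj]
        simp only [Pi.add_apply, Pi.smul_apply, smul_eq_mul]
        positivity)
      have e : (((fun _ => 1) + t • Pi.single i 1, 0) : (ι → ℝ) × (κ → ℝ)) =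
          ((fun _ => 1), 0) + t • (Pi.single i 1, 0) := by simp
      have e2 : pairing ab ((Pi.single i 1, 0) : (ι → ℝ) × (κ → ℝ)) = ab.1 i := by
        simp [pairing, Pi.single_apply]
      rw [map_zero, hp0, e, pairing_add, pairing_smul, e2] at this
      linarith
    · refine le_antisymm ?_ (hLq q)
      have := hLq (-q)
      rw [← neg_one_smul ℝ q, map_smul, pairing_smul] at this
      linarith
    · refine nonneg_of_forall_small (a := pairing ab (fun _ => 1, 0)) fun t ht => ?_
      have := key 0 (t • fun _ => 1) (fun i => by simpa using ht)
      have e : ((t • fun _ => 1, 0) : (ι → ℝ) × (κ → ℝ)) = t • ((fun _ => 1), 0) := by simp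
      rw [map_zero, hp0, e, pairing_smul] at this
      linarith
  -- In the degenerate case a nonzero functional vanishing on the range of the equations is a
  -- multiplier with `α = 0`. Its sign is free and is chosen so that the pairing with `k` is
  -- nonnegative.
  · let L₂ : V →ₗ[ℝ] κ → ℝ := LinearMap.snd ℝ _ _ ∘ₗ L
    have hlt : LinearMap.range L₂ < ⊤ := by
      rw [lt_top_iff_ne_top]
      intro h'
      exact hs (LinearMap.range_eq_top.1 h')
    obtain ⟨f, hf0, hf⟩ := (LinearMap.range L₂).exists_le_ker_of_lt_top hlt
    obtain ⟨ab, hab⟩ := exists_pairing_eq (f ∘ₗ LinearMap.snd ℝ (ι → ℝ) (κ → ℝ))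
    have hne : ab ≠ 0 := by
      rintro rfl
      refine hf0 (LinearMap.ext fun y => ?_)
      have := hab (0, y)
      simpa [pairing] using this
    have h1 : ∀ i, ab.1 i = 0 := by
      intro i
      have := hab (Pi.single i 1, 0)
      simpa [pairing, Pi.single_apply] using this.symm
    have hL : ∀ q, pairing ab (L q) = 0 := by
      intro q
      rw [← hab]
      exact hf ⟨q, rfl⟩
    rcases le_total 0 (pairing ab k) with hk | hk
    · exact exists_normalized hne (fun i => (h1 i).ge) hL hk
    · refine exists_normalized (ab := (-1 : ℝ) • ab) ?_ (fun i => ?_) (fun q => ?_) ?_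
      · simpa using hne
      · simp [h1]
      · rw [smul_pairing, hL, mul_zero]
      · rw [smul_pairing]; linarith

/-- Density of a subspace in the fibers of a linear map with values in a finite dimensional
space. -/
theorem mem_closure_fiber {W : Type*} [NormedAddCommGroup W] [NormedSpace ℝ W]
    [FiniteDimensional ℝ W] (D : Submodule ℝ V) (hD : Dense (D : Set V)) (A : V →L[ℝ] W) (v : V) :
    v ∈ closure {d | d ∈ D ∧ A d = A v} := by
  let A' : D →ₗ[ℝ] W := A.toLinearMap ∘ₗ D.subtype
  obtain ⟨r₀, hr₀⟩ := A'.rangeRestrict.exists_rightInverse_of_surjective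
    (LinearMap.range_rangeRestrict _)
  obtain ⟨r, hr⟩ := LinearMap.exists_extend (r₀ : LinearMap.range A' →ₗ[ℝ] D)
  have hr' : ∀ y ∈ LinearMap.range A', A (r y) = y := by
    intro y hy
    have h1 : r y = r₀ ⟨y, hy⟩ := by
      rw [← hr]; rfl
    have h2 := congrArg (fun f => (f ⟨y, hy⟩ : W)) hr₀
    rw [h1]
    exact h2
  have hclosed : IsClosed (LinearMap.range A' : Set W) :=
    Submodule.closed_of_finiteDimensional _
  -- The image of `D` is a subspace of a finite dimensional space, hence closed, so by density it is
  -- already the whole range of `A`.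
  have hrange : ∀ x, A x ∈ LinearMap.range A' := by
    intro x
    have : A x ∈ closure (LinearMap.range A' : Set W) :=
      map_mem_closure A.continuous (hD x) fun d hd => ⟨⟨d, hd⟩, rfl⟩
    rwa [hclosed.closure_eq] at this
  -- A continuous projection onto the fiber of `v` that corrects by elements of `D`: it fixes `v`
  -- and maps `D` into the part of the fiber lying in `D`.
  let g : V → V := fun x => x + r (A v - A x)
  have hrc : Continuous (fun y => ((r y : D) : V)) :=
    continuous_subtype_val.comp r.continuous_of_finiteDimensional
  have hg : Continuous g := by
    refine continuous_id.add (hrc.comp ?_)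
    fun_prop
  have hgv : g v = v := by simp [g]
  rw [← hgv]
  refine map_mem_closure hg (hD v) fun d hd => ⟨D.add_mem hd (r _).2, ?_⟩
  simp only [g, map_add, sub_self, map_zero, ZeroMemClass.coe_zero, add_zero]
  rw [hr' _ ((LinearMap.range A').sub_mem (hrange v) (hrange d))]
  abel

end Duality

/-! ### The abstract second order necessary condition -/

namespace ReferenceTrajectory

variable {E C : Type*} [NormedAddCommGroup E] [NormedSpace ℝ E] [NormedAddCommGroup C]
  [NormedSpace ℝ C] {T : ℝ} (R : ReferenceTrajectory E C T)
  [FiniteDimensional ℝ E] [FiniteDimensional ℝ C]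

theorem dense_boundedDirections :
    Dense (boundedDirections E C T : Set (E × Lp C 2 (timeMeasure T))) := by
  rintro ⟨ξ, c⟩
  have h := Lp.simpleFunc.dense (E := C) (p := 2) (μ := timeMeasure T) (by norm_num) c
  refine map_mem_closure (f := fun c => (ξ, c)) (by fun_prop) h fun f hf => ?_
  obtain ⟨M, hM⟩ := SimpleFunc.exists_forall_norm_le (Lp.simpleFunc.toSimpleFunc ⟨f, hf⟩)
  refine ⟨M, ?_⟩
  filter_upwards [Lp.simpleFunc.toSimpleFunc_eq_toFun ⟨f, hf⟩] with t ht
  have := hM t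
  rw [ht] at this
  exact this

/-- Each `S y` has its own essential bound. Viewed as a linear map into `L^∞` on a finite
dimensional space, `S` is automatically continuous, and its operator norm is a uniform `M`. -/
theorem exists_uniform_bound {Y : Type*} [NormedAddCommGroup Y] [NormedSpace ℝ Y]
    [FiniteDimensional ℝ Y] (S : Y →ₗ[ℝ] boundedDirections E C T) :
    ∃ M : ℝ, 0 ≤ M ∧ ∀ y, ∀ᵐ t ∂timeMeasure T, ‖(S y).1.2 t‖ ≤ M * ‖y‖ := by
  have hmem : ∀ y, MemLp (S y).1.2 ⊤ (timeMeasure T) := fun y => by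
    obtain ⟨M, hM⟩ := (S y).2
    exact memLp_top_of_bound (Lp.aestronglyMeasurable _) M hM
  let J : Y →ₗ[ℝ] Lp C ⊤ (timeMeasure T) :=
    { toFun := fun y => (hmem y).toLp
      map_add' := fun y z => by
        rw [← MemLp.toLp_add]
        refine MemLp.toLp_congr _ _ ?_
        rw [map_add]
        exact Lp.coeFn_add _ _
      map_smul' := fun a y => by
        rw [RingHom.id_apply, ← MemLp.toLp_const_smul]
        refine MemLp.toLp_congr _ _ ?_
        rw [map_smul]
        exact Lp.coeFn_smul _ _ }
  refine ⟨‖J.toContinuousLinearMap‖, norm_nonneg _, fun y => ?_⟩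
  filter_upwards [ae_norm_le_norm_Lp_top (J y), (hmem y).coeFn_toLp] with t h1 h2
  have h3 : J y t = (S y).1.2 t := h2
  rw [← h3]
  exact h1.trans (J.toContinuousLinearMap.le_opNorm y)

/-- The second order necessary condition for trajectories that cannot be improved: in every critical
direction some multiplier makes the second variation nonnegative. -/
theorem exists_multiplier {ι κ : Type*} [Fintype ι] [Fintype κ] {Φ : E × E → ι → ℝ}
    (hΦ : ContDiff ℝ 2 Φ) {H : E × E → κ → ℝ} (hH : ContDiff ℝ 2 H) {ε : ℝ} (hε : 0 < ε)
    (hmin : ∀ x c, R.IsNearbyTrajectory ε x c → H (ends R.hT E x) = H (ends R.hT E R.x) →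
      ¬∀ i, Φ (ends R.hT E x) i < Φ (ends R.hT E R.x) i)
    (q : E × Lp C 2 (timeMeasure T)) (hqH : R.lin H q = 0) (hqΦ : ∀ i, R.lin Φ q i ≤ 0) :
    ∃ ab ∈ normalizedMultipliers (fun q => (R.lin Φ q, R.lin H q)),
      0 ≤ pairing ab (R.curv Φ q, R.curv H q) := by
  set A : E × Lp C 2 (timeMeasure T) →L[ℝ] (ι → ℝ) × (κ → ℝ) := (R.lin Φ).prod (R.lin H) with hA
  have hAq : ∀ q, A q = (R.lin Φ q, R.lin H q) := fun _ => rfl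
  -- For bounded directions, a solution `q₁` of the second order system would give a forbidden
  -- improvement, so the alternative supplies a multiplier. It annihilates only bounded directions
  -- at first; density and continuity extend this to all directions.
  have hbdd : ∀ q₀ ∈ boundedDirections E C T, A q₀ = A q →
      ∃ ab ∈ normalizedMultipliers A, 0 ≤ pairing ab (R.curv Φ q₀, R.curv H q₀) := by
    intro q₀ hq₀ hAq₀
    have hq₀H : R.lin H q₀ = 0 := (congrArg Prod.snd hAq₀).trans hqH
    have hq₀Φ : ∀ i, R.lin Φ q₀ i ≤ 0 := fun i => by
      have : R.lin Φ q₀ = R.lin Φ q := congrArg Prod.fst hAq₀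
      rw [this]; exact hqΦ i
    obtain ⟨ab, hab, hk⟩ := exists_multiplier_of_not_solvable
      (A.toLinearMap ∘ₗ (boundedDirections E C T).subtype) (R.curv Φ q₀, R.curv H q₀) (by
        rintro hs ⟨q₁, hq₁Φ, hq₁H⟩
        obtain ⟨S, hS⟩ := LinearMap.exists_rightInverse_of_surjective
          ((R.lin H).toLinearMap ∘ₗ (boundedDirections E C T).subtype)
          (LinearMap.range_eq_top.2 hs)
        obtain ⟨M, hM0, hM⟩ := exists_uniform_bound S
        obtain ⟨x, c, hx, hHx, hΦx⟩ := R.exists_nearby_decrease hΦ hH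
          (((boundedDirections E C T).subtype ∘ₗ S).toContinuousLinearMap)
          (fun y => congrArg (fun f => f y) hS) hM0 hM hq₀ q₁.2 hq₀H hq₁H hq₀Φ hq₁Φ hε
        exact hmin x c hx hHx hΦx)
    refine ⟨ab, ⟨hab.1, hab.2.1, fun r => ?_⟩, hk⟩
    have hcl : IsClosed {r | pairing ab (A r) = 0} := by
      refine isClosed_eq (continuous_pairing.comp (continuous_const.prodMk A.continuous))
        continuous_const
    have hsub : (boundedDirections E C T : Set _) ⊆ {r | pairing ab (A r) = 0} :=
      fun r hr => hab.2.2 ⟨r, hr⟩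
    exact hcl.closure_subset_iff.2 hsub (dense_boundedDirections r)
  have hK := isCompact_normalizedMultipliers (A : _ → (ι → ℝ) × (κ → ℝ))
  -- The multiplier depends on `k`, so no single inequality passes to the limit. Compactness of the
  -- normalized multipliers provides a convergent subsequence instead.
  have hclosed : IsClosed {k : (ι → ℝ) × (κ → ℝ) |
      ∃ ab ∈ normalizedMultipliers A, 0 ≤ pairing ab k} := by
    have hc : IsClosed {p : ((ι → ℝ) × (κ → ℝ)) × ((ι → ℝ) × (κ → ℝ)) |
        p.1 ∈ normalizedMultipliers A ∧ 0 ≤ pairing p.1 p.2} :=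
      (hK.isClosed.preimage continuous_fst).inter (isClosed_le continuous_const continuous_pairing)
    rw [← isSeqClosed_iff_isClosed]
    intro k k₀ hk hlim
    choose ab hab hpos using hk
    obtain ⟨ab₀, hab₀, φ, hφ, hφlim⟩ := hK.tendsto_subseq hab
    refine ⟨ab₀, hab₀, ?_⟩
    have := continuous_pairing.continuousAt.tendsto.comp
      (hφlim.prodMk_nhds (hlim.comp hφ.tendsto_atTop))
    exact ge_of_tendsto' this fun n => hpos _
  have hcont : Continuous fun q => (R.curv Φ q, R.curv H q) :=
    (R.continuous_curv Φ).prodMk (R.continuous_curv H)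
  have := map_mem_closure (t := {k : (ι → ℝ) × (κ → ℝ) |
    ∃ ab ∈ normalizedMultipliers A, 0 ≤ pairing ab k}) hcont
      (mem_closure_fiber (boundedDirections E C T)
        dense_boundedDirections A q) fun d hd => hbdd d hd.1 hd.2
  rw [hclosed.closure_eq] at this
  exact this

end ReferenceTrajectory

/-! ### Integration by parts and the fundamental lemma -/

section IntegrationByParts

variable {E : Type*} [NormedAddCommGroup E] [NormedSpace ℝ E] {T : ℝ}

/-- The functions `f` and `k` are controlled only on `[0, T]`. They are replaced by their integral
representations, which are absolutely continuous there with a.e. derivatives `a` and `b`. -/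
theorem integral_deriv_mul_add_mul_deriv (hT : 0 ≤ T) {f k a b : ℝ → ℝ}
    (ha : Integrable a (timeMeasure T)) (hb : Integrable b (timeMeasure T))
    (hf : ∀ t ∈ Icc 0 T, f t = f 0 + ∫ s in (0 : ℝ)..t, a s)
    (hk : ∀ t ∈ Icc 0 T, k t = k 0 + ∫ s in (0 : ℝ)..t, b s) :
    ∫ t, (a t * k t + f t * b t) ∂timeMeasure T = f T * k T - f 0 * k 0 := by
  have ha' := (intervalIntegrable_iff_timeMeasure hT).2 ha
  have hb' := (intervalIntegrable_iff_timeMeasure hT).2 hb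
  have hac : ∀ {a : ℝ → ℝ} (r : ℝ), IntervalIntegrable a volume 0 T →
      AbsolutelyContinuousOnInterval (fun t => r + ∫ s in (0 : ℝ)..t, a s) 0 T := by
    intro a r ha
    have h1 : AbsolutelyContinuousOnInterval (fun _ : ℝ => r) 0 T :=
      (LipschitzWith.const r).lipschitzOnWith.absolutelyContinuousOnInterval
    exact h1.add (ha.absolutelyContinuousOnInterval_intervalIntegral (c := 0) (by simp))
  have hderiv : ∀ {a : ℝ → ℝ} (r : ℝ), IntervalIntegrable a volume 0 T →
      ∀ᵐ t, t ∈ uIcc 0 T → deriv (fun t => r + ∫ s in (0 : ℝ)..t, a s) t = a t := by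
    intro a r ha
    filter_upwards [ha.ae_hasDerivAt_integral] with t ht htT
    exact ((ht htT 0 (by simp)).const_add r).deriv
  have key := (hac (f 0) ha').integral_deriv_mul_eq_sub (hac (k 0) hb')
  have h0 : (0 : ℝ) ∈ Icc 0 T := ⟨le_rfl, hT⟩
  have h1 : T ∈ Icc 0 T := ⟨hT, le_rfl⟩
  rw [← hf T h1, ← hk T h1, ← hf 0 h0, ← hk 0 h0] at key
  rw [← key, intervalIntegral_eq_timeMeasure hT]
  refine integral_congr_ae ?_
  filter_upwards [ae_restrict_of_ae (hderiv (f 0) ha'), ae_restrict_of_ae (hderiv (k 0) hb'),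
    ae_timeMeasure_mem T] with t h2 h3 h4
  rw [uIcc_of_le hT] at h2 h3
  rw [h2 h4, h3 h4, ← hf t h4, ← hk t h4]

variable [FiniteDimensional ℝ E]

/-- Integration by parts for the duality pairing of absolutely continuous functions. -/
theorem integral_dual_apply (hT : 0 ≤ T) {x g : ℝ → E} {p h : ℝ → E →L[ℝ] ℝ}
    (hg : Integrable g (timeMeasure T)) (hh : Integrable h (timeMeasure T))
    (hx : ∀ t ∈ Icc 0 T, x t = x 0 + ∫ s in (0 : ℝ)..t, g s)
    (hp : ∀ t ∈ Icc 0 T, p t = p 0 + ∫ s in (0 : ℝ)..t, h s) :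
    ∫ t, (h t (x t) + p t (g t)) ∂timeMeasure T = p T (x T) - p 0 (x 0) := by
  have := FiniteDimensional.complete ℝ E
  let b := Module.finBasis ℝ E
  let co := fun i => (b.coord i).toContinuousLinearMap
  have hexp : ∀ (r : E →L[ℝ] ℝ) (y : E), r y = ∑ i, r (b i) * co i y := by
    intro r y
    conv_lhs => rw [← b.sum_repr y, map_sum]
    refine Finset.sum_congr rfl fun i _ => ?_
    rw [map_smul, smul_eq_mul, mul_comm]
    rfl
  have h0 : (0 : ℝ) ∈ Icc 0 T := ⟨le_rfl, hT⟩
  have hxi : ∀ i, ∀ t ∈ Icc 0 T, co i (x t) = co i (x 0) + ∫ s in (0 : ℝ)..t, co i (g s) := by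
    intro i t ht
    rw [ContinuousLinearMap.intervalIntegral_comp_comm _
      (intervalIntegrable_of_timeMeasure hg h0 ht), ← map_add, ← hx t ht]
  have hpi : ∀ i, ∀ t ∈ Icc 0 T, p t (b i) = p 0 (b i) + ∫ s in (0 : ℝ)..t, h s (b i) := by
    intro i t ht
    have := ContinuousLinearMap.intervalIntegral_comp_comm
      (ContinuousLinearMap.apply ℝ ℝ (b i)) (intervalIntegrable_of_timeMeasure hh h0 ht)
    simp only [ContinuousLinearMap.apply_apply] at this
    rw [this, ← add_apply, ← hp t ht]
  have hgi : ∀ i, Integrable (fun t => co i (g t)) (timeMeasure T) :=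
    fun i => (co i).integrable_comp hg
  have hhi : ∀ i, Integrable (fun t => h t (b i)) (timeMeasure T) :=
    fun i => (ContinuousLinearMap.apply ℝ ℝ (b i)).integrable_comp hh
  have hcont : ∀ {f a : ℝ → ℝ}, Integrable a (timeMeasure T) →
      (∀ t ∈ Icc 0 T, f t = f 0 + ∫ s in (0 : ℝ)..t, a s) → ContinuousOn f (Icc 0 T) := by
    intro f a ha hf
    exact (continuousOn_const.add (continuousOn_primitive_timeMeasure ha)).congr hf
  have hmul : ∀ {f a : ℝ → ℝ}, Integrable a (timeMeasure T) → ContinuousOn f (Icc 0 T) →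
      Integrable (fun t => a t * f t) (timeMeasure T) := by
    intro f a ha hf
    exact IntegrableOn.mul_continuousOn ha hf isCompact_Icc
  rw [hexp (p T), hexp (p 0), ← Finset.sum_sub_distrib]
  rw [Finset.sum_congr rfl fun i _ => (integral_deriv_mul_add_mul_deriv hT (hhi i) (hgi i)
    (hpi i) (hxi i)).symm, ← integral_finsetSum]
  · refine integral_congr_ae (Eventually.of_forall fun t => ?_)
    simp only
    rw [hexp (h t), hexp (p t), Finset.sum_add_distrib]
  · intro i _
    refine (hmul (hhi i) (hcont (hgi i) (hxi i))).add ?_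
    simp_rw [mul_comm (p _ (b i))]
    exact hmul (hgi i) (hcont (hhi i) (hpi i))

end IntegrationByParts

/-- Testing with indicator functions times basis vectors shows that each coordinate has zero
integral over every measurable set. -/
theorem ae_eq_zero_of_forall_integral_apply_eq_zero {C : Type*} [NormedAddCommGroup C]
    [NormedSpace ℝ C] [FiniteDimensional ℝ C] {T : ℝ} {f : ℝ → C →L[ℝ] ℝ}
    (hf : Integrable f (timeMeasure T))
    (h : ∀ q : Lp C 2 (timeMeasure T), ∫ t, f t (q t) ∂timeMeasure T = 0) :
    f =ᵐ[timeMeasure T] 0 := by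
  let b := Module.finBasis ℝ C
  have hi : ∀ i, (fun t => f t (b i)) =ᵐ[timeMeasure T] 0 := by
    intro i
    have hint : Integrable (fun t => f t (b i)) (timeMeasure T) :=
      (ContinuousLinearMap.apply ℝ ℝ (b i)).integrable_comp hf
    refine hint.ae_eq_zero_of_forall_setIntegral_eq_zero fun s hs hμs => ?_
    rw [← h (indicatorConstLp 2 hs hμs.ne (b i)), ← integral_indicator hs]
    refine integral_congr_ae ?_
    filter_upwards [indicatorConstLp_coeFn (p := 2) (hs := hs) (hμs := hμs.ne) (c := b i)]
      with t ht
    rw [ht]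
    by_cases hts : t ∈ s <;> simp [hts]
  filter_upwards [ae_all_iff.2 hi] with t ht
  refine ContinuousLinearMap.coe_injective (b.ext fun i => ?_)
  exact ht i

/-! ### The adjoint equation and the costate -/

namespace ReferenceTrajectory

variable {E C : Type*} [NormedAddCommGroup E] [NormedSpace ℝ E] [NormedAddCommGroup C]
  [NormedSpace ℝ C] {T : ℝ} (R : ReferenceTrajectory E C T)
  [FiniteDimensional ℝ E] [FiniteDimensional ℝ C]

/-- The right-hand side of the adjoint equation. -/
def adjointRHS (p : C(Icc 0 T, E →L[ℝ] ℝ)) (t : ℝ) : E →L[ℝ] ℝ :=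
  -(extendIcc R.hT p t ∘L (fderiv ℝ R.F (R.pt t) ∘L ContinuousLinearMap.inl ℝ E C))

/-- The solutions of the adjoint equation. -/
def IsAdjoint (p : C(Icc 0 T, E →L[ℝ] ℝ)) : Prop :=
  p = ContinuousMap.const _ (p ⟨0, le_rfl, R.hT⟩) + primitive T (R.adjointRHS p)

theorem continuous_adjointCoeff : Continuous fun w => (-(ContinuousLinearMap.compL ℝ E E ℝ).flip)
    ((fderiv ℝ R.F w).comp (ContinuousLinearMap.inl ℝ E C)) :=
  (-(ContinuousLinearMap.compL ℝ E E ℝ).flip).continuous.comp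
    (R.continuous_fderiv.clm_comp continuous_const)

/-- The coefficient of the adjoint equation. -/
def adjointCoeff : Lp ((E →L[ℝ] ℝ) →L[ℝ] E →L[ℝ] ℝ) ⊤ (timeMeasure T) :=
  (R.memLp_comp_pt (Y := (E →L[ℝ] ℝ) →L[ℝ] E →L[ℝ] ℝ) R.continuous_adjointCoeff ⊤).toLp

theorem coeFn_adjointCoeff (p : C(Icc 0 T, E →L[ℝ] ℝ)) :
    (fun t => R.adjointCoeff t (extendIcc R.hT p t)) =ᵐ[timeMeasure T] R.adjointRHS p := by
  filter_upwards [(R.memLp_comp_pt (Y := (E →L[ℝ] ℝ) →L[ℝ] E →L[ℝ] ℝ)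
    R.continuous_adjointCoeff ⊤).coeFn_toLp] with t ht
  rw [adjointCoeff, ht]
  rfl

theorem memLp_adjointRHS (p : C(Icc 0 T, E →L[ℝ] ℝ)) :
    MemLp (R.adjointRHS p) ⊤ (timeMeasure T) := by
  have h := (memLp_extendIcc R.hT p ⊤)
  have h2 : MemLp (fun t => (fderiv ℝ R.F (R.pt t)).comp (ContinuousLinearMap.inl ℝ E C)) ⊤
      (timeMeasure T) :=
    R.memLp_comp_pt (G := fun w => (fderiv ℝ R.F w).comp (ContinuousLinearMap.inl ℝ E C))
      (R.continuous_fderiv.clm_comp continuous_const) ⊤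
  exact ((ContinuousLinearMap.compL ℝ E E ℝ).memLp_of_bilin ⊤ h h2).neg

theorem integrable_adjointRHS (p : C(Icc 0 T, E →L[ℝ] ℝ)) :
    Integrable (R.adjointRHS p) (timeMeasure T) :=
  (R.memLp_adjointRHS p).integrable le_top

theorem exists_isAdjoint (p₀ : E →L[ℝ] ℝ) :
    ∃ p, R.IsAdjoint p ∧ p ⟨0, le_rfl, R.hT⟩ = p₀ := by
  refine ⟨volterraResolvent R.hT R.adjointCoeff (ContinuousMap.const _ p₀), ?_⟩
  set p := volterraResolvent R.hT R.adjointCoeff (ContinuousMap.const _ p₀) with hp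
  have h : p = ContinuousMap.const _ p₀ + primitive T (R.adjointRHS p) := by
    rw [← primitive_congr (R.coeFn_adjointCoeff p), ← volterra_eq_primitive]
    exact volterraResolvent_eq R.hT R.adjointCoeff _
  have h0 : p ⟨0, le_rfl, R.hT⟩ = p₀ := by
    rw [h, ContinuousMap.add_apply, primitive_zero R.hT]; simp
  refine ⟨?_, h0⟩
  unfold IsAdjoint
  rw [h0]
  exact h

theorem eq_integral_of_eq_primitive {F : Type*} [NormedAddCommGroup F] [NormedSpace ℝ F]
    (hT : 0 ≤ T) {x : C(Icc 0 T, F)} {ξ : F} {g : ℝ → F} (hg : Integrable g (timeMeasure T))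
    (hx : x = ContinuousMap.const _ ξ + primitive T g) :
    ∀ t ∈ Icc 0 T, extendIcc hT x t = extendIcc hT x 0 + ∫ s in (0 : ℝ)..t, g s := by
  have h : ∀ t (ht : t ∈ Icc 0 T), x ⟨t, ht⟩ = ξ + ∫ s in (0 : ℝ)..t, g s := by
    intro t ht
    rw [hx, ContinuousMap.add_apply, primitive_apply hg]; rfl
  intro t ht
  have h0 : (0 : ℝ) ∈ Icc 0 T := ⟨le_rfl, hT⟩
  rw [extendIcc_of_mem hT x ht, extendIcc_of_mem hT x h0, h t ht, h 0 h0]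
  simp

/-- The pairing of a solution of the adjoint equation with a solution of the linearized equation. -/
theorem adjoint_pairing {p : C(Icc 0 T, E →L[ℝ] ℝ)} (hp : R.IsAdjoint p) {x : C(Icc 0 T, E)} {ξ : E}
    {r : ℝ → E} (hr : Integrable r (timeMeasure T))
    (hx : x = ContinuousMap.const _ ξ +
      primitive T (fun t => fderiv ℝ R.F (R.pt t) (extendIcc R.hT x t, 0) + r t)) :
    p ⟨T, R.hT, le_rfl⟩ (x ⟨T, R.hT, le_rfl⟩) - p ⟨0, le_rfl, R.hT⟩ (x ⟨0, le_rfl, R.hT⟩) =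
      ∫ t, extendIcc R.hT p t (r t) ∂timeMeasure T := by
  have hg : Integrable (fun t => fderiv ℝ R.F (R.pt t) (extendIcc R.hT x t, 0) + r t)
      (timeMeasure T) := (R.integrable_A_apply x).add hr
  have := integral_dual_apply R.hT hg (R.integrable_adjointRHS p)
    (eq_integral_of_eq_primitive R.hT hg hx)
    (eq_integral_of_eq_primitive R.hT (R.integrable_adjointRHS p) hp)
  rw [extendIcc_of_mem R.hT p ⟨R.hT, le_rfl⟩, extendIcc_of_mem R.hT x ⟨R.hT, le_rfl⟩,
    extendIcc_of_mem R.hT p ⟨le_rfl, R.hT⟩, extendIcc_of_mem R.hT x ⟨le_rfl, R.hT⟩] at this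
  rw [← this]
  -- In the derivative of `p x` the contributions `-p F_x x` and `p F_x x` cancel, which leaves `p
  -- r`.
  refine integral_congr_ae (Eventually.of_forall fun t => ?_)
  simp [adjointRHS]

theorem adjoint_pairing_state {p : C(Icc 0 T, E →L[ℝ] ℝ)} (hp : R.IsAdjoint p)
    (q : E × Lp C 2 (timeMeasure T)) :
    p ⟨T, R.hT, le_rfl⟩ (R.state q ⟨T, R.hT, le_rfl⟩) - p ⟨0, le_rfl, R.hT⟩ q.1 =
      ∫ t, extendIcc R.hT p t (fderiv ℝ R.F (R.pt t) (0, q.2 t)) ∂timeMeasure T := by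
  rw [← R.adjoint_pairing hp (x := R.state q) (ξ := q.1) (R.integrable_forcing q.2), state_zero]
  refine (R.state_eq q).trans ?_
  congr 2
  funext t
  rw [← map_add]
  simp

theorem adjoint_pairing_second {p : C(Icc 0 T, E →L[ℝ] ℝ)} (hp : R.IsAdjoint p)
    (q : E × Lp C 2 (timeMeasure T)) :
    p ⟨T, R.hT, le_rfl⟩ (R.second q ⟨T, R.hT, le_rfl⟩) =
      ∫ t, extendIcc R.hT p t ((1 / 2 : ℝ) • fderiv ℝ (fderiv ℝ R.F) (R.pt t)
        (extendIcc R.hT (R.state q) t, q.2 t) (extendIcc R.hT (R.state q) t, q.2 t))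
        ∂timeMeasure T := by
  rw [← R.adjoint_pairing hp (x := R.second q) (ξ := 0) (R.integrable_quad q), second_zero]
  · simp
  · rw [show ContinuousMap.const (Icc 0 T) (0 : E) = 0 from rfl, zero_add]
    exact R.second_eq q

theorem integral_adjoint_zero (p : C(Icc 0 T, E →L[ℝ] ℝ)) :
    ∫ t, extendIcc R.hT p t (fderiv ℝ R.F (R.pt t) (0, (0 : Lp C 2 (timeMeasure T)) t))
      ∂timeMeasure T = 0 := by
  rw [← integral_zero ℝ ℝ (μ := timeMeasure T)]
  refine integral_congr_ae ?_
  filter_upwards [Lp.coeFn_zero C 2 (timeMeasure T)] with t ht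
  rw [ht]
  simp [Prod.mk_zero_zero]

/-- In finite dimension injectivity suffices. If the free motion from `ξ` ends at `0`, then
conservation of `p x` along every adjoint solution shows that all functionals `p(0)`, which are
arbitrary, vanish at `ξ`. -/
theorem surjective_transition :
    Function.Surjective fun ξ : E => R.state (ξ, 0) ⟨T, R.hT, le_rfl⟩ := by
  let Ψ : E →ₗ[ℝ] E := ((ContinuousMap.evalCLM ℝ (⟨T, R.hT, le_rfl⟩ : Icc 0 T)) ∘L R.state ∘L
    ContinuousLinearMap.inl ℝ E (Lp C 2 (timeMeasure T))).toLinearMap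
  refine (LinearMap.injective_iff_surjective (f := Ψ)).1
    (LinearMap.ker_eq_bot.1 (LinearMap.ker_eq_bot'.2 fun ξ hξ => ?_))
  refine SeparatingDual.eq_zero_of_forall_dual_eq_zero (R := ℝ) fun π => ?_
  obtain ⟨p, hp, hp0⟩ := R.exists_isAdjoint π
  have h := R.adjoint_pairing_state hp (ξ, 0)
  rw [R.integral_adjoint_zero, hp0] at h
  have hξ' : R.state (ξ, 0) ⟨T, R.hT, le_rfl⟩ = 0 := hξ
  rw [hξ', map_zero, zero_sub, neg_eq_zero] at h
  exact h

/-- The existence of a costate for functionals of the endpoints that vanish on the solutions of the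
linearized system. -/
theorem exists_costate {d₀ d₁ : E →L[ℝ] ℝ}
    (hd : ∀ q, d₀ q.1 + d₁ (R.state q ⟨T, R.hT, le_rfl⟩) = 0) :
    ∃ p, R.IsAdjoint p ∧ p ⟨0, le_rfl, R.hT⟩ = -d₀ ∧ p ⟨T, R.hT, le_rfl⟩ = d₁ ∧
      ∀ᵐ t ∂timeMeasure T, ∀ c, extendIcc R.hT p t (fderiv ℝ R.F (R.pt t) (0, c)) = 0 := by
  obtain ⟨p, hp, hp0⟩ := R.exists_isAdjoint (-d₀)
  -- With `p(0) = -d₀` prescribed, this identity carries both remaining claims: zero control and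
  -- arbitrary final states give `p(T) = d₁`, after which zero initial value and arbitrary controls
  -- give stationarity.
  have hq : ∀ q, p ⟨T, R.hT, le_rfl⟩ (R.state q ⟨T, R.hT, le_rfl⟩) -
      d₁ (R.state q ⟨T, R.hT, le_rfl⟩) =
      ∫ t, extendIcc R.hT p t (fderiv ℝ R.F (R.pt t) (0, q.2 t)) ∂timeMeasure T := by
    intro q
    rw [← R.adjoint_pairing_state hp, hp0]
    have := hd q
    simp only [neg_apply]
    linarith
  have hpT : p ⟨T, R.hT, le_rfl⟩ = d₁ := by
    ext y
    obtain ⟨ξ, rfl⟩ := R.surjective_transition y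
    have := hq (ξ, 0)
    rw [R.integral_adjoint_zero] at this
    exact sub_eq_zero.1 this
  refine ⟨p, hp, hp0, hpT, ?_⟩
  have hB : MemLp (fun t => (fderiv ℝ R.F (R.pt t)).comp (ContinuousLinearMap.inr ℝ E C)) ⊤
      (timeMeasure T) :=
    R.memLp_comp_pt (G := fun w => (fderiv ℝ R.F w).comp (ContinuousLinearMap.inr ℝ E C))
      (R.continuous_fderiv.clm_comp continuous_const) ⊤
  have hf : Integrable (fun t => extendIcc R.hT p t ∘L
      ((fderiv ℝ R.F (R.pt t)).comp (ContinuousLinearMap.inr ℝ E C))) (timeMeasure T) :=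
    ((ContinuousLinearMap.compL ℝ C E ℝ).memLp_of_bilin ⊤ (memLp_extendIcc R.hT p ⊤)
      hB).integrable le_top
  have := ae_eq_zero_of_forall_integral_apply_eq_zero hf fun c => by
    have := hq (0, c)
    rw [hpT, sub_self] at this
    exact this.symm
  filter_upwards [this] with t ht c
  have := congrArg (fun f => f c) ht
  exact this

end ReferenceTrajectory

/-! ### Sobolev functions, primitives and almost everywhere derivatives -/

section Sobolev

variable {E : Type*} [NormedAddCommGroup E] [NormedSpace ℝ E] [CompleteSpace E] {T : ℝ}

theorem ae_hasDerivAt_of_eq_integral {x g : ℝ → E} (hg : Integrable g (timeMeasure T))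
    (hx : ∀ t ∈ Icc 0 T, x t = x 0 + ∫ s in (0 : ℝ)..t, g s) :
    ∀ᵐ t ∂timeMeasure T, HasDerivAt x (g t) t := by
  rcases le_or_gt 0 T with hT | hT
  -- Nothing is known about `x` outside `[0, T]`, so a two-sided derivative is available only at
  -- interior points; the endpoints are discarded as a null set.
  · have h0 : ∀ᵐ t : ℝ, t ≠ 0 := by simp [ae_iff, measure_singleton]
    have h1 : ∀ᵐ t : ℝ, t ≠ T := by simp [ae_iff, measure_singleton]
    filter_upwards [ae_restrict_of_ae
      ((intervalIntegrable_iff_timeMeasure hT).2 hg).ae_hasDerivAt_integral,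
      ae_restrict_of_ae h0, ae_restrict_of_ae h1, ae_timeMeasure_mem T] with t ht ht0 ht1 htm
    rw [uIcc_of_le hT] at ht
    have hd := (ht htm 0 ⟨le_rfl, hT⟩).const_add (x 0)
    refine hd.congr_of_eventuallyEq ?_
    filter_upwards [Icc_mem_nhds (lt_of_le_of_ne htm.1 ht0.symm) (lt_of_le_of_ne htm.2 ht1)]
      with s hs using hx s hs
  · have : timeMeasure T = 0 := by
      rw [timeMeasure, Icc_eq_empty (not_le.2 hT), Measure.restrict_empty]
    rw [this]
    exact ae_zero.symm ▸ Filter.eventually_bot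

/-- `MemW1` provides some density, while the differential equation provides an a.e. derivative.
Lebesgue differentiation identifies the two, which turns the differential equation into an integral
equation. -/
theorem MemW1.eq_integral {p : ENNReal} (hp : 1 ≤ p) {x f : ℝ → E} (hx : MemW1 p T x)
    (hf : ∀ᵐ t ∂timeMeasure T, HasDerivAt x (f t) t) :
    MemLp f p (timeMeasure T) ∧ ∀ t ∈ Icc 0 T, x t = x 0 + ∫ s in (0 : ℝ)..t, f s := by
  obtain ⟨g, hg, hxg⟩ := hx
  have h : g =ᵐ[timeMeasure T] f := by
    filter_upwards [ae_hasDerivAt_of_eq_integral (hg.integrable hp) hxg, hf] with t h1 h2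
    exact h1.unique h2
  refine ⟨(memLp_congr_ae h).1 hg, fun t ht => ?_⟩
  rw [← intervalIntegral_congr_timeMeasure h ht]
  exact hxg t ht

theorem MemW1.continuousOn {p : ENNReal} (hp : 1 ≤ p) {x : ℝ → E} (hx : MemW1 p T x) :
    ContinuousOn x (Icc 0 T) := by
  obtain ⟨g, hg, hxg⟩ := hx
  exact (continuousOn_const.add (continuousOn_primitive_timeMeasure (hg.integrable hp))).congr hxg

/-- The restriction of a function to `[0, T]` as a continuous function. -/
def restrictIcc {x : ℝ → E} (hx : ContinuousOn x (Icc 0 T)) : C(Icc 0 T, E) :=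
  ⟨fun t => x t, continuousOn_iff_continuous_domRestrict.1 hx⟩

theorem restrictIcc_apply {x : ℝ → E} (hx : ContinuousOn x (Icc 0 T)) (t : Icc 0 T) :
    restrictIcc hx t = x t := rfl

theorem extendIcc_restrictIcc (hT : 0 ≤ T) {x : ℝ → E} (hx : ContinuousOn x (Icc 0 T)) {t : ℝ}
    (ht : t ∈ Icc 0 T) : extendIcc hT (restrictIcc hx) t = x t := by
  rw [extendIcc_of_mem hT _ ht]; rfl

theorem restrictIcc_eq_primitive {x g : ℝ → E} (hx : ContinuousOn x (Icc 0 T))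
    (hg : Integrable g (timeMeasure T))
    (hxg : ∀ t ∈ Icc 0 T, x t = x 0 + ∫ s in (0 : ℝ)..t, g s) :
    restrictIcc hx = ContinuousMap.const _ (x 0) + primitive T g := by
  ext t
  rw [ContinuousMap.add_apply, primitive_apply hg]
  exact hxg t t.2

end Sobolev

/-! ### Derivatives of compositions with linear maps -/

section SecondDerivatives

variable {X W Y Z : Type*} [NormedAddCommGroup X] [NormedSpace ℝ X] [NormedAddCommGroup W]
  [NormedSpace ℝ W] [NormedAddCommGroup Y] [NormedSpace ℝ Y] [NormedAddCommGroup Z]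
  [NormedSpace ℝ Z]

/-- One formula for all second derivatives of the Hamiltonian: `J` embeds the variable of the outer
differentiation, `K` that of the inner one, and `π` is the costate. -/
theorem fderiv_clm_comp_fderiv_comp {F : W → Y} (hF : ContDiff ℝ 2 F) (π : Y →L[ℝ] Z) {j : X → W}
    {J : X →L[ℝ] W} {x : X} (hj : HasFDerivAt j J x) {X' : Type*} [NormedAddCommGroup X']
    [NormedSpace ℝ X'] (K : X' →L[ℝ] W) (a : X) (b : X') :
    fderiv ℝ (fun y => π.comp ((fderiv ℝ F (j y)).comp K)) x a b =
      π (fderiv ℝ (fderiv ℝ F) (j x) (J a) (K b)) := by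
  have h1 : HasFDerivAt (fderiv ℝ F) (fderiv ℝ (fderiv ℝ F) (j x)) (j x) :=
    ((hF.fderiv_right (m := 1) (by norm_num)).differentiable (by norm_num) _).hasFDerivAt
  have h2 := h1.comp x hj
  have h3 : HasFDerivAt (fun y => (fderiv ℝ F (j y)).comp K)
      (((ContinuousLinearMap.compL ℝ X' W Y).flip K).comp
        ((fderiv ℝ (fderiv ℝ F) (j x)).comp J)) x :=
    (((ContinuousLinearMap.compL ℝ X' W Y).flip K).hasFDerivAt).comp x h2
  have h4 : HasFDerivAt (fun y => π.comp ((fderiv ℝ F (j y)).comp K))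
      ((ContinuousLinearMap.compL ℝ X' Y Z π).comp (((ContinuousLinearMap.compL ℝ X' W Y).flip
        K).comp ((fderiv ℝ (fderiv ℝ F) (j x)).comp J))) x :=
    ((ContinuousLinearMap.compL ℝ X' Y Z π).hasFDerivAt).comp x h3
  rw [h4.fderiv]
  rfl

theorem fderiv_clm_apply_comp {F : W → Y} (hF : ContDiff ℝ 2 F) (π : Y →L[ℝ] Z) (w : W) :
    fderiv ℝ (fun y => π (F y)) w = π.comp (fderiv ℝ F w) :=
  (π.hasFDerivAt.comp w (hF.differentiable (by norm_num) w).hasFDerivAt).fderiv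

theorem fderiv_fderiv_clm_comp {F : W → Y} (hF : ContDiff ℝ 2 F) (π : Y →L[ℝ] Z) (w a b : W) :
    fderiv ℝ (fderiv ℝ (fun y => π (F y))) w a b = π (fderiv ℝ (fderiv ℝ F) w a b) := by
  have e : fderiv ℝ (fun y => π (F y)) =
      fun y => π.comp ((fderiv ℝ F (id y)).comp (ContinuousLinearMap.id ℝ W)) := by
    funext y; rw [fderiv_clm_apply_comp hF]; rfl
  rw [e, fderiv_clm_comp_fderiv_comp hF π (hasFDerivAt_id w)]
  rfl

end SecondDerivatives

/-! ### Derivatives of the dynamics and of the Hamiltonian -/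

namespace ControlProblem

variable {n l m dφ dη : ℕ} (P : ControlProblem n l m dφ dη)

/-- The dynamics as a function of the pair of state and controls. -/
def dyn (w : Vec n × (Vec l × Vec m)) : Vec n := P.F w.1 w.2.1 w.2.2

/-- The cost and the inequality constraints. -/
def Φ (z : Vec n × Vec n) (i : Fin (dφ + 1)) : ℝ := P.φ i z

/-- The equality constraints. -/
def eqs (z : Vec n × Vec n) (j : Fin dη) : ℝ := P.η j z

variable {P}

theorem IsRegular.contDiff_dyn (h : P.IsRegular) : ContDiff ℝ 2 P.dyn := by
  have hf : ∀ i, ContDiff ℝ 2 fun w : Vec n × (Vec l × Vec m) => P.f i (w.1, w.2.1) := fun i =>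
    (h.1 i).1.comp (contDiff_fst.prodMk (contDiff_fst.comp contDiff_snd))
  unfold dyn F
  refine (hf 0).add (ContDiff.sum fun i _ => ?_)
  have h1 : ContDiff ℝ 2 fun w : Vec n × (Vec l × Vec m) => w.2.2 :=
    contDiff_snd.comp contDiff_snd
  have h2 : ContDiff ℝ 2 fun w : Vec n × (Vec l × Vec m) => w.2.2 i :=
    (EuclideanSpace.proj (𝕜 := ℝ) i : Vec m →L[ℝ] ℝ).contDiff.comp h1
  exact h2.smul (hf i.succ)

theorem IsRegular.contDiff_Φ (h : P.IsRegular) : ContDiff ℝ 2 P.Φ :=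
  contDiff_pi.2 fun i => (h.2.1 i).1

theorem IsRegular.contDiff_eqs (h : P.IsRegular) : ContDiff ℝ 2 P.eqs :=
  contDiff_pi.2 fun j => (h.2.2 j).1

/-- The embedding of the states. -/
abbrev inX (n l m : ℕ) : Vec n →L[ℝ] Vec n × (Vec l × Vec m) := ContinuousLinearMap.inl ℝ _ _

/-- The embedding of the nonlinear controls. -/
abbrev inU (n l m : ℕ) : Vec l →L[ℝ] Vec n × (Vec l × Vec m) :=
  (ContinuousLinearMap.inr ℝ _ _).comp (ContinuousLinearMap.inl ℝ _ _)

/-- The embedding of the affine controls. -/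
abbrev inV (n l m : ℕ) : Vec m →L[ℝ] Vec n × (Vec l × Vec m) :=
  (ContinuousLinearMap.inr ℝ _ _).comp (ContinuousLinearMap.inr ℝ _ _)

theorem hasFDerivAt_inX (x : Vec n) (u : Vec l) (v : Vec m) :
    HasFDerivAt (fun y => (y, (u, v))) (inX n l m) x :=
  hasFDerivAt_prodMk_left x (u, v)

theorem hasFDerivAt_inU (x : Vec n) (u : Vec l) (v : Vec m) :
    HasFDerivAt (fun y => (x, (y, v))) (inU n l m) u :=
  (hasFDerivAt_prodMk_right x (u, v)).comp u (hasFDerivAt_prodMk_left u v)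

theorem hasFDerivAt_inV (x : Vec n) (u : Vec l) (v : Vec m) :
    HasFDerivAt (fun y => (x, (u, y))) (inV n l m) v :=
  (hasFDerivAt_prodMk_right x (u, v)).comp v (hasFDerivAt_prodMk_right u v)

variable (μ : Multiplier n dφ dη) (x : Vec n) (u : Vec l) (v : Vec m) (t : ℝ)

theorem IsRegular.hasFDerivAt_dyn (hreg : P.IsRegular) (w : Vec n × (Vec l × Vec m)) :
    HasFDerivAt P.dyn (fderiv ℝ P.dyn w) w :=
  (hreg.contDiff_dyn.differentiable (by norm_num) w).hasFDerivAt

theorem IsRegular.hasFDerivAt_x (hreg : P.IsRegular) : HasFDerivAt (fun y => P.F y u v)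
    ((fderiv ℝ P.dyn (x, (u, v))).comp (inX n l m)) x := by
  have h := hreg.hasFDerivAt_dyn (x, (u, v))
  exact HasFDerivAt.comp x h (hasFDerivAt_inX x u v)

theorem IsRegular.fderiv_x (hreg : P.IsRegular) :
    fderiv ℝ (fun y => P.F y u v) x = (fderiv ℝ P.dyn (x, (u, v))).comp (inX n l m) :=
  (hreg.hasFDerivAt_x x u v).fderiv

theorem IsRegular.hasFDerivAt_u (hreg : P.IsRegular) : HasFDerivAt (fun y => P.F x y v)
    ((fderiv ℝ P.dyn (x, (u, v))).comp (inU n l m)) u := by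
  have h := hreg.hasFDerivAt_dyn (x, (u, v))
  exact HasFDerivAt.comp u h (hasFDerivAt_inU x u v)

theorem IsRegular.fderiv_u (hreg : P.IsRegular) :
    fderiv ℝ (fun y => P.F x y v) u = (fderiv ℝ P.dyn (x, (u, v))).comp (inU n l m) :=
  (hreg.hasFDerivAt_u x u v).fderiv

theorem IsRegular.hasFDerivAt_v (hreg : P.IsRegular) : HasFDerivAt (fun y => P.F x u y)
    ((fderiv ℝ P.dyn (x, (u, v))).comp (inV n l m)) v := by
  have h := hreg.hasFDerivAt_dyn (x, (u, v))
  exact HasFDerivAt.comp v h (hasFDerivAt_inV x u v)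

theorem IsRegular.fderiv_v (hreg : P.IsRegular) :
    fderiv ℝ (fun y => P.F x u y) v = (fderiv ℝ P.dyn (x, (u, v))).comp (inV n l m) :=
  (hreg.hasFDerivAt_v x u v).fderiv

theorem IsRegular.linearizedRHS_eq (hreg : P.IsRegular) (wh w : Triple n l m) (t : ℝ) :
    P.linearizedRHS wh w t =
      fderiv ℝ P.dyn (wh.x t, (wh.u t, wh.v t)) (w.x t, (w.u t, w.v t)) := by
  rw [linearizedRHS, hreg.fderiv_x, hreg.fderiv_u, hreg.fderiv_v]
  simp only [ContinuousLinearMap.comp_apply, ← map_add]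
  simp

theorem IsRegular.Hx_eq (hreg : P.IsRegular) :
    P.Hx μ x u v t = (μ.p t).comp ((fderiv ℝ P.dyn (x, (u, v))).comp (inX n l m)) :=
  ((μ.p t).hasFDerivAt.comp x (hreg.hasFDerivAt_x x u v)).fderiv

theorem IsRegular.Hu_eq (hreg : P.IsRegular) :
    P.Hu μ x u v t = (μ.p t).comp ((fderiv ℝ P.dyn (x, (u, v))).comp (inU n l m)) :=
  ((μ.p t).hasFDerivAt.comp u (hreg.hasFDerivAt_u x u v)).fderiv

theorem IsRegular.Hv_eq (hreg : P.IsRegular) :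
    P.Hv μ x u v t = (μ.p t).comp ((fderiv ℝ P.dyn (x, (u, v))).comp (inV n l m)) :=
  ((μ.p t).hasFDerivAt.comp v (hreg.hasFDerivAt_v x u v)).fderiv

/-- The dynamics are affine in `v`, so `F_v` does not depend on `v`. This is why the second
variation contains no term quadratic in `v̄`. -/
theorem IsRegular.fderiv_fderiv_v (hreg : P.IsRegular) (b b' : Vec m) :
    fderiv ℝ (fderiv ℝ P.dyn) (x, (u, v)) (inV n l m b) (inV n l m b') = 0 := by
  have h := fderiv_clm_comp_fderiv_comp hreg.contDiff_dyn (ContinuousLinearMap.id ℝ (Vec n))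
    (hasFDerivAt_inV x u v) (inV n l m) b b'
  rw [ContinuousLinearMap.id_apply] at h
  rw [← h]
  have hconst : ∀ y, (ContinuousLinearMap.id ℝ (Vec n)).comp
      ((fderiv ℝ P.dyn (x, (u, y))).comp (inV n l m)) =
      ∑ i : Fin m, (EuclideanSpace.proj (𝕜 := ℝ) i : Vec m →L[ℝ] ℝ).smulRight
        (P.f i.succ (x, u)) := by
    intro y
    rw [ContinuousLinearMap.id_comp, ← hreg.fderiv_v]
    have h1 : HasFDerivAt (fun y : Vec m => ∑ i : Fin m, y i • P.f i.succ (x, u))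
        (∑ i : Fin m, (EuclideanSpace.proj (𝕜 := ℝ) i : Vec m →L[ℝ] ℝ).smulRight
          (P.f i.succ (x, u))) y := by
      refine HasFDerivAt.fun_sum fun i _ => ?_
      exact ((EuclideanSpace.proj (𝕜 := ℝ) i : Vec m →L[ℝ] ℝ).smulRight
        (P.f i.succ (x, u))).hasFDerivAt
    exact (h1.const_add (P.f 0 (x, u))).fderiv
  simp_rw [hconst]
  simp

/-- In the full quadratic form each mixed term occurs twice by symmetry, which cancels the factor
one half; only the two pure terms keep it. -/
theorem IsRegular.secondVariationIntegrand_eq (hreg : P.IsRegular) (wh w : Triple n l m) :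
    P.secondVariationIntegrand wh μ w t = μ.p t ((1 / 2 : ℝ) •
      fderiv ℝ (fderiv ℝ P.dyn) (wh.x t, (wh.u t, wh.v t)) (w.x t, (w.u t, w.v t))
        (w.x t, (w.u t, w.v t))) := by
  have hw : (w.x t, (w.u t, w.v t)) = inX n l m (w.x t) + inU n l m (w.u t) +
      inV n l m (w.v t) := by simp
  simp only [secondVariationIntegrand]
  simp_rw [hreg.Hx_eq, hreg.Hu_eq, hreg.Hv_eq]
  rw [fderiv_clm_comp_fderiv_comp hreg.contDiff_dyn _ (hasFDerivAt_inX _ _ _),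
    fderiv_clm_comp_fderiv_comp hreg.contDiff_dyn _ (hasFDerivAt_inX _ _ _),
    fderiv_clm_comp_fderiv_comp hreg.contDiff_dyn _ (hasFDerivAt_inX _ _ _),
    fderiv_clm_comp_fderiv_comp hreg.contDiff_dyn _ (hasFDerivAt_inU _ _ _),
    fderiv_clm_comp_fderiv_comp hreg.contDiff_dyn _ (hasFDerivAt_inU _ _ _), hw]
  set D := fderiv ℝ (fderiv ℝ P.dyn) (wh.x t, (wh.u t, wh.v t)) with hD
  have hsymm : ∀ a b, D a b = D b a := fun a b =>
    (hreg.contDiff_dyn.contDiffAt.isSymmSndFDerivAt (by simp)) a b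
  have hvv := hreg.fderiv_fderiv_v (wh.x t) (wh.u t) (wh.v t) (w.v t) (w.v t)
  rw [← hD] at hvv
  simp only [map_add, add_apply, map_smul, smul_eq_mul, hvv]
  rw [hsymm (inU n l m (w.u t)) (inX n l m (w.x t)), hsymm (inV n l m (w.v t)) (inX n l m (w.x t)),
    hsymm (inV n l m (w.v t)) (inU n l m (w.u t))]
  simp only [map_zero]
  ring

end ControlProblem

/-! ### Translation between the control problem and the abstract system -/

theorem exists_bound_of_memLp_top {F : Type*} [NormedAddCommGroup F] {T : ℝ} {f : ℝ → F}
    (hf : MemLp f ⊤ (timeMeasure T)) : ∃ M : ℝ, ∀ᵐ t ∂timeMeasure T, ‖f t‖ ≤ M := by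
  refine ⟨‖hf.toLp‖, ?_⟩
  filter_upwards [ae_norm_le_norm_Lp_top hf.toLp, hf.coeFn_toLp] with t h1 h2
  rwa [← h2]

/-- The pairing with fixed coefficients as a pair of continuous linear functionals. -/
def coeffL {ι : Type*} [Fintype ι] (a : ι → ℝ) : (ι → ℝ) →L[ℝ] ℝ :=
  ∑ i, a i • ContinuousLinearMap.proj i

theorem coeffL_apply {ι : Type*} [Fintype ι] (a k : ι → ℝ) : coeffL a k = ∑ i, a i * k i := by
  simp [coeffL]

theorem Triple.MemW.memLp_controls {n l m : ℕ} {p : ENNReal} {T : ℝ} {w : Triple n l m}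
    (h : w.MemW p T) : MemLp (fun t => (w.u t, w.v t)) p (timeMeasure T) :=
  memLp_prod_iff.2 ⟨h.2.1, h.2.2⟩

namespace ControlProblem

variable {n l m dφ dη : ℕ} {P : ControlProblem n l m dφ dη} {wh : Triple n l m}

theorem IsTrajectory.continuousOn (hw : P.IsTrajectory wh) : ContinuousOn wh.x (Icc 0 P.T) :=
  hw.1.1.continuousOn le_top

/-- A trajectory of the control problem as a reference trajectory of the abstract system. -/
def reference (hT : 0 ≤ P.T) (hreg : P.IsRegular) (hw : P.IsTrajectory wh) :
    ReferenceTrajectory (Vec n) (Vec l × Vec m) P.T where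
  hT := hT
  F := P.dyn
  contDiff := hreg.contDiff_dyn
  x := restrictIcc hw.continuousOn
  c := fun t => (wh.u t, wh.v t)
  measurable_c := hw.1.2.1.1.prodMk hw.1.2.2.1
  bounded_c := by
    obtain ⟨M, hM⟩ := exists_bound_of_memLp_top hw.1.2.1
    obtain ⟨N, hN⟩ := exists_bound_of_memLp_top hw.1.2.2
    refine ⟨max M N, ?_⟩
    filter_upwards [hM, hN] with t h1 h2
    exact max_le_max h1 h2
  x_eq := by
    obtain ⟨h1, h2⟩ := hw.1.1.eq_integral le_top hw.2
    refine (restrictIcc_eq_primitive hw.continuousOn (h1.integrable le_top) h2).trans ?_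
    rw [restrictIcc_apply]
    congr 1
    refine primitive_congr ?_
    filter_upwards [ae_timeMeasure_mem P.T] with t ht
    rw [extendIcc_restrictIcc hT _ ht]
    rfl

section Bridge

variable (hT : 0 ≤ P.T) (hreg : P.IsRegular) (hw : P.IsTrajectory wh)

theorem reference_pt {t : ℝ} (ht : t ∈ Icc 0 P.T) :
    (reference hT hreg hw).pt t = (wh.x t, (wh.u t, wh.v t)) :=
  Prod.ext (extendIcc_restrictIcc hT hw.continuousOn ht) rfl

/-- The direction of the linearized system given by an element of `𝒲₂`. -/
def direction {w : Triple n l m} (h : w.MemW 2 P.T) :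
    Vec n × Lp (Vec l × Vec m) 2 (timeMeasure P.T) :=
  (w.x 0, h.memLp_controls.toLp)

theorem coeFn_direction {w : Triple n l m} (h : w.MemW 2 P.T) :
    (direction h).2 =ᵐ[timeMeasure P.T] fun t => (w.u t, w.v t) :=
  h.memLp_controls.coeFn_toLp

theorem state_direction {w : Triple n l m} (h : w.MemW 2 P.T)
    (hlin : ∀ᵐ t ∂timeMeasure P.T, HasDerivAt w.x (P.linearizedRHS wh w t) t) :
    (reference hT hreg hw).state (direction h) = restrictIcc (h.1.continuousOn (by norm_num)) := by
  obtain ⟨h1, h2⟩ := h.1.eq_integral (by norm_num) hlin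
  symm
  refine (reference hT hreg hw).eq_state ?_
  refine (restrictIcc_eq_primitive _ (h1.integrable (by norm_num)) h2).trans ?_
  congr 1
  refine primitive_congr ?_
  filter_upwards [ae_timeMeasure_mem P.T, coeFn_direction h] with t ht hc
  have hc' : ((h.memLp_controls.toLp : Lp (Vec l × Vec m) 2 (timeMeasure P.T)) : ℝ → _) t =
      (w.u t, w.v t) := hc
  rw [hreg.linearizedRHS_eq, extendIcc_restrictIcc _ _ ht, reference_pt hT hreg hw ht, hc']
  rfl

theorem ends_state_direction {w : Triple n l m} (h : w.MemW 2 P.T)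
    (hlin : ∀ᵐ t ∂timeMeasure P.T, HasDerivAt w.x (P.linearizedRHS wh w t) t) :
    ReferenceTrajectory.ends hT (Vec n) ((reference hT hreg hw).state (direction h)) =
      P.endpoints w := by
  rw [state_direction hT hreg hw h hlin]; rfl

theorem fderiv_Φ_apply (hreg : P.IsRegular) (z e : Vec n × Vec n) (i : Fin (dφ + 1)) :
    fderiv ℝ P.Φ z e i = fderiv ℝ (P.φ i) z e := by
  have := fderiv_clm_apply_comp hreg.contDiff_Φ (ContinuousLinearMap.proj (R := ℝ) i) z
  exact (congrArg (fun f => f e) this).symm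

theorem fderiv_eqs_apply (hreg : P.IsRegular) (z e : Vec n × Vec n) (j : Fin dη) :
    fderiv ℝ P.eqs z e j = fderiv ℝ (P.η j) z e := by
  have := fderiv_clm_apply_comp hreg.contDiff_eqs (ContinuousLinearMap.proj (R := ℝ) j) z
  exact (congrArg (fun f => f e) this).symm

theorem endpointLagrangian_eq (μ : Multiplier n dφ dη) :
    P.endpointLagrangian μ = fun z => coeffL μ.α (P.Φ z) + coeffL μ.β (P.eqs z) := by
  funext z
  rw [coeffL_apply, coeffL_apply]; rfl

theorem contDiff_endpointLagrangian (hreg : P.IsRegular) (μ : Multiplier n dφ dη) :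
    ContDiff ℝ 2 (P.endpointLagrangian μ) := by
  rw [endpointLagrangian_eq]
  exact ((coeffL μ.α).contDiff.comp hreg.contDiff_Φ).add
    ((coeffL μ.β).contDiff.comp hreg.contDiff_eqs)

theorem fderiv_endpointLagrangian (hreg : P.IsRegular) (μ : Multiplier n dφ dη)
    (z : Vec n × Vec n) : fderiv ℝ (P.endpointLagrangian μ) z =
      (coeffL μ.α).comp (fderiv ℝ P.Φ z) + (coeffL μ.β).comp (fderiv ℝ P.eqs z) := by
  rw [endpointLagrangian_eq, ← fderiv_clm_apply_comp hreg.contDiff_Φ,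
    ← fderiv_clm_apply_comp hreg.contDiff_eqs]
  exact fderiv_add
    (((coeffL μ.α).contDiff.comp hreg.contDiff_Φ).differentiable (by norm_num) z)
    (((coeffL μ.β).contDiff.comp hreg.contDiff_eqs).differentiable (by norm_num) z)

theorem fderiv_endpointLagrangian_apply (hreg : P.IsRegular) (μ : Multiplier n dφ dη)
    (z e : Vec n × Vec n) : fderiv ℝ (P.endpointLagrangian μ) z e =
      pairing (μ.α, μ.β) (fderiv ℝ P.Φ z e, fderiv ℝ P.eqs z e) := by
  rw [fderiv_endpointLagrangian hreg]
  simp only [add_apply, ContinuousLinearMap.comp_apply, coeffL_apply]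
  rfl

theorem fderiv_fderiv_endpointLagrangian_apply (hreg : P.IsRegular) (μ : Multiplier n dφ dη)
    (z e e' : Vec n × Vec n) : fderiv ℝ (fderiv ℝ (P.endpointLagrangian μ)) z e e' =
      pairing (μ.α, μ.β)
        (fderiv ℝ (fderiv ℝ P.Φ) z e e', fderiv ℝ (fderiv ℝ P.eqs) z e e') := by
  have h1 : ContDiff ℝ 2 fun z => coeffL μ.α (P.Φ z) := (coeffL μ.α).contDiff.comp hreg.contDiff_Φ
  have h2 : ContDiff ℝ 2 fun z => coeffL μ.β (P.eqs z) :=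
    (coeffL μ.β).contDiff.comp hreg.contDiff_eqs
  have e1 : fderiv ℝ (P.endpointLagrangian μ) =
      fun z => fderiv ℝ (fun z => coeffL μ.α (P.Φ z)) z +
        fderiv ℝ (fun z => coeffL μ.β (P.eqs z)) z := by
    funext z
    rw [endpointLagrangian_eq]
    exact fderiv_add (h1.differentiable (by norm_num) z) (h2.differentiable (by norm_num) z)
  have e2 : fderiv ℝ (fderiv ℝ (P.endpointLagrangian μ)) z =
      fderiv ℝ (fderiv ℝ (fun z => coeffL μ.α (P.Φ z))) z +
        fderiv ℝ (fderiv ℝ (fun z => coeffL μ.β (P.eqs z))) z := by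
    rw [e1]
    exact fderiv_add ((h1.fderiv_right (m := 1) (by norm_num)).differentiable (by norm_num) z)
      ((h2.fderiv_right (m := 1) (by norm_num)).differentiable (by norm_num) z)
  rw [e2, add_apply, add_apply, fderiv_fderiv_clm_comp hreg.contDiff_Φ,
    fderiv_fderiv_clm_comp hreg.contDiff_eqs, coeffL_apply, coeffL_apply]
  rfl

theorem fderiv_endpointLagrangian_left (hreg : P.IsRegular) (μ : Multiplier n dφ dη)
    (a b : Vec n) : fderiv ℝ (fun y => P.endpointLagrangian μ (y, b)) a =
      (fderiv ℝ (P.endpointLagrangian μ) (a, b)).comp (ContinuousLinearMap.inl ℝ _ _) := by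
  have h := ((contDiff_endpointLagrangian hreg μ).differentiable (by norm_num) (a, b)).hasFDerivAt
  exact (HasFDerivAt.comp (g := P.endpointLagrangian μ) (f := fun y => (y, b)) a h
    (hasFDerivAt_prodMk_left a b)).fderiv

theorem fderiv_endpointLagrangian_right (hreg : P.IsRegular) (μ : Multiplier n dφ dη)
    (a b : Vec n) : fderiv ℝ (fun y => P.endpointLagrangian μ (a, y)) b =
      (fderiv ℝ (P.endpointLagrangian μ) (a, b)).comp (ContinuousLinearMap.inr ℝ _ _) := by
  have h := ((contDiff_endpointLagrangian hreg μ).differentiable (by norm_num) (a, b)).hasFDerivAt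
  exact (HasFDerivAt.comp (g := P.endpointLagrangian μ) (f := fun y => (a, y)) b h
    (hasFDerivAt_prodMk_right a b)).fderiv

/-- Brings the annihilation condition on `(α, β)` into the form `d₀ ξ + d₁ x(T)` required by
`exists_costate`, with the transversality functionals as `d₀` and `d₁`. -/
theorem pairing_lin (hreg : P.IsRegular) (hw : P.IsTrajectory wh) (μ : Multiplier n dφ dη)
    (q : Vec n × Lp (Vec l × Vec m) 2 (timeMeasure P.T)) :
    pairing (μ.α, μ.β) ((reference hT hreg hw).lin P.Φ q, (reference hT hreg hw).lin P.eqs q) =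
      fderiv ℝ (fun y => P.endpointLagrangian μ (y, wh.x P.T)) (wh.x 0) q.1 +
        fderiv ℝ (fun y => P.endpointLagrangian μ (wh.x 0, y)) (wh.x P.T)
          ((reference hT hreg hw).state q ⟨P.T, hT, le_rfl⟩) := by
  rw [fderiv_endpointLagrangian_left hreg, fderiv_endpointLagrangian_right hreg,
    ContinuousLinearMap.comp_apply, ContinuousLinearMap.comp_apply, ← map_add]
  rw [ReferenceTrajectory.lin_apply, ReferenceTrajectory.lin_apply,
    ← fderiv_endpointLagrangian_apply hreg]
  congr 1
  rw [ReferenceTrajectory.ends_apply, (reference hT hreg hw).state_zero]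
  simp [reference]

/-- The costate of a multiplier solves the adjoint equation. -/
theorem isAdjoint_of_mem {μ : Multiplier n dφ dη} (hμ : μ ∈ P.multipliers wh) :
    (reference hT hreg hw).IsAdjoint (restrictIcc (hμ.1.continuousOn le_top)) := by
  obtain ⟨h1, h2⟩ := hμ.1.eq_integral le_top hμ.2.2.2.1
  refine (restrictIcc_eq_primitive _ (h1.integrable le_top) h2).trans ?_
  rw [restrictIcc_apply]
  congr 1
  refine primitive_congr ?_
  filter_upwards [ae_timeMeasure_mem P.T] with t ht
  rw [hreg.Hx_eq, ReferenceTrajectory.adjointRHS, extendIcc_restrictIcc _ _ ht,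
    reference_pt hT hreg hw ht]
  rfl

theorem costate_vanishes (hreg : P.IsRegular) {μ : Multiplier n dφ dη} (hμ : μ ∈ P.multipliers wh) :
    ∀ᵐ t ∂timeMeasure P.T, ∀ c : Vec l × Vec m,
      μ.p t (fderiv ℝ P.dyn (wh.x t, (wh.u t, wh.v t)) (0, c)) = 0 := by
  filter_upwards [hμ.2.2.2.2.2.2] with t ht c
  rw [hreg.Hu_eq, hreg.Hv_eq] at ht
  have h1 := congrArg (fun f => f c.1) ht.1
  have h2 := congrArg (fun f => f c.2) ht.2
  simp only [ContinuousLinearMap.comp_apply, zero_apply] at h1 h2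
  have e : ((0, c) : Vec n × (Vec l × Vec m)) = inU n l m c.1 + inV n l m c.2 := by simp
  rw [e, map_add, map_add]
  simp only [ContinuousLinearMap.comp_apply]
  rw [h1, h2, add_zero]

/-- Transversality turns the pairing into `p(T) x(T) - p(0) x(0)`. By the adjoint equation this is
the integral of `p F_c c`, which vanishes by stationarity. -/
theorem mem_normalizedMultipliers {μ : Multiplier n dφ dη} (hμ : μ ∈ P.multipliers wh) :
    (μ.α, μ.β) ∈ normalizedMultipliers fun q =>
      ((reference hT hreg hw).lin P.Φ q, (reference hT hreg hw).lin P.eqs q) := by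
  refine ⟨hμ.2.1, hμ.2.2.1, fun q => ?_⟩
  rw [pairing_lin hT hreg hw]
  have h := (reference hT hreg hw).adjoint_pairing_state (isAdjoint_of_mem hT hreg hw hμ) q
  have h0 := hμ.2.2.2.2.1
  have h1 := hμ.2.2.2.2.2.1
  have hz : ∫ t, extendIcc (reference hT hreg hw).hT (restrictIcc (hμ.1.continuousOn le_top)) t
      (fderiv ℝ (reference hT hreg hw).F ((reference hT hreg hw).pt t) (0, q.2 t))
      ∂timeMeasure P.T = 0 := by
    refine integral_eq_zero_of_ae ?_
    filter_upwards [ae_timeMeasure_mem P.T, costate_vanishes hreg hμ] with t ht hc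
    rw [extendIcc_restrictIcc _ _ ht, reference_pt hT hreg hw ht]
    exact hc _
  rw [hz, restrictIcc_apply, restrictIcc_apply, h0, h1, neg_apply] at h
  linarith

/-- The second variation as the pairing of the multiplier with the second order terms. -/
theorem secondVariation_eq_pairing {μ : Multiplier n dφ dη} (hμ : μ ∈ P.multipliers wh)
    {w : Triple n l m} (h : w.MemW 2 P.T)
    (hlin : ∀ᵐ t ∂timeMeasure P.T, HasDerivAt w.x (P.linearizedRHS wh w t) t) :
    P.secondVariation wh μ w = pairing (μ.α, μ.β) ((reference hT hreg hw).curv P.Φ (direction h),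
      (reference hT hreg hw).curv P.eqs (direction h)) := by
  have hends := ends_state_direction hT hreg hw h hlin
  have hcurv : ((reference hT hreg hw).curv P.Φ (direction h),
      (reference hT hreg hw).curv P.eqs (direction h)) =
      (fderiv ℝ P.Φ (P.endpoints wh) (ReferenceTrajectory.ends hT (Vec n)
        ((reference hT hreg hw).second (direction h))),
        fderiv ℝ P.eqs (P.endpoints wh) (ReferenceTrajectory.ends hT (Vec n)
        ((reference hT hreg hw).second (direction h)))) +
      (1 / 2 : ℝ) • (fderiv ℝ (fderiv ℝ P.Φ) (P.endpoints wh) (P.endpoints w) (P.endpoints w),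
        fderiv ℝ (fderiv ℝ P.eqs) (P.endpoints wh) (P.endpoints w) (P.endpoints w)) := by
    rw [← hends]; rfl
  rw [hcurv, pairing_add, pairing_smul, ← fderiv_endpointLagrangian_apply hreg,
    ← fderiv_fderiv_endpointLagrangian_apply hreg, secondVariation, iteratedFDeriv_two_apply,
    add_comm]
  congr 1
  rw [ReferenceTrajectory.ends_apply]
  -- `second` vanishes at time `0`, so only the terminal derivative of the endpoint Lagrangian
  -- contributes, and that is `p(T)`. The adjoint pairing then converts `p(T) second(T)` into the
  -- integral part of `Ω`.
  have h1 : fderiv ℝ (P.endpointLagrangian μ) (P.endpoints wh)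
      ((reference hT hreg hw).second (direction h) ⟨0, le_rfl, hT⟩,
        (reference hT hreg hw).second (direction h) ⟨P.T, hT, le_rfl⟩) =
      μ.p P.T ((reference hT hreg hw).second (direction h) ⟨P.T, hT, le_rfl⟩) := by
    rw [hμ.2.2.2.2.2.1, fderiv_endpointLagrangian_right hreg,
      (reference hT hreg hw).second_zero]
    rfl
  rw [h1, intervalIntegral_eq_timeMeasure hT]
  refine Eq.trans ?_ ((reference hT hreg hw).adjoint_pairing_second
    (isAdjoint_of_mem hT hreg hw hμ) (direction h)).symm
  refine integral_congr_ae ?_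
  filter_upwards [ae_timeMeasure_mem P.T, coeFn_direction h] with t ht hc
  rw [hreg.secondVariationIntegrand_eq, extendIcc_restrictIcc _ _ ht,
    state_direction hT hreg hw h hlin, extendIcc_restrictIcc _ _ ht, reference_pt hT hreg hw ht, hc]
  rfl

/-- Normalized multipliers of the linearized constraints lift to Lagrange multipliers. -/
theorem exists_mem_multipliers {ab : (Fin (dφ + 1) → ℝ) × (Fin dη → ℝ)}
    (hab : ab ∈ normalizedMultipliers fun q =>
      ((reference hT hreg hw).lin P.Φ q, (reference hT hreg hw).lin P.eqs q)) :
    ∃ μ ∈ P.multipliers wh, (μ.α, μ.β) = ab := by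
  let μ₀ : Multiplier n dφ dη := ⟨ab.1, ab.2, 0⟩
  obtain ⟨p, hp, hp0, hpT, hstat⟩ := (reference hT hreg hw).exists_costate
    (d₀ := fderiv ℝ (fun y => P.endpointLagrangian μ₀ (y, wh.x P.T)) (wh.x 0))
    (d₁ := fderiv ℝ (fun y => P.endpointLagrangian μ₀ (wh.x 0, y)) (wh.x P.T))
    (fun q => (pairing_lin hT hreg hw μ₀ q).symm.trans (hab.2.2 q))
  have hint := ReferenceTrajectory.eq_integral_of_eq_primitive hT
    ((reference hT hreg hw).integrable_adjointRHS p) hp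
  refine ⟨⟨ab.1, ab.2, extendIcc hT p⟩, ⟨⟨_, (reference hT hreg hw).memLp_adjointRHS p, hint⟩,
    hab.1, hab.2.1, ?_, ?_, ?_, ?_⟩, rfl⟩
  · filter_upwards [ae_timeMeasure_mem P.T,
      ae_hasDerivAt_of_eq_integral ((reference hT hreg hw).integrable_adjointRHS p) hint]
      with t ht hd
    rw [hreg.Hx_eq]
    rw [ReferenceTrajectory.adjointRHS, reference_pt hT hreg hw ht] at hd
    exact hd
  · exact (extendIcc_of_mem hT p ⟨le_rfl, hT⟩).trans hp0
  · exact (extendIcc_of_mem hT p ⟨hT, le_rfl⟩).trans hpT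
  · filter_upwards [ae_timeMeasure_mem P.T, hstat] with t ht hs
    rw [reference_pt hT hreg hw ht] at hs
    rw [hreg.Hu_eq, hreg.Hv_eq]
    constructor
    · ext a
      exact hs (a, 0)
    · ext a
      exact hs (0, a)

end Bridge

/-! ### Weak minimality excludes improvement, and the conclusion -/

theorem eLpNorm_top_lt_of_ae_bound {F : Type*} [NormedAddCommGroup F] {T : ℝ} {f : ℝ → F}
    {r ε : ℝ} (hε : 0 < ε) (hr : r < ε) (hf : ∀ᵐ t ∂timeMeasure T, ‖f t‖ ≤ r) :
    eLpNorm f ⊤ (timeMeasure T) < ENNReal.ofReal ε := by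
  rw [eLpNorm_exponent_top]
  refine (eLpNormEssSup_le_of_ae_bound hf).trans_lt ?_
  exact (ENNReal.ofReal_lt_ofReal_iff hε).2 hr

/-- A weak minimum cannot be improved by nearby trajectories of the abstract system. -/
theorem IsWeakMin.exists_not_decrease (hT : 0 ≤ P.T) (hreg : P.IsRegular)
    (hbd : P.ControlsAwayFromBoundary wh)
    (hact : ∀ i : Fin dφ, P.φ i.succ (P.endpoints wh) = 0) (hmin : P.IsWeakMin wh) :
    ∃ ε > 0, ∀ x c, (reference hT hreg hmin.1.1).IsNearbyTrajectory ε x c →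
      P.eqs (ReferenceTrajectory.ends hT (Vec n) x) = P.eqs (P.endpoints wh) →
      ¬∀ i, P.Φ (ReferenceTrajectory.ends hT (Vec n) x) i < P.Φ (P.endpoints wh) i := by
  obtain ⟨⟨htraj, hη, -, -⟩, ε, hε, hopt⟩ := id hmin
  obtain ⟨δ, hδ, hball⟩ := hbd
  -- Pairs of controls carry the maximum norm here, whereas the boundary condition uses the
  -- Euclidean one. Two components of size at most `δ / 2` satisfy `‖a‖² + ‖b‖² ≤ δ² / 2`.
  refine ⟨min (ε / 2) (δ / 2), by positivity, fun x c hx hH hΦ => ?_⟩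
  set ρ := min (ε / 2) (δ / 2) with hρ
  have hρ0 : 0 < ρ := by positivity
  have hρε : ρ < ε := (min_le_left _ _).trans_lt (by linarith)
  have hρδ : ρ ≤ δ / 2 := min_le_right _ _
  obtain ⟨hcm, hxeq, hxρ, hcρ⟩ := hx
  obtain ⟨M, hM⟩ := (reference hT hreg hmin.1.1).bounded_c
  have hcb : ∀ᵐ t ∂timeMeasure P.T, ‖c t‖ ≤ M + ρ := by
    filter_upwards [hM, hcρ] with t h1 h2
    have := norm_le_norm_add_norm_sub' (c t) ((reference hT hreg hmin.1.1).c t)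
    linarith
  have hcLp : MemLp c ⊤ (timeMeasure P.T) := memLp_top_of_bound hcm _ hcb
  let g : ℝ → Vec n := fun t => P.dyn (extendIcc hT x t, c t)
  have hg : MemLp g ⊤ (timeMeasure P.T) := by
    refine ReferenceTrajectory.memLp_comp_of_bounded (M := max ‖x‖ (M + ρ))
      (f := fun t => (extendIcc hT x t, c t)) hreg.contDiff_dyn.continuous
      ((aestronglyMeasurable_extendIcc hT x).prodMk hcm) ?_ ⊤
    filter_upwards [hcb] with t ht
    exact max_le_max (norm_extendIcc_le _ _ _) ht
  have hint := ReferenceTrajectory.eq_integral_of_eq_primitive hT (hg.integrable le_top) hxeq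
  let w : Triple n l m := ⟨extendIcc hT x, fun t => (c t).1, fun t => (c t).2⟩
  have hends : P.endpoints w = ReferenceTrajectory.ends hT (Vec n) x :=
    Prod.ext (extendIcc_of_mem hT x ⟨le_rfl, hT⟩) (extendIcc_of_mem hT x ⟨hT, le_rfl⟩)
  have hcρ1 : ∀ᵐ t ∂timeMeasure P.T, ‖w.u t - wh.u t‖ ≤ ρ := by
    filter_upwards [hcρ] with t ht using (le_max_left _ _).trans ht
  have hcρ2 : ∀ᵐ t ∂timeMeasure P.T, ‖w.v t - wh.v t‖ ≤ ρ := by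
    filter_upwards [hcρ] with t ht using (le_max_right _ _).trans ht
  have hfeas : P.IsFeasible w := by
    refine ⟨⟨⟨⟨g, hg, hint⟩, hcLp.fst, hcLp.snd⟩, ae_hasDerivAt_of_eq_integral
      (hg.integrable le_top) hint⟩, fun j => ?_, fun i => ?_, ?_⟩
    · rw [hends]
      exact (congrFun hH j).trans (hη j)
    · rw [hends]
      -- Since every inequality constraint is active along `wh`, decreasing it preserves
      -- feasibility.
      exact (hΦ i.succ).le.trans (hact i).le
    · filter_upwards [hball, hcρ1, hcρ2] with t h1 h2 h3
      have h4 := h1 (w.u t - wh.u t) (w.v t - wh.v t) (by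
        have := norm_nonneg (w.u t - wh.u t)
        have := norm_nonneg (w.v t - wh.v t)
        nlinarith)
      simpa using h4
  have hle := hopt w hfeas
    (eLpNorm_top_lt_of_ae_bound hε hρε (by
      filter_upwards [ae_timeMeasure_mem P.T] with t ht
      have h1 : w.x t - wh.x t = extendIcc hT (x - (reference hT hreg hmin.1.1).x) t := by
        rw [ReferenceTrajectory.extendIcc_sub]
        congr 1
        exact (extendIcc_restrictIcc hT htraj.continuousOn ht).symm
      rw [h1]
      exact (norm_extendIcc_le _ _ _).trans hxρ))
    (eLpNorm_top_lt_of_ae_bound hε hρε hcρ1) (eLpNorm_top_lt_of_ae_bound hε hρε hcρ2)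
  rw [hends] at hle
  exact absurd (hΦ 0) (not_lt.2 hle)

end ControlProblem

end

/-- Second order necessary condition for a weak minimum: the maximum over the set of Lagrange
multipliers of the second variation exists and is nonnegative, on the critical cone `𝒞` in the
`L^∞` setting and on the critical cone `𝒞₂` in the `L²` setting. -/
theorem theorem3p2 {n l m dφ dη : ℕ} (P : ControlProblem n l m dφ dη) (wh : Triple n l m)
    (hT : 0 < P.T) (hU : IsOpen P.U) (hV : IsOpen P.V) (hreg : P.IsRegular)
    (hbd : P.ControlsAwayFromBoundary wh)
    (hact : ∀ i : Fin dφ, P.φ i.succ (P.endpoints wh) = 0)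
    (hmin : P.IsWeakMin wh) :
    (∀ w ∈ P.criticalCone wh, ∃ M : ℝ,
      IsGreatest ((fun μ => P.secondVariation wh μ w) '' P.multipliers wh) M ∧ 0 ≤ M) ∧
    (∀ w ∈ P.criticalConeL2 wh, ∃ M : ℝ,
      IsGreatest ((fun μ => P.secondVariation wh μ w) '' P.multipliers wh) M ∧ 0 ≤ M) := by
  suffices h : ∀ w ∈ P.criticalConeL2 wh, ∃ M : ℝ,
      IsGreatest ((fun μ => P.secondVariation wh μ w) '' P.multipliers wh) M ∧ 0 ≤ M from
    ⟨fun w hw => h w hw.1, h⟩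
  rintro w ⟨hw2, hlin, hη, hφ⟩
  have hw := hmin.1.1
  set R := ControlProblem.reference hT.le hreg hw with hR
  set q := ControlProblem.direction hw2 with hq
  set k := (R.curv P.Φ q, R.curv P.eqs q) with hk
  have hends : ReferenceTrajectory.ends hT.le (Vec n) (R.state q) = P.endpoints w :=
    ControlProblem.ends_state_direction hT.le hreg hw hw2 hlin
  set K := normalizedMultipliers fun q => (R.lin P.Φ q, R.lin P.eqs q) with hK
  -- On `Λ` the value of `Ω` depends only on `(α, β)`, and exactly the normalized pairs in `K`
  -- occur. The maximum over an infinite dimensional set of triples thus becomes one over a compact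
  -- subset of a finite dimensional space.
  have himage : (fun μ => P.secondVariation wh μ w) '' P.multipliers wh =
      (fun ab => pairing ab k) '' K := by
    ext r
    constructor
    · rintro ⟨μ, hμ, rfl⟩
      exact ⟨(μ.α, μ.β), ControlProblem.mem_normalizedMultipliers hT.le hreg hw hμ,
        (ControlProblem.secondVariation_eq_pairing hT.le hreg hw hμ hw2 hlin).symm⟩
    · rintro ⟨ab, hab, rfl⟩
      obtain ⟨μ, hμ, rfl⟩ := ControlProblem.exists_mem_multipliers hT.le hreg hw hab
      exact ⟨μ, hμ, ControlProblem.secondVariation_eq_pairing hT.le hreg hw hμ hw2 hlin⟩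
  obtain ⟨ε, hε, hnot⟩ := hmin.exists_not_decrease hT.le hreg hbd hact
  obtain ⟨ab, hab, hpos⟩ := R.exists_multiplier hreg.contDiff_Φ hreg.contDiff_eqs hε hnot q
    (by
      funext j
      rw [R.lin_apply]
      exact (ControlProblem.fderiv_eqs_apply hreg _ _ j).trans (hends ▸ hη j))
    (fun i => by
      rw [R.lin_apply]
      exact (ControlProblem.fderiv_Φ_apply hreg _ _ i).trans_le (hends ▸ hφ i))
  have hcompact : IsCompact ((fun ab => pairing ab k) '' K) :=
    (isCompact_normalizedMultipliers _).image
      (continuous_pairing.comp (continuous_id.prodMk continuous_const))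
  obtain ⟨M, hM⟩ := hcompact.exists_isGreatest ⟨_, ab, hab, rfl⟩
  rw [himage]
  exact ⟨M, hM, hpos.trans (hM.2 ⟨ab, hab, rfl⟩)⟩
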